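/- **Setting.** Let $\mathcal X\subset\mathbb R^{d_x}$, $\mathcal Y\subset\mathbb R^{d_y}$ be nonempty, convex and compact, $A\in\mathbb R^{p\times d_x}$, $B\in\mathbb R^{p\times d_y}$, $c\in\mathbb R^p$, let $\unlhd$ be $\le$ (componentwise) or $=$, and put $\Lambda=\mathbb R^p_+$ or $\Lambda=\mathbb R^p$, respectively. Assume that for every $x\in\mathcal X$ there is $y\in\mathcal Y$ with $Ax+By\unlhd c$. Consider $\min_{x\in\mathcal X}\max_{y\in\mathcal Y,\,Ax+By\unlhd c} g(x,y)$ with $g(x,y)=\mathbb E_{\zeta\sim D}[G(x,y;\zeta)]$ and $\mathcal L_g(x,y,\lambda)=g(x,y)-\lambda^\top(Ax+By-c)$. For every sample $\zeta$, $G(\cdot,\cdot;\zeta)$ is differentiable on $U\times V$, where $U\supseteq\mathcal X$ and $V\supseteq\mathcal Y$ are open, and there $\nabla_xG$ and $\nabla_yG$ are $l$-Lipschitz in $x$ and in $y$ ($l>0$); $G(x,y;\cdot)$ is integrable for $(x,y)\in U\times V$; and $g(x,\cdot)$ is concave on $\mathcal Y$ for $x\in\mathcal X$. For $\theta>0$ let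 $\widehat\nabla_x f(x,y)=\sum_i\frac{f(x+\theta u_i,y)-f(x,y)}{\theta}u_i$ with the coordinate directions $u_i$, and similarly $\widehat\nabla_y$; a subscript $k$ means $\theta=\theta_{1,k}$ for $x$ and $\theta=\theta_{2,k}$ for $y$. For a mini-batch $I=\{\zeta_1,\dots,\zeta_b\}$ put $\widehat\nabla_x\tilde{\mathcal L}_{G,k}(x,y,\lambda;I)=\frac1b\sum_j\widehat\nabla_xG_k(x,y;\zeta_j)-A^\top\lambda$ and $\widehat\nabla_y\tilde{\mathcal L}_{G,k}(x,y,\lambda;I)=\frac1b\sum_j\widehat\nabla_yG_k(x,y;\zeta_j)-B^\top\lambda-\rho_ky$; put $\widehat\nabla_x\tilde{\mathcal L}_{g,k}=\widehat\nabla_xg_k-A^\top\lambda$ and $\widehat\nabla_y\tilde{\mathcal L}_{g,k}=\widehat\nabla_yg_k-B^\top\lambda-\rho_ky$. **Algorithm (ZO-RMPDPG).** Start from $(x_1,y_1,\lambda_1)\in\mathcal X\times\mathcal Y\times\Lambda$; let $I_1,I_2,\dots$ be mini-batches of size $b\ge1$, all samples i.i.d. with law $D$; $\varrho_0=\iota_0=1$.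 With $\mathcal P$ denoting Euclidean projection, for $k=1,2,\dots$ $$v_k=\widehat\nabla_x\tilde{\mathcal L}_{G,k}(x_k,y_k,\lambda_k;I_k)+(1-\varrho_{k-1})\big[v_{k-1}-\widehat\nabla_x\tilde{\mathcal L}_{G,k-1}(x_{k-1},y_{k-1},\lambda_{k-1};I_k)\big],$$ $$w_k=\widehat\nabla_y\tilde{\mathcal L}_{G,k}(x_k,y_k,\lambda_k;I_k)+(1-\iota_{k-1})\big[w_{k-1}-\widehat\nabla_y\tilde{\mathcal L}_{G,k-1}(x_{k-1},y_{k-1},\lambda_{k-1};I_k)\big],$$ $$x_{k+1}=x_k+\eta_k\big(\mathcal P_{\mathcal X}(x_k-\tilde\alpha_kv_k)-x_k\big),\qquad y_{k+1}=y_k+\eta_k\big(\mathcal P_{\mathcal Y}(y_k+\tilde\beta w_k)-y_k\big),$$ $$\lambda_{k+1}=\lambda_k+\eta_k\big(\mathcal P_\Lambda(\lambda_k+\tilde\gamma_k(Ax_{k+1}+By_{k+1}-c))-\lambda_k\big).$$ **Parameters.** $\eta_k=(k+2)^{-5/13}$, $\tilde\alpha_k=A_2(k+2)^{-4/13}$,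 $\tilde\gamma_k=A_3(k+2)^{-4/13}$, $\rho_{k+1}=L(k+2)^{-2/13}$ ($k\ge0$), $\varrho_k=A_4(k+2)^{-12/13}$ and $\iota_k=A_5(k+2)^{-8/13}$ ($k\ge1$), $D^{(1)}_k=A_6(k+2)^{3/13}$, $D^{(2)}_k=A_7(k+2)^{3/13}$, $$\theta_{1,k}=\tfrac{\varepsilon}{L(k+2)^{6/13}}\sqrt{\tfrac{D_1}{d_x(24D_1+16+\frac{64A_6}{bA_2})}},\qquad \theta_{2,k}=\tfrac{\varepsilon}{L(k+2)^{6/13}}\sqrt{\tfrac{D_1}{d_y(24D_1+1280+\frac{64A_7}{bA_2})}},$$ where $L=\max\{l+\rho_1,\|A\|,\|B\|\}$ (with $\rho_1=2^{-2/13}L$), $0<\tilde\beta\le\frac1{6L}$, $A_2,A_3,A_6,A_7,D_1>0$, and $A_2\le\min\{\frac1{8L},\frac{\tilde\beta}{16\sqrt{10}},\frac1{\sqrt3\|A\|}\}$, $A_3\le\min\{\frac{2L^2A_2}{\|B\|^2},\frac1{4L},\frac{\tilde\beta^2}{1280A_2}\}$ (the bound with $\|A\|$ or $\|B\|$ is void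 if $A=0$ or $B=0$), $A_4\ge\frac{4A_2}{A_6}+\frac{12}{13}$, $A_5\ge\frac{640A_2}{A_7}+\frac{12}{13}$, $A_6,A_7\le\min\{\frac b{96A_2L^2},\frac{11bA_2}{12L\tilde\beta},\frac b{192A_3L^2}\}$, $D_1\le\min\{\frac1{32},\frac L{3/\tilde\beta+3\|B\|^2\tilde\beta},\frac{A_3}{24A_2},\frac{A_4A_6}{12A_2},\frac{A_5A_7}{12A_2}\}$, and $\varrho_k\le1$, $\iota_k\le1$ for all $k\ge1$. Let $\delta>0$. **Quantities.** $\nabla\mathcal G^{\alpha,\beta,\gamma}(x,y,\lambda)$ is the vector with the three blocks $\frac1\alpha(x-\mathcal P_{\mathcal X}(x-\alpha\nabla_x\mathcal L_g))$, $\frac1\beta(y-\mathcal P_{\mathcal Y}(y+\beta\nabla_y\mathcal L_g))$, $\frac1\gamma(\lambda-\mathcal P_\Lambda(\lambda-\gamma\nabla_\lambda\mathcal L_g))$, and $$T_2(\varepsilon)=\min\{k\ge2:\ \mathbb E\|\nabla\mathcal G^{\tilde\alpha_k,\tilde\beta,\tilde\gamma_k}(x_k,y_k,\lambda_k)\|^2\le\varepsilon^2\}.$$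 With $\tilde{\mathcal L}_{g,k}=\mathcal L_g-\frac{\rho_k}2\|y\|^2$, $\Psi_k(x,\lambda)=\max_{y\in\mathcal Y}\tilde{\mathcal L}_{g,k}(x,y,\lambda)$, $y_k^*=\arg\max_{y\in\mathcal Y}\tilde{\mathcal L}_{g,k}(x_k,y,\lambda_k)$, $\sigma_y=\max_{y\in\mathcal Y}\|y\|$, let for $k\ge2$ $$\begin{aligned}S_k=\mathbb E\Big[&\Psi_k(x_k,\lambda_k)+\Big(\tfrac{32\tilde\alpha_{k-1}L^2}{\tilde\beta\rho_k}-4\eta_{k-1}\tilde\alpha_{k-1}L^2\Big)\|y_k-y_k^*\|^2+D^{(1)}_{k-1}\|\widehat\nabla_x\tilde{\mathcal L}_{g,k}(x_k,y_k,\lambda_k)-v_k\|^2\\&+D^{(2)}_{k-1}\|\widehat\nabla_y\tilde{\mathcal L}_{g,k}(x_k,y_k,\lambda_k)-w_k\|^2-\tfrac{160\tilde\alpha_kL^2(\rho_k-\rho_{k+1})}{\eta_k\tilde\beta^2\rho_{k+1}^3}\|y_k^*\|^2\Big]+\tfrac{12D^{(2)}_k\rho_k^2\sigma_y^2}b,\end{aligned}$$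 $\underline S=\inf_{k\ge2}S_k$, $C_1=S_2-\underline S+16L^2\eta_1\tilde\alpha_1\sigma_y^2+\frac{\rho_2}2\sigma_y^2+\frac{160\tilde\alpha_2L^2\rho_2}{\eta_2\tilde\beta^2\rho_3^3}\sigma_y^2$ and $C_2=\frac{2\delta^2(A_4^2A_6+A_5^2A_7)}b+\frac{36A_7d_yL^2\sigma_y^2}{13b}+2D_1A_2L^2\sigma_y^2$. **Theorem.** There is a constant $K>0$, independent of $\varepsilon$, such that the following holds for every $\varepsilon>0$ for which * $x+tu_i\in U$ and $y+sv_j\in V$ for all $x\in\mathcal X$, $y\in\mathcal Y$, all coordinate directions $u_i,v_j$ and all $0\le t\le\theta_{1,1}$, $0\le s\le\theta_{2,1}$, and * $\mathbb E\|\widehat\nabla_xG_k(x,y;\zeta)-\widehat\nabla_xg_k(x,y)\|^2\le\delta^2$ and $\mathbb E\|\widehat\nabla_yG_k(x,y;\zeta)-\widehat\nabla_yg_k(x,y)\|^2\le\delta^2$ for all $k\ge1$, $x\in\mathcal X$, $y\in\mathcal Y$. The expectations $S_k$, $k\ge2$, exist and are bounded below, $T_2(\varepsilon)$ is finite, and if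 $T_2(\varepsilon)\ge3$ then $$\frac{7\varepsilon^2}8\le\frac{C_1+C_2\ln(T_2(\varepsilon)+1)}{D_1A_2\big(\frac{13}4(T_2(\varepsilon)+2)^{4/13}-\frac{13}4\,4^{4/13}\big)}.$$ Moreover, $T_2(\varepsilon)\le K\,\varepsilon^{-6.5}\,(\ln(1/\varepsilon))^{13/4}$ whenever $\varepsilon\le\frac12$; that is, $T_2(\varepsilon)=\tilde{\mathcal O}(\varepsilon^{-6.5})$. -/

import Mathlib

open MeasureTheory ProbabilityTheory

noncomputable section

namespace ZORMPDPG

/-- The Euclidean space `ℝⁿ`. -/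
abbrev Vec (n : ℕ) : Type := EuclideanSpace ℝ (Fin n)

/-- Whether the coupled constraint is `A x + B y ≤ c` (componentwise) or `A x + B y = c`. -/
inductive Rel : Type
  | le
  | eq

/-- The set of multipliers: the nonnegative orthant for `≤`, the whole space for `=`. -/
def Rel.multipliers {p : ℕ} : Rel → Set (Vec p)
  | .le => {lam | ∀ i, 0 ≤ lam i}
  | .eq => Set.univ

/-- The relation `u ⊴ c` between vectors. -/
def Rel.holds {p : ℕ} : Rel → Vec p → Vec p → Prop
  | .le, u, c => ∀ i, u i ≤ c i
  | .eq, u, c => u = c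

/-- Euclidean projection onto `Z`: a minimiser of the distance to `v` over `Z`
(it exists and is unique when `Z` is nonempty, closed and convex). -/
def proj {n : ℕ} (Z : Set (Vec n)) (v : Vec n) : Vec n :=
  Classical.epsilon fun z => z ∈ Z ∧ ∀ z' ∈ Z, ‖z - v‖ ^ 2 ≤ ‖z' - v‖ ^ 2

/-- The `i`-th coordinate direction. -/
def dir {n : ℕ} (i : Fin n) : Vec n := EuclideanSpace.single i 1

/-- Forward-difference estimator of the `x`-gradient with smoothing parameter `θ`. -/
def fdX {dx dy : ℕ} (f : Vec dx → Vec dy → ℝ) (θ : ℝ) (x : Vec dx) (y : Vec dy) : Vec dx :=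
  ∑ i, ((f (x + θ • dir i) y - f x y) / θ) • dir i

/-- Forward-difference estimator of the `y`-gradient with smoothing parameter `θ`. -/
def fdY {dx dy : ℕ} (f : Vec dx → Vec dy → ℝ) (θ : ℝ) (x : Vec dx) (y : Vec dy) : Vec dy :=
  ∑ i, ((f x (y + θ • dir i) - f x y) / θ) • dir i

/-- The data of the problem
`min_{x ∈ X} max_{y ∈ Y, A x + B y ⊴ c} g x y`, `g x y = 𝔼_{ζ ∼ D} [G x y ζ]`.
The matrices `A` and `B` are given as linear maps between Euclidean spaces, so that `‖A‖` and `‖B‖`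
are the spectral norms and the transposes are the adjoints. -/
structure Problem (dx dy p : ℕ) (Ξ : Type*) [MeasurableSpace Ξ] where
  rel : Rel
  X : Set (Vec dx)
  Y : Set (Vec dy)
  A : Vec dx →L[ℝ] Vec p
  B : Vec dy →L[ℝ] Vec p
  c : Vec p
  G : Vec dx → Vec dy → Ξ → ℝ
  D : Measure Ξ

/-- The constants that enter the parameter schedules; `b` is the size of the mini-batches. -/
structure Params where
  L : ℝ
  β : ℝ
  A₂ : ℝ
  A₃ : ℝ
  A₄ : ℝ
  A₅ : ℝ
  A₆ : ℝ
  A₇ : ℝ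
  D₁ : ℝ
  b : ℕ

namespace Params

variable (q : Params)

/-- The step size `η_k`. -/
def eta (k : ℕ) : ℝ := 1 / ((k : ℝ) + 2) ^ (5 / 13 : ℝ)

/-- The step size `α̃_k`. -/
def alpha (k : ℕ) : ℝ := q.A₂ / ((k : ℝ) + 2) ^ (4 / 13 : ℝ)

/-- The step size `γ̃_k`. -/
def gamma (k : ℕ) : ℝ := q.A₃ / ((k : ℝ) + 2) ^ (4 / 13 : ℝ)

/-- The regularization parameter `ρ_k`, that is, `ρ_{k+1} = L / (k+2)^{2/13}`. -/
def rho (k : ℕ) : ℝ := q.L / ((k : ℝ) + 1) ^ (2 / 13 : ℝ)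

/-- The momentum parameter `ϱ_k` (`k ≥ 1`) of the `x`-gradient estimator. -/
def momX (k : ℕ) : ℝ := q.A₄ / ((k : ℝ) + 2) ^ (12 / 13 : ℝ)

/-- The momentum parameter `ι_k` (`k ≥ 1`) of the `y`-gradient estimator. -/
def momY (k : ℕ) : ℝ := q.A₅ / ((k : ℝ) + 2) ^ (8 / 13 : ℝ)

/-- The weight `D_k^{(1)}`. -/
def weightX (k : ℕ) : ℝ := q.A₆ * ((k : ℝ) + 2) ^ (3 / 13 : ℝ)

/-- The weight `D_k^{(2)}`. -/
def weightY (k : ℕ) : ℝ := q.A₇ * ((k : ℝ) + 2) ^ (3 / 13 : ℝ)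

/-- The smoothing parameter `θ_{1,k}` for accuracy `ε` in dimension `dx`. -/
def thetaX (dx : ℕ) (ε : ℝ) (k : ℕ) : ℝ :=
  ε / (q.L * ((k : ℝ) + 2) ^ (6 / 13 : ℝ)) *
    √(q.D₁ / (dx * (24 * q.D₁ + 16 + 64 * q.A₆ / (q.b * q.A₂))))

/-- The smoothing parameter `θ_{2,k}` for accuracy `ε` in dimension `dy`. -/
def thetaY (dy : ℕ) (ε : ℝ) (k : ℕ) : ℝ :=
  ε / (q.L * ((k : ℝ) + 2) ^ (6 / 13 : ℝ)) *
    √(q.D₁ / (dy * (24 * q.D₁ + 1280 + 64 * q.A₇ / (q.b * q.A₂))))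

/-- The admissible constants, where `nA = ‖A‖` and `nB = ‖B‖`. Upper bounds of the form
`2 L² A₂ / ‖B‖²` and `1 / (√3 ‖A‖)` are written without division, since `A` and `B` may vanish. -/
structure Admissible (nA nB : ℝ) : Prop where
  b_pos : 0 < q.b
  β_pos : 0 < q.β
  β_le : q.β ≤ 1 / (6 * q.L)
  A₂_pos : 0 < q.A₂
  A₂_le₁ : q.A₂ ≤ 1 / (8 * q.L)
  A₂_le₂ : q.A₂ ≤ q.β / (16 * √10)
  A₂_le₃ : q.A₂ * (√3 * nA) ≤ 1
  A₃_pos : 0 < q.A₃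
  A₃_le₁ : q.A₃ * nB ^ 2 ≤ 2 * q.L ^ 2 * q.A₂
  A₃_le₂ : q.A₃ ≤ 1 / (4 * q.L)
  A₃_le₃ : q.A₃ ≤ q.β ^ 2 / (1280 * q.A₂)
  A₄_ge : 4 * q.A₂ / q.A₆ + 12 / 13 ≤ q.A₄
  A₅_ge : 640 * q.A₂ / q.A₇ + 12 / 13 ≤ q.A₅
  A₆_pos : 0 < q.A₆
  A₆_le₁ : q.A₆ ≤ q.b / (96 * q.A₂ * q.L ^ 2)
  A₆_le₂ : q.A₆ ≤ 11 * q.b * q.A₂ / (12 * q.L * q.β)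
  A₆_le₃ : q.A₆ ≤ q.b / (192 * q.A₃ * q.L ^ 2)
  A₇_pos : 0 < q.A₇
  A₇_le₁ : q.A₇ ≤ q.b / (96 * q.A₂ * q.L ^ 2)
  A₇_le₂ : q.A₇ ≤ 11 * q.b * q.A₂ / (12 * q.L * q.β)
  A₇_le₃ : q.A₇ ≤ q.b / (192 * q.A₃ * q.L ^ 2)
  D₁_pos : 0 < q.D₁
  D₁_le₁ : q.D₁ ≤ 1 / 32
  D₁_le₂ : q.D₁ ≤ q.L / (3 / q.β + 3 * nB ^ 2 * q.β)
  D₁_le₃ : q.D₁ ≤ q.A₃ / (24 * q.A₂)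
  D₁_le₄ : q.D₁ ≤ q.A₄ * q.A₆ / (12 * q.A₂)
  D₁_le₅ : q.D₁ ≤ q.A₅ * q.A₇ / (12 * q.A₂)
  momX_le : ∀ k : ℕ, 1 ≤ k → q.momX k ≤ 1
  momY_le : ∀ k : ℕ, 1 ≤ k → q.momY k ≤ 1

end Params

/-- The variables `x_k, y_k, λ_k` of an iteration and its gradient estimators `v_k, w_k`. -/
structure Iterate (dx dy p : ℕ) where
  x : Vec dx
  y : Vec dy
  lam : Vec p
  v : Vec dx
  w : Vec dy

namespace Problem

variable {dx dy p : ℕ} {Ξ : Type*} [MeasurableSpace Ξ] (P : Problem dx dy p Ξ) (q : Params)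

/-- The objective `g x y = 𝔼_{ζ ∼ D} [G x y ζ]`. -/
def g (x : Vec dx) (y : Vec dy) : ℝ := ∫ ζ, P.G x y ζ ∂P.D

/-- The set `Λ` of multipliers. -/
def Lam : Set (Vec p) := P.rel.multipliers

/-- The Lagrangian `𝓛_g`. -/
def lag (x : Vec dx) (y : Vec dy) (lam : Vec p) : ℝ :=
  P.g x y - inner ℝ lam (P.A x + P.B y - P.c)

/-- The regularized Lagrangian `𝓛̃_{g,k}`. -/
def lagReg (k : ℕ) (x : Vec dx) (y : Vec dy) (lam : Vec p) : ℝ :=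
  P.lag x y lam - q.rho k / 2 * ‖y‖ ^ 2

/-- The stationarity gap `∇𝒢^{α,β,γ}(x, y, λ)`, a vector of `ℝ^{dx} × ℝ^{dy} × ℝ^p` with its
Euclidean norm. -/
def gap (α β γ : ℝ) (x : Vec dx) (y : Vec dy) (lam : Vec p) :
    WithLp 2 (Vec dx × WithLp 2 (Vec dy × Vec p)) :=
  WithLp.toLp 2
    ((1 / α) • (x - proj P.X (x - α • gradient (fun x' => P.lag x' y lam) x)),
      WithLp.toLp 2
        ((1 / β) • (y - proj P.Y (y + β • gradient (fun y' => P.lag x y' lam) y)),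
          (1 / γ) • (lam - proj P.Lam (lam - γ • gradient (fun l => P.lag x y l) lam))))

/-- The zeroth-order estimator `∇̂_x 𝓛̃_{G,k}(x, y, λ; I)` on a mini-batch `I`. -/
def estX (ε : ℝ) (k : ℕ) (x : Vec dx) (y : Vec dy) (lam : Vec p) (I : Fin q.b → Ξ) : Vec dx :=
  (1 / (q.b : ℝ)) • ∑ j,
    (fdX (fun x' y' => P.G x' y' (I j)) (q.thetaX dx ε k) x y -
      ContinuousLinearMap.adjoint P.A lam)

/-- The zeroth-order estimator `∇̂_y 𝓛̃_{G,k}(x, y, λ; I)` on a mini-batch `I`. -/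
def estY (ε : ℝ) (k : ℕ) (x : Vec dx) (y : Vec dy) (lam : Vec p) (I : Fin q.b → Ξ) : Vec dy :=
  (1 / (q.b : ℝ)) • ∑ j,
    (fdY (fun x' y' => P.G x' y' (I j)) (q.thetaY dy ε k) x y -
      ContinuousLinearMap.adjoint P.B lam - q.rho k • y)

/-- The estimator `∇̂_x 𝓛̃_{g,k}(x, y, λ)` of the exact objective. -/
def meanEstX (ε : ℝ) (k : ℕ) (x : Vec dx) (y : Vec dy) (lam : Vec p) : Vec dx :=
  fdX P.g (q.thetaX dx ε k) x y - ContinuousLinearMap.adjoint P.A lam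

/-- The estimator `∇̂_y 𝓛̃_{g,k}(x, y, λ)` of the exact objective. -/
def meanEstY (ε : ℝ) (k : ℕ) (x : Vec dx) (y : Vec dy) (lam : Vec p) : Vec dy :=
  fdY P.g (q.thetaY dy ε k) x y - ContinuousLinearMap.adjoint P.B lam - q.rho k • y

/-- The state at `k = 1`. The algorithm prescribes `ϱ_0 = ι_0 = 1`, hence `v_1` and `w_1` are the
plain estimators on the first mini-batch. -/
def start (ε : ℝ) (x₁ : Vec dx) (y₁ : Vec dy) (lam₁ : Vec p) (I : ℕ → Fin q.b → Ξ) :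
    Iterate dx dy p where
  x := x₁
  y := y₁
  lam := lam₁
  v := P.estX q ε 1 x₁ y₁ lam₁ (I 1)
  w := P.estY q ε 1 x₁ y₁ lam₁ (I 1)

/-- One iteration of ZO-RMPDPG: from the state of index `k ≥ 1` to that of index `k + 1`. -/
def step (ε : ℝ) (I : ℕ → Fin q.b → Ξ) (k : ℕ) (s : Iterate dx dy p) : Iterate dx dy p :=
  let x' := s.x + Params.eta k • (proj P.X (s.x - q.alpha k • s.v) - s.x)
  let y' := s.y + Params.eta k • (proj P.Y (s.y + q.β • s.w) - s.y)
  let lam' := s.lam + Params.eta k •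
    (proj P.Lam (s.lam + q.gamma k • (P.A x' + P.B y' - P.c)) - s.lam)
  { x := x'
    y := y'
    lam := lam'
    v := P.estX q ε (k + 1) x' y' lam' (I (k + 1)) +
      (1 - q.momX k) • (s.v - P.estX q ε k s.x s.y s.lam (I (k + 1)))
    w := P.estY q ε (k + 1) x' y' lam' (I (k + 1)) +
      (1 - q.momY k) • (s.w - P.estY q ε k s.x s.y s.lam (I (k + 1))) }

/-- The iterates of ZO-RMPDPG run on the mini-batches `I 1, I 2, …`; the index `0` is not used. -/
def iter (ε : ℝ) (x₁ : Vec dx) (y₁ : Vec dy) (lam₁ : Vec p) (I : ℕ → Fin q.b → Ξ) :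
    ℕ → Iterate dx dy p
  | 0 => P.start q ε x₁ y₁ lam₁ I
  | k + 1 =>
    if k = 0 then P.start q ε x₁ y₁ lam₁ I
    else P.step q ε I k (iter ε x₁ y₁ lam₁ I k)

/-- `Ψ_k(x, λ) = max_{y ∈ Y} 𝓛̃_{g,k}(x, y, λ)`. -/
def maxVal (k : ℕ) (x : Vec dx) (lam : Vec p) : ℝ :=
  sSup ((fun y => P.lagReg q k x y lam) '' P.Y)

/-- `y_k^*(x, λ) = argmax_{y ∈ Y} 𝓛̃_{g,k}(x, y, λ)`. -/
def argMax (k : ℕ) (x : Vec dx) (lam : Vec p) : Vec dy :=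
  Classical.epsilon fun y => y ∈ P.Y ∧ IsMaxOn (fun y' => P.lagReg q k x y' lam) P.Y y

/-- `σ_y = max {‖y‖ | y ∈ Y}`. -/
def sigma : ℝ := sSup (norm '' P.Y)

/-- The random variable whose expectation is `S_k(x_k, y_k, λ_k)`, as a function of the `k`-th
state, `k ≥ 2`. -/
def potential (ε : ℝ) (k : ℕ) (s : Iterate dx dy p) : ℝ :=
  P.maxVal q k s.x s.lam
    + 32 * q.alpha (k - 1) * q.L ^ 2 / (q.β * q.rho k) * ‖s.y - P.argMax q k s.x s.lam‖ ^ 2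
    + q.weightX (k - 1) * ‖P.meanEstX q ε k s.x s.y s.lam - s.v‖ ^ 2
    + q.weightY (k - 1) * ‖P.meanEstY q ε k s.x s.y s.lam - s.w‖ ^ 2
    - 4 * Params.eta (k - 1) * q.alpha (k - 1) * q.L ^ 2 * ‖s.y - P.argMax q k s.x s.lam‖ ^ 2
    - 160 * q.alpha k * q.L ^ 2 * (q.rho k - q.rho (k + 1)) /
        (Params.eta k * q.β ^ 2 * q.rho (k + 1) ^ 3) * ‖P.argMax q k s.x s.lam‖ ^ 2
    + 12 * q.weightY k * q.rho k ^ 2 * P.sigma ^ 2 / q.b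

/-- The constant `C₁`, where `S₂` is the value `S_2(x_2, y_2, λ_2)` and `Smin` the lower bound. -/
def C₁ (S₂ Smin : ℝ) : ℝ :=
  S₂ - Smin + 16 * q.L ^ 2 * Params.eta 1 * q.alpha 1 * P.sigma ^ 2
    + q.rho 2 / 2 * P.sigma ^ 2
    + 160 * q.alpha 2 * q.L ^ 2 * q.rho 2 / (Params.eta 2 * q.β ^ 2 * q.rho 3 ^ 3) * P.sigma ^ 2

/-- The constant `C₂`. -/
def C₂ (δ : ℝ) : ℝ :=
  2 * δ ^ 2 * (q.A₄ ^ 2 * q.A₆ + q.A₅ ^ 2 * q.A₇) / q.b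
    + 36 * q.A₇ * dy * q.L ^ 2 * P.sigma ^ 2 / (13 * q.b)
    + 2 * q.D₁ * q.A₂ * q.L ^ 2 * P.sigma ^ 2

/-- For every sample, `G` is differentiable on `U × V` and its partial gradients are Lipschitz
there, in each of the two variables, with constant `l`. -/
structure SmoothOn (U : Set (Vec dx)) (V : Set (Vec dy)) (l : ℝ) : Prop where
  diff : ∀ ζ, DifferentiableOn ℝ (fun z : Vec dx × Vec dy => P.G z.1 z.2 ζ) (U ×ˢ V)
  lip_xx : ∀ ζ, ∀ x₁ ∈ U, ∀ x₂ ∈ U, ∀ y ∈ V,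
    ‖gradient (fun x => P.G x y ζ) x₁ - gradient (fun x => P.G x y ζ) x₂‖ ≤ l * ‖x₁ - x₂‖
  lip_xy : ∀ ζ, ∀ x ∈ U, ∀ y₁ ∈ V, ∀ y₂ ∈ V,
    ‖gradient (fun x' => P.G x' y₁ ζ) x - gradient (fun x' => P.G x' y₂ ζ) x‖ ≤ l * ‖y₁ - y₂‖
  lip_yy : ∀ ζ, ∀ x ∈ U, ∀ y₁ ∈ V, ∀ y₂ ∈ V,
    ‖gradient (fun y => P.G x y ζ) y₁ - gradient (fun y => P.G x y ζ) y₂‖ ≤ l * ‖y₁ - y₂‖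
  lip_yx : ∀ ζ, ∀ x₁ ∈ U, ∀ x₂ ∈ U, ∀ y ∈ V,
    ‖gradient (fun y' => P.G x₁ y' ζ) y - gradient (fun y' => P.G x₂ y' ζ) y‖ ≤ l * ‖x₁ - x₂‖

/-- `U × V` contains all points at which the difference quotients evaluate `G`, together with the
segments that join them to the base points (the smoothing parameters decrease in `k`). -/
def StencilIn (ε : ℝ) (U : Set (Vec dx)) (V : Set (Vec dy)) : Prop :=
  (∀ x ∈ P.X, ∀ i, ∀ t ∈ Set.Icc 0 (q.thetaX dx ε 1), x + t • dir i ∈ U) ∧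
    (∀ y ∈ P.Y, ∀ i, ∀ t ∈ Set.Icc 0 (q.thetaY dy ε 1), y + t • dir i ∈ V)

/-- The variance of the zeroth-order gradient estimators is at most `δ²`. -/
def VarianceBound (ε δ : ℝ) : Prop :=
  ∀ k : ℕ, 1 ≤ k → ∀ x ∈ P.X, ∀ y ∈ P.Y,
    ∫⁻ ζ, ‖fdX (fun x' y' => P.G x' y' ζ) (q.thetaX dx ε k) x y
        - fdX P.g (q.thetaX dx ε k) x y‖ₑ ^ 2 ∂P.D ≤ ENNReal.ofReal (δ ^ 2) ∧
      ∫⁻ ζ, ‖fdY (fun x' y' => P.G x' y' ζ) (q.thetaY dy ε k) x y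
        - fdY P.g (q.thetaY dy ε k) x y‖ₑ ^ 2 ∂P.D ≤ ENNReal.ofReal (δ ^ 2)

section Random

variable {Ω : Type*} [MeasurableSpace Ω] (μ : Measure Ω) (ε : ℝ) (x₁ : Vec dx) (y₁ : Vec dy)
  (lam₁ : Vec p) (ζ : ℕ → Fin q.b → Ω → Ξ)

/-- The random iterates, produced from the random samples `ζ k j` (the `j`-th member of the `k`-th
mini-batch). -/
def randIter (k : ℕ) (ω : Ω) : Iterate dx dy p :=
  P.iter q ε x₁ y₁ lam₁ (fun n j => ζ n j ω) k

/-- `S_k(x_k, y_k, λ_k)`. -/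
def S (k : ℕ) : ℝ := ∫ ω, P.potential q ε k (P.randIter q ε x₁ y₁ lam₁ ζ k ω) ∂μ

/-- The mean squared stationarity gap `𝔼 ‖∇𝒢^{α̃_k, β̃, γ̃_k}(x_k, y_k, λ_k)‖²`. -/
def meanSqGap (k : ℕ) : ENNReal :=
  ∫⁻ ω, ‖P.gap (q.alpha k) q.β (q.gamma k) (P.randIter q ε x₁ y₁ lam₁ ζ k ω).x
    (P.randIter q ε x₁ y₁ lam₁ ζ k ω).y (P.randIter q ε x₁ y₁ lam₁ ζ k ω).lam‖ₑ ^ 2 ∂μ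

/-- The indices `k ≥ 2` at which the iterate is `ε`-stationary in mean square. -/
def stationaryIndices : Set ℕ :=
  {k | 2 ≤ k ∧ P.meanSqGap q μ ε x₁ y₁ lam₁ ζ k ≤ ENNReal.ofReal (ε ^ 2)}

/-- The first `ε`-stationary index `T₂(ε)`. -/
def T₂ : ℕ := sInf (P.stationaryIndices q μ ε x₁ y₁ lam₁ ζ)

end Random

end Problem

end ZORMPDPG

end

/-! The proof is a Lyapunov argument. The decreasing quantity is `core`: the regularised maximum
`maxVal`, a multiple of the squared distance of `y_k` from the regularised maximiser, and weighted
squared errors of the two gradient estimators. Subtracting `ρ_k/2 ‖y‖²` makes the Lagrangian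
`ρ_k`-strongly concave in `y`. This gives quadratic growth at the maximiser
(`lagReg_add_le_argMax`), a descent inequality for the maximum as a function of `(x, λ)`
(`maxVal_step_le`), and control of the movement of the maximiser (`argMax_step_le`).

For frozen estimators an iteration is deterministic. The projected steps in `x` and `λ` lower the
maximum up to the tracking error of `y` and the gradient error (`descent_maxVal`). The ascent step
in `y` contracts the tracking error faster than the maximiser moves (`descent_argMax`). The
stationarity gap is bounded by the same steps and gradient errors (`scaled_gap_le`). All quantities
are measured in common units (`unitX`, `unitY`, `unitLam`, `unitE`), and `potential_descent` checks
that the coefficients balance.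

The estimators are of recursive momentum type. The error vector of the next estimator is a
contraction of the old one plus an average of centred innovations over a batch independent of the
current state (`errX_step`, `indepFun_batch`), so second moments obey a linear recursion
(`lintegral_errX_succ`). The innovation consists of a small multiple of the full deviation and of a
difference at consecutive iterates for one and the same sample (`lintegral_momentum_sq_le`). The
latter is controlled by the step lengths and hence absorbed by the descent. The finite-difference
bias is deterministic; the smoothing parameters are tuned so that all its occurrences cost at most
an eighth of `D₁ η_k α_k ε²`, which leaves the factor 7/8 in the rate.

As long as no iterate is stationary, every iteration gains `7/8 · D₁ η_k α_k ε²`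
(`meanCore_descent`), with `η_k α_k = A₂ (k+2)^(-9/13)`. The sum of the gains grows like `T^(4/13)`,
while the variance and regularisation losses are `O(1/k)` and sum to a logarithm (`sum_descent`,
`rate`). The resulting inequality `u ≤ ε⁻² (A + B log u)` for `u = (T+2)^(4/13)` is solved by
inserting a crude bound into the logarithm (`exists_complexity_const`). The constant is uniform in
`ε` because `le_S` and `S_two_le` bound the potential below at all times and above at time 2
independently of `ε`. -/

namespace ZORMPDPG

/-! ### Projections -/

section Projection

variable {n : ℕ} {Z : Set (Vec n)}

/-- `proj` is only a choice by `Classical.epsilon`, so existence of a minimiser comes first.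
Convexity then turns minimality into the variational inequality, the form in which projections are
used later. -/
lemma proj_spec (hne : Z.Nonempty) (hcl : IsClosed Z) (hconv : Convex ℝ Z) (v : Vec n) :
    proj Z v ∈ Z ∧ ∀ z ∈ Z, inner ℝ (v - proj Z v) (z - proj Z v) ≤ 0 := by
  have hex : ∃ z, z ∈ Z ∧ ∀ z' ∈ Z, ‖z - v‖ ^ 2 ≤ ‖z' - v‖ ^ 2 := by
    obtain ⟨z, hz, hmin⟩ := exists_norm_eq_iInf_of_complete_convex hne hcl.isComplete hconv v
    refine ⟨z, hz, fun z' hz' => ?_⟩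
    have h : ‖v - z‖ ≤ ‖v - z'‖ := by
      rw [hmin]
      exact ciInf_le ⟨0, Set.forall_mem_range.2 fun _ => norm_nonneg _⟩ (⟨z', hz'⟩ : Z)
    rw [norm_sub_rev z v, norm_sub_rev z' v]
    gcongr
  have h : proj Z v ∈ Z ∧ ∀ z' ∈ Z, ‖proj Z v - v‖ ^ 2 ≤ ‖z' - v‖ ^ 2 :=
    Classical.epsilon_spec hex
  refine ⟨h.1, (norm_eq_iInf_iff_real_inner_le_zero hconv h.1).1 ?_⟩
  have : Nonempty Z := hne.to_subtype
  refine le_antisymm (le_ciInf fun w => ?_)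
    (ciInf_le ⟨0, Set.forall_mem_range.2 fun _ => norm_nonneg _⟩ (⟨_, h.1⟩ : Z))
  rw [norm_sub_rev v, norm_sub_rev v]
  exact (sq_le_sq₀ (norm_nonneg _) (norm_nonneg _)).1 (h.2 w w.2)

lemma proj_nonexpansive (hne : Z.Nonempty) (hcl : IsClosed Z) (hconv : Convex ℝ Z)
    (u v : Vec n) : ‖proj Z u - proj Z v‖ ≤ ‖u - v‖ := by
  obtain ⟨hu, hu'⟩ := proj_spec hne hcl hconv u
  obtain ⟨hv, hv'⟩ := proj_spec hne hcl hconv v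
  have h1 := hu' _ hv
  have h2 := hv' _ hu
  set a := proj Z u
  set c := proj Z v
  have h3 : inner ℝ (u - v) (a - c) =
      ‖a - c‖ ^ 2 - inner ℝ (u - a) (c - a) - inner ℝ (v - c) (a - c) := by
    rw [← real_inner_self_eq_norm_sq]
    simp only [inner_sub_left, inner_sub_right, real_inner_comm]
    ring
  have h4 := real_inner_le_norm (u - v) (a - c)
  by_contra! hlt
  nlinarith [norm_nonneg (u - v), norm_nonneg (a - c)]

lemma proj_eq_self (hne : Z.Nonempty) (hcl : IsClosed Z) (hconv : Convex ℝ Z) {v : Vec n}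
    (hv : v ∈ Z) : proj Z v = v := by
  have h := (proj_spec hne hcl hconv v).2 v hv
  rw [real_inner_self_eq_norm_sq] at h
  have h0 : ‖v - proj Z v‖ = 0 := by nlinarith [norm_nonneg (v - proj Z v)]
  exact (sub_eq_zero.1 (norm_eq_zero.1 h0)).symm

lemma continuous_proj (hne : Z.Nonempty) (hcl : IsClosed Z) (hconv : Convex ℝ Z) :
    Continuous (proj Z) := by
  have : LipschitzWith 1 (proj Z) := LipschitzWith.of_dist_le_mul fun u v => by
    simpa [dist_eq_norm] using proj_nonexpansive hne hcl hconv u v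
  exact this.continuous

/-- The variational inequality of a projected step `proj Z (x - a • v)` with `a > 0`. -/
lemma proj_step_inner_le (hne : Z.Nonempty) (hcl : IsClosed Z) (hconv : Convex ℝ Z)
    {x v : Vec n} (hx : x ∈ Z) {a : ℝ} (ha : 0 < a) :
    inner ℝ v (proj Z (x - a • v) - x) ≤ -(‖proj Z (x - a • v) - x‖ ^ 2 / a) := by
  have h := (proj_spec hne hcl hconv (x - a • v)).2 x hx
  set t := proj Z (x - a • v)
  have h1 : inner ℝ (x - a • v - t) (x - t) = ‖t - x‖ ^ 2 + a * inner ℝ v (t - x) := by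
    rw [← real_inner_self_eq_norm_sq, ← real_inner_smul_left]
    simp only [inner_sub_left, inner_sub_right, real_inner_comm]
    ring
  rw [h1] at h
  rw [← neg_div, le_div_iff₀ ha]
  linarith

end Projection

lemma convex_multipliers {p : ℕ} (r : Rel) : Convex ℝ (r.multipliers : Set (Vec p)) := by
  cases r with
  | le =>
    intro u hu v hv s t hs ht _ i
    have := hu i
    have := hv i
    simp only [PiLp.add_apply, PiLp.smul_apply, smul_eq_mul]
    positivity
  | eq => exact convex_univ

lemma isClosed_multipliers {p : ℕ} (r : Rel) : IsClosed (r.multipliers : Set (Vec p)) := by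
  cases r with
  | le =>
    have : (Rel.multipliers .le : Set (Vec p)) = ⋂ i, {lam | 0 ≤ lam i} := by
      ext; simp [Rel.multipliers]
    rw [this]
    exact isClosed_iInter fun i => isClosed_le continuous_const (by fun_prop)
  | eq => exact isClosed_univ

/-- The sign condition of weak duality. It keeps the maximum bounded below although the multipliers
may be unbounded. -/
lemma inner_multiplier_nonpos {p : ℕ} {r : Rel} {lam u c : Vec p} (hlam : lam ∈ r.multipliers)
    (h : r.holds u c) : inner ℝ lam (u - c) ≤ 0 := by
  cases r with
  | le =>
    rw [PiLp.inner_apply]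
    refine Finset.sum_nonpos fun i _ => ?_
    have h1 := hlam i
    have h2 := h i
    simp only [PiLp.sub_apply, RCLike.inner_apply, conj_trivial]
    nlinarith
  | eq =>
    have h' : u = c := h
    simp [h']

/-! ### Functions with Lipschitz gradient -/

section Smooth

variable {n : ℕ} {f : Vec n → ℝ} {gr : Vec n → Vec n} {U : Set (Vec n)} {l : ℝ}

/-- A first-order expansion with quadratic error along a segment in the domain of a Lipschitz
gradient. -/
lemma abs_sub_inner_gradient_le
    (hf : ∀ z ∈ U, HasGradientAt f (gr z) z)
    (hlip : ∀ z ∈ U, ∀ z' ∈ U, ‖gr z - gr z'‖ ≤ l * ‖z - z'‖)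
    (x d : Vec n) (hseg : ∀ t ∈ Set.Icc (0 : ℝ) 1, x + t • d ∈ U) :
    |f (x + d) - f x - inner ℝ (gr x) d| ≤ l / 2 * ‖d‖ ^ 2 := by
  have hx : x ∈ U := by simpa using hseg 0 (by simp)
  have hder : ∀ t ∈ Set.Icc (0 : ℝ) 1,
      HasDerivAt (fun t : ℝ => f (x + t • d)) (inner ℝ (gr (x + t • d)) d) t := by
    intro t ht
    have h1 : HasDerivAt (fun t : ℝ => x + t • d) d t := by
      simpa using ((hasDerivAt_id t).smul_const d).const_add x
    have h2 := (hf _ (hseg t ht)).hasFDerivAt.comp_hasDerivAt t h1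
    simpa [Function.comp_def] using h2
  have hgr : ∀ t ∈ Set.Icc (0 : ℝ) 1,
      |inner ℝ (gr (x + t • d)) d - inner ℝ (gr x) d| ≤ l * t * ‖d‖ ^ 2 := by
    intro t ht
    rw [← inner_sub_left]
    refine (abs_real_inner_le_norm _ _).trans ?_
    have := hlip _ (hseg t ht) _ hx
    rw [add_sub_cancel_left, norm_smul, Real.norm_of_nonneg ht.1] at this
    nlinarith [norm_nonneg d]
  -- Both signs `s = ±1` are treated at once: the signed error minus `l / 2 * ‖d‖ ^ 2 * t ^ 2` has
  -- nonpositive derivative along the segment, so no gradient has to be integrated.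
  have key : ∀ s : ℝ, |s| = 1 →
      s * (f (x + d) - f x - inner ℝ (gr x) d) ≤ l / 2 * ‖d‖ ^ 2 := by
    intro s hs
    have hanti : AntitoneOn (fun t : ℝ => s * (f (x + t • d) - t * inner ℝ (gr x) d)
        - l / 2 * ‖d‖ ^ 2 * t ^ 2) (Set.Icc 0 1) := by
      have hd : ∀ t ∈ Set.Icc (0 : ℝ) 1, HasDerivAt
          (fun t : ℝ => s * (f (x + t • d) - t * inner ℝ (gr x) d) - l / 2 * ‖d‖ ^ 2 * t ^ 2)
          (s * (inner ℝ (gr (x + t • d)) d - inner ℝ (gr x) d) - l * t * ‖d‖ ^ 2) t := by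
        intro t ht
        have h1 := (((hder t ht).sub ((hasDerivAt_id t).mul_const (inner ℝ (gr x) d))).const_mul
          s).sub ((hasDerivAt_pow 2 t).const_mul (l / 2 * ‖d‖ ^ 2))
        refine h1.congr_deriv ?_
        simp only [one_mul, Nat.cast_ofNat, Nat.add_one_sub_one, pow_one]
        ring
      refine antitoneOn_of_deriv_nonpos (convex_Icc 0 1)
        (fun t ht => (hd t ht).continuousAt.continuousWithinAt)
        (fun t ht => (hd t (interior_subset ht)).differentiableAt.differentiableWithinAt) ?_
      intro t ht
      have ht := interior_subset ht
      rw [(hd t ht).deriv]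
      have h2 := le_abs_self (s * (inner ℝ (gr (x + t • d)) d - inner ℝ (gr x) d))
      rw [abs_mul, hs, one_mul] at h2
      linarith [hgr t ht]
    have := hanti (by simp) (by simp) zero_le_one
    simp only [one_smul, zero_smul, add_zero] at this
    linarith
  rw [abs_le]
  constructor
  · linarith [key (-1) (by simp)]
  · linarith [key 1 (by simp)]

/-- The forward-difference gradient of a function of one vector variable. -/
noncomputable def fd (f : Vec n → ℝ) (θ : ℝ) (x : Vec n) : Vec n :=
  ∑ i, ((f (x + θ • dir i) - f x) / θ) • dir i

lemma norm_dir (i : Fin n) : ‖(dir i : Vec n)‖ = 1 := by simp [dir]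

lemma fd_apply (f : Vec n → ℝ) (θ : ℝ) (x : Vec n) (i : Fin n) :
    fd f θ x i = (f (x + θ • dir i) - f x) / θ := by
  simp only [fd, dir, WithLp.ofLp_sum, Finset.sum_apply, PiLp.smul_apply, smul_eq_mul]
  rw [Finset.sum_eq_single i]
  · simp
  · intro j _ hj
    simp [hj.symm]
  · simp

/-- Each coordinate is a one-dimensional expansion with error `l θ / 2`. Positivity of `θ` is asked
only if `0 < n`, because in dimension zero the smoothing parameters degenerate to 0. -/
lemma norm_fd_sub_gradient_sq_le
    (hf : ∀ z ∈ U, HasGradientAt f (gr z) z)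
    (hlip : ∀ z ∈ U, ∀ z' ∈ U, ‖gr z - gr z'‖ ≤ l * ‖z - z'‖)
    (x : Vec n) {θ : ℝ} (hθ : 0 ≤ θ) (hθ' : 0 < n → 0 < θ)
    (hseg : ∀ i, ∀ t ∈ Set.Icc 0 θ, x + t • dir i ∈ U) :
    ‖fd f θ x - gr x‖ ^ 2 ≤ n * l ^ 2 * θ ^ 2 / 4 := by
  rw [EuclideanSpace.norm_sq_eq]
  have : ∀ i ∈ Finset.univ, ‖(fd f θ x - gr x) i‖ ^ 2 ≤ l ^ 2 * θ ^ 2 / 4 := by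
    intro i _
    have hθ0 : 0 < θ := hθ' i.pos
    have h := abs_sub_inner_gradient_le hf hlip x (θ • dir i) (fun t ht => by
      rw [smul_smul]
      exact hseg i _ ⟨by have := ht.1; positivity, by nlinarith [ht.2]⟩)
    have h1 : inner ℝ (gr x) (θ • dir i) = θ * gr x i := by
      rw [real_inner_smul_right, dir, EuclideanSpace.inner_single_right]
      simp
    rw [h1, norm_smul, norm_dir, mul_one, Real.norm_of_nonneg hθ] at h
    have h2 : (fd f θ x - gr x) i = (f (x + θ • dir i) - f x - θ * gr x i) / θ := by
      rw [PiLp.sub_apply, fd_apply]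
      field_simp
    rw [h2, norm_div, Real.norm_of_nonneg hθ, Real.norm_eq_abs]
    have h3 : |f (x + θ • dir i) - f x - θ * gr x i| / θ ≤ l * θ / 2 := by
      rw [div_le_iff₀ hθ0]
      linarith
    calc _ ≤ (l * θ / 2) ^ 2 := by gcongr
      _ = _ := by ring
  refine (Finset.sum_le_sum this).trans (le_of_eq ?_)
  simp
  ring

end Smooth

end ZORMPDPG

namespace ZORMPDPG

open Filter Topology in
/-- If `x` lies in an open set, then so do all short coordinate segments from `x`. -/
lemma exists_stencil {n : ℕ} {U : Set (Vec n)} (hU : IsOpen U) {x : Vec n} (hx : x ∈ U) :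
    ∃ r : ℝ, 0 < r ∧ Metric.ball x r ⊆ U ∧
      ∀ i, ∀ t ∈ Set.Ico (0 : ℝ) r, x + t • dir i ∈ U := by
  obtain ⟨r, hr, hb⟩ := Metric.isOpen_iff.1 hU x hx
  refine ⟨r, hr, hb, fun i t ht => hb ?_⟩
  rw [Metric.mem_ball, dist_eq_norm, add_sub_cancel_left, norm_smul, norm_dir, mul_one,
    Real.norm_of_nonneg ht.1]
  exact ht.2

/-! ### Expectations of random functions with Lipschitz gradient -/

section Expectation

variable {n : ℕ} {Ξ : Type*} [MeasurableSpace Ξ] {D : Measure Ξ} {F : Vec n → Ξ → ℝ}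
  {U : Set (Vec n)} {l : ℝ}

lemma fd_integral (hint : ∀ x ∈ U, Integrable (F x) D) {θ : ℝ} {x : Vec n} (hx : x ∈ U)
    (hst : ∀ i, x + θ • dir i ∈ U) :
    Integrable (fun ζ => fd (fun x => F x ζ) θ x) D ∧
      ∫ ζ, fd (fun x => F x ζ) θ x ∂D = fd (fun x => ∫ ζ, F x ζ ∂D) θ x := by
  have hI : ∀ i ∈ Finset.univ, Integrable
      (fun ζ => ((F (x + θ • dir i) ζ - F x ζ) / θ) • (dir i : Vec n)) D := fun i _ =>
    (((hint _ (hst i)).sub (hint _ hx)).div_const θ).smul_const _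
  refine ⟨integrable_finsetSum _ hI, ?_⟩
  unfold fd
  rw [integral_finsetSum _ hI]
  refine Finset.sum_congr rfl fun i _ => ?_
  rw [integral_smul_const, integral_div, integral_sub (hint _ (hst i)) (hint _ hx)]

variable (hU : IsOpen U) (hint : ∀ x ∈ U, Integrable (F x) D)
  (hdiff : ∀ ζ, ∀ x ∈ U, DifferentiableAt ℝ (fun x => F x ζ) x)
  (hlip : ∀ ζ, ∀ x₁ ∈ U, ∀ x₂ ∈ U,
    ‖gradient (fun x => F x ζ) x₁ - gradient (fun x => F x ζ) x₂‖ ≤ l * ‖x₁ - x₂‖)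

include hU hint hdiff hlip

open Filter Topology in
-- The gradient is a pointwise limit of integrable difference quotients, hence measurable; it
-- differs from a single such quotient by a bounded amount, hence is integrable.
lemma integrable_gradient [IsFiniteMeasure D] {x : Vec n} (hx : x ∈ U) :
    Integrable (fun ζ => gradient (fun x => F x ζ) x) D := by
  obtain ⟨r, hr, -, hst⟩ := exists_stencil hU hx
  have hbound : ∀ θ : ℝ, 0 < θ → θ < r → ∀ ζ,
      ‖fd (fun x => F x ζ) θ x - gradient (fun x => F x ζ) x‖ ^ 2 ≤ n * l ^ 2 * θ ^ 2 / 4 := by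
    intro θ h0 h1 ζ
    exact norm_fd_sub_gradient_sq_le (fun z hz => (hdiff ζ z hz).hasGradientAt) (hlip ζ) x h0.le
      (fun _ => h0) fun i t ht => hst i t ⟨ht.1, ht.2.trans_lt h1⟩
  have hfd : ∀ θ : ℝ, 0 < θ → θ < r → Integrable (fun ζ => fd (fun x => F x ζ) θ x) D :=
    fun θ h0 h1 => (fd_integral hint hx fun i => hst i θ ⟨h0.le, h1⟩).1
  obtain ⟨u, -, hu, hu0⟩ := exists_seq_strictAnti_tendsto' hr
  have hmeas : AEStronglyMeasurable (fun ζ => gradient (fun x => F x ζ) x) D := by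
    refine aestronglyMeasurable_of_tendsto_ae (u := atTop)
      (f := fun k ζ => fd (fun x => F x ζ) (u k) x)
      (fun k => (hfd _ (hu k).1 (hu k).2).aestronglyMeasurable) (ae_of_all _ fun ζ => ?_)
    rw [tendsto_iff_norm_sub_tendsto_zero]
    have h1 : Tendsto (fun k => √(n * l ^ 2 * u k ^ 2 / 4)) atTop (𝓝 0) := by
      have : Tendsto (fun k => √(n * l ^ 2 * u k ^ 2 / 4)) atTop
          (𝓝 √(n * l ^ 2 * 0 ^ 2 / 4)) :=
        (((hu0.pow 2).const_mul _).div_const _).sqrt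
      simpa using this
    refine squeeze_zero (fun _ => norm_nonneg _) (fun k => ?_) h1
    exact Real.le_sqrt_of_sq_le (hbound _ (hu k).1 (hu k).2 ζ)
  have hI := hfd (r / 2) (by positivity) (by linarith)
  have hI' : Integrable (fun ζ => fd (fun x => F x ζ) (r / 2) x
      - gradient (fun x => F x ζ) x) D := by
    refine Integrable.of_bound (hI.aestronglyMeasurable.sub hmeas)
      (√(n * l ^ 2 * (r / 2) ^ 2 / 4)) (ae_of_all _ fun ζ => ?_)
    exact Real.le_sqrt_of_sq_le (hbound _ (by positivity) (by linarith) ζ)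
  exact (hI.sub hI').congr (ae_of_all _ fun ζ => by simp)

/-- The first-order expansion has an error quadratic in the increment and uniform in the sample, so
integrating it replaces dominated convergence. -/
lemma hasGradientAt_integral [IsProbabilityMeasure D] {x : Vec n} (hx : x ∈ U) :
    HasGradientAt (fun x => ∫ ζ, F x ζ ∂D) (∫ ζ, gradient (fun x => F x ζ) x ∂D) x := by
  obtain ⟨r, hr, hb, -⟩ := exists_stencil hU hx
  rw [hasGradientAt_iff_isLittleO_nhds_zero]
  have hO : (fun h => (∫ ζ, F (x + h) ζ ∂D) - (∫ ζ, F x ζ ∂D)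
      - inner ℝ (∫ ζ, gradient (fun x => F x ζ) x ∂D) h) =O[nhds 0] fun h => ‖h‖ ^ 2 := by
    refine Asymptotics.IsBigO.of_bound (l / 2) ?_
    filter_upwards [Metric.ball_mem_nhds (0 : Vec n) hr] with h hh
    rw [mem_ball_zero_iff] at hh
    have hseg : ∀ t ∈ Set.Icc (0 : ℝ) 1, x + t • h ∈ U := fun t ht => hb (by
      rw [Metric.mem_ball, dist_eq_norm, add_sub_cancel_left, norm_smul,
        Real.norm_of_nonneg ht.1]
      nlinarith [ht.2, norm_nonneg h])
    have hxh : x + h ∈ U := by simpa using hseg 1 (by simp)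
    have hgi := integrable_gradient hU hint hdiff hlip hx
    have h1 : (∫ ζ, F (x + h) ζ ∂D) - (∫ ζ, F x ζ ∂D)
        - inner ℝ (∫ ζ, gradient (fun x => F x ζ) x ∂D) h =
        ∫ ζ, (F (x + h) ζ - F x ζ - inner ℝ (gradient (fun x => F x ζ) x) h) ∂D := by
      have h2 : ∫ ζ, inner ℝ (gradient (fun x => F x ζ) x) h ∂D =
          inner ℝ (∫ ζ, gradient (fun x => F x ζ) x ∂D) h := by
        simp only [real_inner_comm h]
        exact integral_inner hgi h
      have h3 : ∫ ζ, (F (x + h) ζ - F x ζ) ∂D = (∫ ζ, F (x + h) ζ ∂D) - ∫ ζ, F x ζ ∂D :=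
        integral_sub (hint _ hxh) (hint _ hx)
      have h4 : Integrable (fun ζ => F (x + h) ζ - F x ζ) D := (hint _ hxh).sub (hint _ hx)
      rw [integral_sub h4 (hgi.inner_const h), h3, h2]
    rw [h1]
    refine (norm_integral_le_of_norm_le_const (ae_of_all D fun ζ =>
      abs_sub_inner_gradient_le (fun z hz => (hdiff ζ z hz).hasGradientAt) (hlip ζ) x h
        hseg)).trans ?_
    simp
  exact hO.trans_isLittleO ((Asymptotics.isLittleO_norm_pow_id one_lt_two))

end Expectation

lemma norm_integral_sub_integral_le {n : ℕ} {Ξ : Type*} [MeasurableSpace Ξ] {D : Measure Ξ}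
    [IsProbabilityMeasure D] {a c : Ξ → Vec n} (ha : Integrable a D) (hc : Integrable c D)
    {C : ℝ} (h : ∀ ζ, ‖a ζ - c ζ‖ ≤ C) : ‖(∫ ζ, a ζ ∂D) - ∫ ζ, c ζ ∂D‖ ≤ C := by
  rw [← integral_sub ha hc]
  simpa using norm_integral_le_of_norm_le_const (ae_of_all D h)

/-! ### The objective -/

namespace Problem

variable {dx dy p : ℕ} {Ξ : Type*} [MeasurableSpace Ξ] (P : Problem dx dy p Ξ)

/-- The partial gradient `∇_x g`. -/
noncomputable def gradX (x : Vec dx) (y : Vec dy) : Vec dx := gradient (fun x' => P.g x' y) x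

/-- The partial gradient `∇_y g`. -/
noncomputable def gradY (x : Vec dx) (y : Vec dy) : Vec dy := gradient (fun y' => P.g x y') y

/-- `g` is differentiable in each variable on `U × V` and its partial gradients are Lipschitz
there, in each of the two variables, with constant `l`. -/
structure SmoothMean (U : Set (Vec dx)) (V : Set (Vec dy)) (l : ℝ) : Prop where
  hasGrad_x : ∀ x ∈ U, ∀ y ∈ V, HasGradientAt (fun x' => P.g x' y) (P.gradX x y) x
  hasGrad_y : ∀ x ∈ U, ∀ y ∈ V, HasGradientAt (fun y' => P.g x y') (P.gradY x y) y
  lip_xx : ∀ x₁ ∈ U, ∀ x₂ ∈ U, ∀ y ∈ V, ‖P.gradX x₁ y - P.gradX x₂ y‖ ≤ l * ‖x₁ - x₂‖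
  lip_xy : ∀ x ∈ U, ∀ y₁ ∈ V, ∀ y₂ ∈ V, ‖P.gradX x y₁ - P.gradX x y₂‖ ≤ l * ‖y₁ - y₂‖
  lip_yy : ∀ x ∈ U, ∀ y₁ ∈ V, ∀ y₂ ∈ V, ‖P.gradY x y₁ - P.gradY x y₂‖ ≤ l * ‖y₁ - y₂‖
  lip_yx : ∀ x₁ ∈ U, ∀ x₂ ∈ U, ∀ y ∈ V, ‖P.gradY x₁ y - P.gradY x₂ y‖ ≤ l * ‖x₁ - x₂‖

variable {P} {U : Set (Vec dx)} {V : Set (Vec dy)} {l : ℝ}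

lemma SmoothOn.differentiableAt_x (h : P.SmoothOn U V l) (hU : IsOpen U) (hV : IsOpen V)
    {x : Vec dx} {y : Vec dy} (hx : x ∈ U) (hy : y ∈ V) (ζ : Ξ) :
    DifferentiableAt ℝ (fun x => P.G x y ζ) x := by
  have h1 := (h.diff ζ).differentiableAt ((hU.prod hV).mem_nhds (x := (x, y)) ⟨hx, hy⟩)
  exact DifferentiableAt.comp (f := fun x' : Vec dx => (x', y)) x h1 (by fun_prop)

lemma SmoothOn.differentiableAt_y (h : P.SmoothOn U V l) (hU : IsOpen U) (hV : IsOpen V)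
    {x : Vec dx} {y : Vec dy} (hx : x ∈ U) (hy : y ∈ V) (ζ : Ξ) :
    DifferentiableAt ℝ (fun y => P.G x y ζ) y := by
  have h1 := (h.diff ζ).differentiableAt ((hU.prod hV).mem_nhds (x := (x, y)) ⟨hx, hy⟩)
  exact DifferentiableAt.comp (f := fun y' : Vec dy => (x, y')) y h1 (by fun_prop)

/-- The partial gradients of the mean are the means of the sample gradients, and a Lipschitz bound
valid for every sample survives averaging. -/
lemma SmoothOn.smoothMean (h : P.SmoothOn U V l) (hU : IsOpen U) (hV : IsOpen V)
    [IsProbabilityMeasure P.D] (hint : ∀ x ∈ U, ∀ y ∈ V, Integrable (P.G x y) P.D) :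
    P.SmoothMean U V l := by
  have hIx : ∀ x ∈ U, ∀ y ∈ V, Integrable (fun ζ => gradient (fun x => P.G x y ζ) x) P.D :=
    fun x hx y hy => integrable_gradient hU (F := fun x ζ => P.G x y ζ)
      (fun x hx => hint x hx y hy) (fun ζ x hx => h.differentiableAt_x hU hV hx hy ζ)
      (fun ζ x₁ hx₁ x₂ hx₂ => h.lip_xx ζ x₁ hx₁ x₂ hx₂ y hy) hx
  have hIy : ∀ x ∈ U, ∀ y ∈ V, Integrable (fun ζ => gradient (fun y => P.G x y ζ) y) P.D :=
    fun x hx y hy => integrable_gradient hV (F := fun y ζ => P.G x y ζ)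
      (fun y hy => hint x hx y hy) (fun ζ y hy => h.differentiableAt_y hU hV hx hy ζ)
      (fun ζ y₁ hy₁ y₂ hy₂ => h.lip_yy ζ x hx y₁ hy₁ y₂ hy₂) hy
  have hgx : ∀ x ∈ U, ∀ y ∈ V, HasGradientAt (fun x' => P.g x' y)
      (∫ ζ, gradient (fun x => P.G x y ζ) x ∂P.D) x :=
    fun x hx y hy => hasGradientAt_integral hU (F := fun x ζ => P.G x y ζ)
      (fun x hx => hint x hx y hy) (fun ζ x hx => h.differentiableAt_x hU hV hx hy ζ)
      (fun ζ x₁ hx₁ x₂ hx₂ => h.lip_xx ζ x₁ hx₁ x₂ hx₂ y hy) hx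
  have hgy : ∀ x ∈ U, ∀ y ∈ V, HasGradientAt (fun y' => P.g x y')
      (∫ ζ, gradient (fun y => P.G x y ζ) y ∂P.D) y :=
    fun x hx y hy => hasGradientAt_integral hV (F := fun y ζ => P.G x y ζ)
      (fun y hy => hint x hx y hy) (fun ζ y hy => h.differentiableAt_y hU hV hx hy ζ)
      (fun ζ y₁ hy₁ y₂ hy₂ => h.lip_yy ζ x hx y₁ hy₁ y₂ hy₂) hy
  have ex : ∀ x ∈ U, ∀ y ∈ V, P.gradX x y = ∫ ζ, gradient (fun x => P.G x y ζ) x ∂P.D :=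
    fun x hx y hy => (hgx x hx y hy).gradient
  have ey : ∀ x ∈ U, ∀ y ∈ V, P.gradY x y = ∫ ζ, gradient (fun y => P.G x y ζ) y ∂P.D :=
    fun x hx y hy => (hgy x hx y hy).gradient
  constructor
  · intro x hx y hy
    rw [ex x hx y hy]
    exact hgx x hx y hy
  · intro x hx y hy
    rw [ey x hx y hy]
    exact hgy x hx y hy
  · intro x₁ hx₁ x₂ hx₂ y hy
    rw [ex x₁ hx₁ y hy, ex x₂ hx₂ y hy]
    exact norm_integral_sub_integral_le (hIx x₁ hx₁ y hy) (hIx x₂ hx₂ y hy)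
      fun ζ => h.lip_xx ζ x₁ hx₁ x₂ hx₂ y hy
  · intro x hx y₁ hy₁ y₂ hy₂
    rw [ex x hx y₁ hy₁, ex x hx y₂ hy₂]
    exact norm_integral_sub_integral_le (hIx x hx y₁ hy₁) (hIx x hx y₂ hy₂)
      fun ζ => h.lip_xy ζ x hx y₁ hy₁ y₂ hy₂
  · intro x hx y₁ hy₁ y₂ hy₂
    rw [ey x hx y₁ hy₁, ey x hx y₂ hy₂]
    exact norm_integral_sub_integral_le (hIy x hx y₁ hy₁) (hIy x hx y₂ hy₂)
      fun ζ => h.lip_yy ζ x hx y₁ hy₁ y₂ hy₂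
  · intro x₁ hx₁ x₂ hx₂ y hy
    rw [ey x₁ hx₁ y hy, ey x₂ hx₂ y hy]
    exact norm_integral_sub_integral_le (hIy x₁ hx₁ y hy) (hIy x₂ hx₂ y hy)
      fun ζ => h.lip_yx ζ x₁ hx₁ x₂ hx₂ y hy

end Problem

end ZORMPDPG

/-! ### The regularised Lagrangian: growth, first-order optimality, and variation of its maximum and
maximiser. -/

namespace ZORMPDPG

/-- The limit `t → 0` in elementary form. It replaces one-sided derivatives along segments in the
proofs of the concavity inequality and of optimality. -/
lemma le_of_forall_le_add_mul {a b C : ℝ} (h : ∀ t : ℝ, 0 < t → t ≤ 1 → a ≤ b + t * C) :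
    a ≤ b := by
  by_contra! hlt
  have hpos : 0 < (a - b) / (2 * (|C| + 1)) := by
    have : 0 < a - b := by linarith
    positivity
  have h1 := h (min 1 ((a - b) / (2 * (|C| + 1)))) (lt_min one_pos hpos) (min_le_left _ _)
  have h2 : min 1 ((a - b) / (2 * (|C| + 1))) * C ≤ (a - b) / 2 := by
    calc min 1 ((a - b) / (2 * (|C| + 1))) * C
        ≤ min 1 ((a - b) / (2 * (|C| + 1))) * (|C| + 1) := by
          gcongr
          linarith [le_abs_self C]
      _ ≤ ((a - b) / (2 * (|C| + 1))) * (|C| + 1) := by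
          gcongr
          exact min_le_right _ _
      _ = (a - b) / 2 := by
          field_simp
  linarith

namespace Problem

variable {dx dy p : ℕ} {Ξ : Type*} [MeasurableSpace Ξ]

/-- The standing assumptions on the feasible sets and the mean objective. -/
structure Regular (P : Problem dx dy p Ξ) (U : Set (Vec dx)) (V : Set (Vec dy)) (l : ℝ) :
    Prop where
  X_ne : P.X.Nonempty
  X_conv : Convex ℝ P.X
  X_comp : IsCompact P.X
  Y_ne : P.Y.Nonempty
  Y_conv : Convex ℝ P.Y
  Y_comp : IsCompact P.Y
  X_sub : P.X ⊆ U
  Y_sub : P.Y ⊆ V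
  l_pos : 0 < l
  mean : P.SmoothMean U V l
  conc : ∀ x ∈ P.X, ConcaveOn ℝ P.Y (P.g x)

/-- The partial gradient `∇_x 𝓛_g`. -/
noncomputable def lagGradX (P : Problem dx dy p Ξ) (x : Vec dx) (y : Vec dy) (lam : Vec p) :
    Vec dx :=
  P.gradX x y - ContinuousLinearMap.adjoint P.A lam

/-- The partial gradient `∇_y 𝓛̃_{g,k}`. -/
noncomputable def regGradY (P : Problem dx dy p Ξ) (q : Params) (k : ℕ) (x : Vec dx) (y : Vec dy)
    (lam : Vec p) : Vec dy :=
  P.gradY x y - ContinuousLinearMap.adjoint P.B lam - q.rho k • y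

lemma Lam_ne (P : Problem dx dy p Ξ) : P.Lam.Nonempty := by
  refine ⟨0, ?_⟩
  unfold Lam
  cases P.rel <;> simp [Rel.multipliers]

lemma lam_conv (P : Problem dx dy p Ξ) : Convex ℝ P.Lam := convex_multipliers _

lemma lam_closed (P : Problem dx dy p Ξ) : IsClosed P.Lam := isClosed_multipliers _

namespace Regular

variable {P : Problem dx dy p Ξ} {U : Set (Vec dx)} {V : Set (Vec dy)} {l : ℝ}

section

variable (h : P.Regular U V l)

include h

lemma abs_g_x_le {x x' : Vec dx} {y : Vec dy} (hx : x ∈ P.X) (hx' : x' ∈ P.X) (hy : y ∈ P.Y) :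
    |P.g x' y - P.g x y - inner ℝ (P.gradX x y) (x' - x)| ≤ l / 2 * ‖x' - x‖ ^ 2 := by
  have := abs_sub_inner_gradient_le (fun z hz => h.mean.hasGrad_x z hz y (h.Y_sub hy))
    (fun z hz z' hz' => h.mean.lip_xx z hz z' hz' y (h.Y_sub hy)) x (x' - x)
    (fun t ht => h.X_sub (h.X_conv.add_smul_sub_mem hx hx' ht))
  simpa using this

lemma abs_g_y_le {x : Vec dx} {y y' : Vec dy} (hx : x ∈ P.X) (hy : y ∈ P.Y) (hy' : y' ∈ P.Y) :
    |P.g x y' - P.g x y - inner ℝ (P.gradY x y) (y' - y)| ≤ l / 2 * ‖y' - y‖ ^ 2 := by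
  have := abs_sub_inner_gradient_le (fun z hz => h.mean.hasGrad_y x (h.X_sub hx) z hz)
    (fun z hz z' hz' => h.mean.lip_yy x (h.X_sub hx) z hz z' hz') y (y' - y)
    (fun t ht => h.Y_sub (h.Y_conv.add_smul_sub_mem hy hy' ht))
  simpa using this

/-- Concavity along the chord to `y'` is compared with the quadratic expansion at the point of
parameter `t`; dividing by `t` and letting it vanish leaves the tangent bound. -/
lemma g_y_le {x : Vec dx} {y y' : Vec dy} (hx : x ∈ P.X) (hy : y ∈ P.Y) (hy' : y' ∈ P.Y) :
    P.g x y' ≤ P.g x y + inner ℝ (P.gradY x y) (y' - y) := by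
  refine le_of_forall_le_add_mul (C := l / 2 * ‖y' - y‖ ^ 2) fun t ht ht1 => ?_
  have hmem := h.Y_conv.add_smul_sub_mem hy hy' (t := t) ⟨ht.le, ht1⟩
  have h1 := (abs_le.1 (h.abs_g_y_le hx hy hmem)).2
  have h2 := (h.conc x hx).2 hy hy' (sub_nonneg.2 ht1) ht.le (sub_add_cancel 1 t)
  have h3 : (1 - t) • y + t • y' = y + t • (y' - y) := by module
  rw [h3] at h2
  simp only [smul_eq_mul] at h2
  rw [add_sub_cancel_left, real_inner_smul_right, norm_smul, Real.norm_of_nonneg ht.le] at h1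
  have h4 : t * (P.g x y') ≤
      t * (P.g x y + inner ℝ (P.gradY x y) (y' - y) + t * (l / 2 * ‖y' - y‖ ^ 2)) := by
    nlinarith
  exact le_of_mul_le_mul_left h4 ht

lemma continuousOn_g_y {x : Vec dx} (hx : x ∈ P.X) : ContinuousOn (P.g x) P.Y := fun y hy =>
  (h.mean.hasGrad_y x (h.X_sub hx) y (h.Y_sub hy)).continuousAt.continuousWithinAt

lemma gradY_monotone {x : Vec dx} {y y' : Vec dy} (hx : x ∈ P.X) (hy : y ∈ P.Y)
    (hy' : y' ∈ P.Y) : inner ℝ (P.gradY x y' - P.gradY x y) (y' - y) ≤ 0 := by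
  have h1 := h.g_y_le hx hy hy'
  have h2 := h.g_y_le hx hy' hy
  have h3 : inner ℝ (P.gradY x y') (y - y') = -inner ℝ (P.gradY x y') (y' - y) := by
    rw [← inner_neg_right, neg_sub]
  rw [inner_sub_left]
  linarith

end

variable (q : Params)

/-- The exact second-order bookkeeping of the terms added to `g` in `𝓛̃_{g,k}`. -/
lemma lagReg_sub (k : ℕ) (x : Vec dx) (y y' : Vec dy) (lam : Vec p) :
    P.lagReg q k x y' lam - P.lagReg q k x y lam =
      P.g x y' - P.g x y - inner ℝ (P.gradY x y) (y' - y)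
        + inner ℝ (P.regGradY q k x y lam) (y' - y) - q.rho k / 2 * ‖y' - y‖ ^ 2 := by
  have h1 : inner ℝ lam (P.A x + P.B y' - P.c) =
      inner ℝ lam (P.A x + P.B y - P.c) + inner ℝ (ContinuousLinearMap.adjoint P.B lam) (y' - y) := by
    rw [ContinuousLinearMap.adjoint_inner_left, ← inner_add_right, map_sub]
    congr 1
    abel
  have h2 : ‖y'‖ ^ 2 = ‖y‖ ^ 2 + 2 * inner ℝ y (y' - y) + ‖y' - y‖ ^ 2 := by
    have := norm_add_sq_real y (y' - y)
    rwa [add_sub_cancel] at this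
  unfold lagReg lag regGradY
  rw [h1, h2, inner_sub_left, inner_sub_left, real_inner_smul_left]
  ring

variable (h : P.Regular U V l) (k : ℕ)

include h

lemma lagReg_y_le {x : Vec dx} {y y' : Vec dy} (hx : x ∈ P.X) (hy : y ∈ P.Y) (hy' : y' ∈ P.Y)
    (lam : Vec p) :
    P.lagReg q k x y' lam ≤ P.lagReg q k x y lam
      + inner ℝ (P.regGradY q k x y lam) (y' - y) - q.rho k / 2 * ‖y' - y‖ ^ 2 := by
  have := lagReg_sub (P := P) q k x y y' lam
  have := h.g_y_le hx hy hy'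
  linarith

lemma lagReg_y_ge {x : Vec dx} {y y' : Vec dy} (hx : x ∈ P.X) (hy : y ∈ P.Y) (hy' : y' ∈ P.Y)
    (lam : Vec p) :
    P.lagReg q k x y lam + inner ℝ (P.regGradY q k x y lam) (y' - y)
      - (l + q.rho k) / 2 * ‖y' - y‖ ^ 2 ≤ P.lagReg q k x y' lam := by
  have := lagReg_sub (P := P) q k x y y' lam
  have := (abs_le.1 (h.abs_g_y_le hx hy hy')).1
  linarith

lemma argMax_spec {x : Vec dx} (hx : x ∈ P.X) (lam : Vec p) :
    P.argMax q k x lam ∈ P.Y ∧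
      IsMaxOn (fun y' => P.lagReg q k x y' lam) P.Y (P.argMax q k x lam) := by
  have hc : ContinuousOn (fun y => P.lagReg q k x y lam) P.Y := by
    have := h.continuousOn_g_y hx
    unfold lagReg lag
    fun_prop
  exact Classical.epsilon_spec (h.Y_comp.exists_isMaxOn h.Y_ne hc)

lemma argMax_mem {x : Vec dx} (hx : x ∈ P.X) (lam : Vec p) : P.argMax q k x lam ∈ P.Y :=
  (h.argMax_spec q k hx lam).1

lemma maxVal_eq {x : Vec dx} (hx : x ∈ P.X) (lam : Vec p) :
    P.maxVal q k x lam = P.lagReg q k x (P.argMax q k x lam) lam := by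
  obtain ⟨h1, h2⟩ := h.argMax_spec q k hx lam
  refine IsGreatest.csSup_eq ⟨⟨_, h1, rfl⟩, ?_⟩
  rintro _ ⟨y, hy, rfl⟩
  exact h2 hy

/-- The maximiser beats every point of the segment to `y`; the first-order term of the lower
expansion must therefore be nonpositive in the limit. -/
lemma argMax_inner_le {x : Vec dx} {y : Vec dy} (hx : x ∈ P.X) (hy : y ∈ P.Y) (lam : Vec p) :
    inner ℝ (P.regGradY q k x (P.argMax q k x lam) lam) (y - P.argMax q k x lam) ≤ 0 := by
  obtain ⟨h1, h2⟩ := h.argMax_spec q k hx lam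
  set s := P.argMax q k x lam
  refine le_of_forall_le_add_mul (C := (l + q.rho k) / 2 * ‖y - s‖ ^ 2) fun t ht ht1 => ?_
  have hmem := h.Y_conv.add_smul_sub_mem h1 hy (t := t) ⟨ht.le, ht1⟩
  have h3 := h.lagReg_y_ge q k hx h1 hmem lam
  have h4 : P.lagReg q k x (s + t • (y - s)) lam ≤ P.lagReg q k x s lam := h2 hmem
  rw [add_sub_cancel_left, real_inner_smul_right, norm_smul, Real.norm_of_nonneg ht.le] at h3
  have h5 : t * inner ℝ (P.regGradY q k x s lam) (y - s) ≤
      t * (0 + t * ((l + q.rho k) / 2 * ‖y - s‖ ^ 2)) := by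
    nlinarith
  exact le_of_mul_le_mul_left h5 ht

/-- Strong concavity supplies the quadratic term, and optimality removes the linear one. -/
lemma lagReg_add_le_argMax {x : Vec dx} {y : Vec dy} (hx : x ∈ P.X) (hy : y ∈ P.Y)
    (lam : Vec p) :
    P.lagReg q k x y lam + q.rho k / 2 * ‖y - P.argMax q k x lam‖ ^ 2 ≤
      P.lagReg q k x (P.argMax q k x lam) lam := by
  have h1 := h.argMax_inner_le q k hx hy lam
  have h2 := h.lagReg_y_le q k hx (h.argMax_mem q k hx lam) hy lam
  linarith

/-- The maximal value along a change of the minimisation variables, compared at arbitrary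
`y, z ∈ Y`. -/
lemma maxVal_step_le (hρ : 0 < q.rho k) {x x' : Vec dx} {y z : Vec dy} (hx : x ∈ P.X)
    (hx' : x' ∈ P.X) (hy : y ∈ P.Y) (lam lam' : Vec p) :
    P.maxVal q k x' lam' ≤ P.maxVal q k x lam + inner ℝ (P.lagGradX x y lam) (x' - x)
      - inner ℝ (lam' - lam) (P.A x' + P.B z - P.c)
      + (l / 2 + l ^ 2 / q.rho k) * ‖x' - x‖ ^ 2 + ‖P.B‖ ^ 2 / q.rho k * ‖lam' - lam‖ ^ 2
      + l * ‖x' - x‖ * ‖y - P.argMax q k x lam‖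
      + ‖P.B‖ * ‖lam' - lam‖ * (‖y - P.argMax q k x lam‖ + ‖z - y‖) := by
  have hs := h.argMax_mem q k hx lam
  have hs' := h.argMax_mem q k hx' lam'
  rw [h.maxVal_eq q k hx, h.maxVal_eq q k hx']
  -- The new maximiser `s'` is inserted into the old problem. The growth `ρ/2 ‖s' - s‖²` gained here
  -- is spent in two quarters, `h8` for the change of `x` and `h9` for that of `λ`, so no Lipschitz
  -- bound of the maximiser is needed.
  have h1 := h.lagReg_add_le_argMax q k hx hs' lam
  set s := P.argMax q k x lam
  set s' := P.argMax q k x' lam'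
  have h2 := (abs_le.1 (h.abs_g_x_le hx hx' hs')).2
  have h3 : inner ℝ (P.gradX x s') (x' - x) ≤
      inner ℝ (P.gradX x y) (x' - x) + l * ‖s' - y‖ * ‖x' - x‖ := by
    have := (real_inner_le_norm (P.gradX x s' - P.gradX x y) (x' - x)).trans
      (mul_le_mul_of_nonneg_right (h.mean.lip_xy x (h.X_sub hx) s' (h.Y_sub hs') y (h.Y_sub hy))
        (norm_nonneg _))
    rw [inner_sub_left] at this
    linarith
  have h4 : P.lagReg q k x' s' lam' - P.lagReg q k x s' lam = P.g x' s' - P.g x s'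
      - inner ℝ (ContinuousLinearMap.adjoint P.A lam) (x' - x)
      - inner ℝ (lam' - lam) (P.A x' + P.B z - P.c)
      - inner ℝ (lam' - lam) (P.B (s' - z)) := by
    unfold lagReg lag
    rw [ContinuousLinearMap.adjoint_inner_left]
    simp only [inner_sub_left, inner_sub_right, inner_add_right, map_sub]
    ring
  have h5 : -inner ℝ (lam' - lam) (P.B (s' - z)) ≤ ‖lam' - lam‖ * (‖P.B‖ * ‖s' - z‖) := by
    rw [← inner_neg_left]
    refine (real_inner_le_norm _ _).trans ?_
    rw [norm_neg]
    gcongr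
    exact P.B.le_opNorm _
  have h6 : ‖s' - y‖ ≤ ‖s' - s‖ + ‖y - s‖ := by
    rw [norm_sub_rev y s]
    exact norm_sub_le_norm_sub_add_norm_sub _ _ _
  have h7 : ‖s' - z‖ ≤ ‖s' - s‖ + ‖y - s‖ + ‖z - y‖ := by
    have := norm_sub_le_norm_sub_add_norm_sub s' y z
    rw [norm_sub_rev y z] at this
    linarith
  have h8 : l * ‖s' - s‖ * ‖x' - x‖ ≤
      q.rho k / 4 * ‖s' - s‖ ^ 2 + l ^ 2 / q.rho k * ‖x' - x‖ ^ 2 := by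
    have : 0 ≤ (q.rho k / 2 * ‖s' - s‖ - l * ‖x' - x‖) ^ 2 / q.rho k := by positivity
    have e : (q.rho k / 2 * ‖s' - s‖ - l * ‖x' - x‖) ^ 2 / q.rho k =
        q.rho k / 4 * ‖s' - s‖ ^ 2 + l ^ 2 / q.rho k * ‖x' - x‖ ^ 2
          - l * ‖s' - s‖ * ‖x' - x‖ := by
      field_simp
      ring
    linarith
  have h9 : ‖P.B‖ * ‖s' - s‖ * ‖lam' - lam‖ ≤
      q.rho k / 4 * ‖s' - s‖ ^ 2 + ‖P.B‖ ^ 2 / q.rho k * ‖lam' - lam‖ ^ 2 := by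
    have : 0 ≤ (q.rho k / 2 * ‖s' - s‖ - ‖P.B‖ * ‖lam' - lam‖) ^ 2 / q.rho k := by positivity
    have e : (q.rho k / 2 * ‖s' - s‖ - ‖P.B‖ * ‖lam' - lam‖) ^ 2 / q.rho k =
        q.rho k / 4 * ‖s' - s‖ ^ 2 + ‖P.B‖ ^ 2 / q.rho k * ‖lam' - lam‖ ^ 2
          - ‖P.B‖ * ‖s' - s‖ * ‖lam' - lam‖ := by
      field_simp
      ring
    linarith
  have h10 : l * ‖s' - y‖ * ‖x' - x‖ ≤ l * (‖s' - s‖ + ‖y - s‖) * ‖x' - x‖ := by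
    have := h.l_pos
    gcongr
  have h11 : ‖lam' - lam‖ * (‖P.B‖ * ‖s' - z‖) ≤
      ‖lam' - lam‖ * (‖P.B‖ * (‖s' - s‖ + ‖y - s‖ + ‖z - y‖)) := by gcongr
  have h12 : inner ℝ (P.lagGradX x y lam) (x' - x) = inner ℝ (P.gradX x y) (x' - x)
      - inner ℝ (ContinuousLinearMap.adjoint P.A lam) (x' - x) := by
    rw [lagGradX, inner_sub_left]
  rw [h12]
  linarith

/-- Contraction of a damped projected ascent step towards the regularised maximiser. -/
lemma ascent_step_le {β η : ℝ} (hβ : 0 < β) (hη : 0 ≤ η) (hη1 : η ≤ 1) (hρ : 0 < q.rho k)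
    (hβL : β * (l + q.rho k) ≤ 1 / 6) {x : Vec dx} {y : Vec dy} (hx : x ∈ P.X) (hy : y ∈ P.Y)
    (lam : Vec p) (w : Vec dy) :
    ‖y + η • (proj P.Y (y + β • w) - y) - P.argMax q k x lam‖ ^ 2 ≤
      (1 - η * β * q.rho k) * ‖y - P.argMax q k x lam‖ ^ 2
        - 5 / 6 * η * ‖proj P.Y (y + β • w) - y‖ ^ 2
        + η * β / q.rho k * ‖P.regGradY q k x y lam - w‖ ^ 2 := by
  have hs := h.argMax_mem q k hx lam
  obtain ⟨ht, htp⟩ := proj_spec h.Y_ne h.Y_comp.isClosed h.Y_conv (y + β • w)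
  have h1 := htp _ hs
  have h2 := h.lagReg_y_le q k hx hy hs lam
  have h3 := h.lagReg_y_ge q k hx hy ht lam
  have h4 := h.lagReg_add_le_argMax q k hx ht lam
  set s := P.argMax q k x lam
  set t := proj P.Y (y + β • w)
  set G := P.regGradY q k x y lam
  set ρ := q.rho k
  have e1 : inner ℝ (y + β • w - t) (s - t) =
      β * inner ℝ w (s - t) - inner ℝ (t - y) (s - y) + ‖t - y‖ ^ 2 := by
    rw [← real_inner_self_eq_norm_sq, ← real_inner_smul_left]
    simp only [inner_sub_left, inner_sub_right, inner_add_left, real_inner_comm]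
    ring
  have e2 : inner ℝ G (s - y) - inner ℝ G (t - y) = inner ℝ w (s - t) + inner ℝ (G - w) (s - t) := by
    simp only [inner_sub_left, inner_sub_right]
    ring
  have e3 : ‖y + η • (t - y) - s‖ ^ 2 =
      ‖y - s‖ ^ 2 - 2 * η * inner ℝ (t - y) (s - y) + η ^ 2 * ‖t - y‖ ^ 2 := by
    have : y + η • (t - y) - s = (y - s) + η • (t - y) := by abel
    rw [this, norm_add_sq_real, norm_smul, Real.norm_of_nonneg hη, real_inner_smul_right,
      real_inner_comm, ← neg_sub s y, inner_neg_right, norm_neg]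
    ring
  -- The Young weights are chosen so that `ρ/2 ‖t - s‖²` is cancelled exactly by the growth `h4` at
  -- the projected point `t`.
  have e4 : inner ℝ (G - w) (s - t) ≤ ‖G - w‖ ^ 2 / (2 * ρ) + ρ / 2 * ‖t - s‖ ^ 2 := by
    have h5 := real_inner_le_norm (G - w) (s - t)
    rw [norm_sub_rev s t] at h5
    have h6 : 0 ≤ (‖G - w‖ - ρ * ‖t - s‖) ^ 2 / (2 * ρ) := by positivity
    have h7 : (‖G - w‖ - ρ * ‖t - s‖) ^ 2 / (2 * ρ) =
        ‖G - w‖ ^ 2 / (2 * ρ) + ρ / 2 * ‖t - s‖ ^ 2 - ‖G - w‖ * ‖t - s‖ := by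
      field_simp
      ring
    linarith
  rw [norm_sub_rev s y] at h2
  have e5 : ρ / 2 * ‖y - s‖ ^ 2 - (l + ρ) / 2 * ‖t - y‖ ^ 2 - ‖G - w‖ ^ 2 / (2 * ρ)
      ≤ inner ℝ w (s - t) := by linarith
  have e6 : β * (ρ / 2 * ‖y - s‖ ^ 2 - (l + ρ) / 2 * ‖t - y‖ ^ 2 - ‖G - w‖ ^ 2 / (2 * ρ))
      ≤ inner ℝ (t - y) (s - y) - ‖t - y‖ ^ 2 := by
    have := mul_le_mul_of_nonneg_left e5 hβ.le
    linarith
  have e7 : β * (l + ρ) * ‖t - y‖ ^ 2 ≤ 1 / 6 * ‖t - y‖ ^ 2 := by gcongr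
  have e8 : η * (β * ρ * ‖y - s‖ ^ 2 + 11 / 6 * ‖t - y‖ ^ 2 - β / ρ * ‖G - w‖ ^ 2)
      ≤ η * (2 * inner ℝ (t - y) (s - y)) := by
    refine mul_le_mul_of_nonneg_left ?_ hη
    have : β * (‖G - w‖ ^ 2 / (2 * ρ)) = (β / ρ * ‖G - w‖ ^ 2) / 2 := by
      field_simp
    linarith
  have e9 : η ^ 2 * ‖t - y‖ ^ 2 ≤ η * ‖t - y‖ ^ 2 := by
    gcongr
    nlinarith
  rw [e3]
  have e10 : η * β / ρ * ‖G - w‖ ^ 2 = η * (β / ρ * ‖G - w‖ ^ 2) := by ring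
  rw [e10]
  linarith

/-- Movement of the regularised maximiser when all of `x`, `λ` and the regularisation change. -/
lemma argMax_step_le {k k' : ℕ} (hρ' : 0 < q.rho k') (hρ : q.rho k' ≤ q.rho k) {x x' : Vec dx}
    (hx : x ∈ P.X) (hx' : x' ∈ P.X) (lam lam' : Vec p) :
    ‖P.argMax q k' x' lam' - P.argMax q k x lam‖ ^ 2 ≤
      (q.rho k - q.rho k') / q.rho k' *
          (‖P.argMax q k' x' lam'‖ ^ 2 - ‖P.argMax q k x lam‖ ^ 2)
        + 2 * (l ^ 2 * ‖x' - x‖ ^ 2 + ‖P.B‖ ^ 2 * ‖lam' - lam‖ ^ 2) / q.rho k' ^ 2 := by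
  have h1 := h.argMax_mem q k hx lam
  have h2 := h.argMax_mem q k' hx' lam'
  have v1 := h.argMax_inner_le q k hx h2 lam
  have v2 := h.argMax_inner_le q k' hx' h1 lam'
  set s := P.argMax q k x lam
  set s' := P.argMax q k' x' lam'
  have hm := h.gradY_monotone hx' h1 h2
  set r := q.rho k
  set r' := q.rho k'
  have hu : ‖(P.gradY x' s - P.gradY x s) - ContinuousLinearMap.adjoint P.B (lam' - lam)‖ ^ 2 ≤
      2 * (l ^ 2 * ‖x' - x‖ ^ 2 + ‖P.B‖ ^ 2 * ‖lam' - lam‖ ^ 2) := by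
    have a1 : ‖P.gradY x' s - P.gradY x s‖ ≤ l * ‖x' - x‖ :=
      h.mean.lip_yx x' (h.X_sub hx') x (h.X_sub hx) s (h.Y_sub h1)
    have a2 : ‖ContinuousLinearMap.adjoint P.B (lam' - lam)‖ ≤ ‖P.B‖ * ‖lam' - lam‖ := by
      have := (ContinuousLinearMap.adjoint P.B).le_opNorm (lam' - lam)
      rwa [LinearIsometryEquiv.norm_map] at this
    have a3 := norm_sub_le (P.gradY x' s - P.gradY x s)
      (ContinuousLinearMap.adjoint P.B (lam' - lam))
    calc _ ≤ (l * ‖x' - x‖ + ‖P.B‖ * ‖lam' - lam‖) ^ 2 := by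
          gcongr
          linarith
      _ ≤ _ := by nlinarith [sq_nonneg (l * ‖x' - x‖ - ‖P.B‖ * ‖lam' - lam‖)]
  set u := (P.gradY x' s - P.gradY x s) - ContinuousLinearMap.adjoint P.B (lam' - lam) with hu_def
  have hcs := real_inner_le_norm u (s' - s)
  have e1 : inner ℝ (P.regGradY q k x s lam) (s' - s)
      + inner ℝ (P.regGradY q k' x' s' lam') (s - s') =
      -inner ℝ u (s' - s) - inner ℝ (P.gradY x' s' - P.gradY x' s) (s' - s)
        + inner ℝ (r' • s' - r • s) (s' - s) := by
    rw [hu_def, ← neg_sub s' s, inner_neg_right]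
    simp only [regGradY, inner_sub_left, map_sub]
    ring
  -- The change of regularisation is kept as the signed difference `‖s'‖² - ‖s‖²` instead of being
  -- estimated by `σ²`. This difference can later be summed by parts.
  have e2 : inner ℝ (r' • s' - r • s) (s' - s) =
      (r + r') / 2 * ‖s' - s‖ ^ 2 - (r - r') / 2 * (‖s'‖ ^ 2 - ‖s‖ ^ 2) := by
    rw [← real_inner_self_eq_norm_sq, ← real_inner_self_eq_norm_sq, ← real_inner_self_eq_norm_sq]
    simp only [inner_sub_left, inner_sub_right, real_inner_smul_left, real_inner_comm s s']
    ring
  have e3 : ‖u‖ * ‖s' - s‖ ≤ r' / 2 * ‖s' - s‖ ^ 2 + ‖u‖ ^ 2 / (2 * r') := by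
    have h6 : 0 ≤ (‖u‖ - r' * ‖s' - s‖) ^ 2 / (2 * r') := by positivity
    have h7 : (‖u‖ - r' * ‖s' - s‖) ^ 2 / (2 * r') =
        r' / 2 * ‖s' - s‖ ^ 2 + ‖u‖ ^ 2 / (2 * r') - ‖u‖ * ‖s' - s‖ := by
      field_simp
      ring
    linarith
  have e4 : r' * ‖s' - s‖ ^ 2 ≤ (r + r') / 2 * ‖s' - s‖ ^ 2 := by
    gcongr
    linarith
  have e5 : r' / 2 * ‖s' - s‖ ^ 2 ≤ (r - r') / 2 * (‖s'‖ ^ 2 - ‖s‖ ^ 2) + ‖u‖ ^ 2 / (2 * r') := by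
    linarith
  have e6 : ‖s' - s‖ ^ 2 ≤ (r - r') / r' * (‖s'‖ ^ 2 - ‖s‖ ^ 2) + ‖u‖ ^ 2 / r' ^ 2 := by
    have := mul_le_mul_of_nonneg_left e5 (show 0 ≤ 2 / r' by positivity)
    have a : 2 / r' * (r' / 2 * ‖s' - s‖ ^ 2) = ‖s' - s‖ ^ 2 := by field_simp
    have b : 2 / r' * ((r - r') / 2 * (‖s'‖ ^ 2 - ‖s‖ ^ 2) + ‖u‖ ^ 2 / (2 * r')) =
        (r - r') / r' * (‖s'‖ ^ 2 - ‖s‖ ^ 2) + ‖u‖ ^ 2 / r' ^ 2 := by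
      field_simp
    linarith
  refine e6.trans ?_
  gcongr

end Regular

end Problem

end ZORMPDPG

/-! ### The schedules as powers of `tau`, and the consequences of the bounds on the constants. -/

namespace ZORMPDPG

namespace Params

/-- The thirteenth root of `k + 2`, in powers of which all schedules are expressed. -/
noncomputable def tau (k : ℕ) : ℝ := ((k : ℝ) + 2) ^ (1 / 13 : ℝ)

lemma tau_pos (k : ℕ) : 0 < tau k := by unfold tau; positivity

lemma tau_pow (k n : ℕ) : tau k ^ n = ((k : ℝ) + 2) ^ (n / 13 : ℝ) := by
  rw [tau, ← Real.rpow_mul_natCast (by positivity)]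
  congr 1
  ring

lemma tau_pow_thirteen (k : ℕ) : tau k ^ 13 = (k : ℝ) + 2 := by
  rw [tau_pow]
  norm_num

lemma one_le_tau (k : ℕ) : 1 ≤ tau k :=
  Real.one_le_rpow (by linarith [(Nat.cast_nonneg k : (0 : ℝ) ≤ k)]) (by norm_num)

lemma tau_le_succ (k : ℕ) : tau k ≤ tau (k + 1) := by
  unfold tau
  gcongr
  simp

lemma eta_eq (k : ℕ) : eta k = 1 / tau k ^ 5 := by rw [eta, tau_pow]; norm_num

variable (q : Params)

lemma alpha_eq (k : ℕ) : q.alpha k = q.A₂ / tau k ^ 4 := by rw [alpha, tau_pow]; norm_num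

lemma gamma_eq (k : ℕ) : q.gamma k = q.A₃ / tau k ^ 4 := by rw [gamma, tau_pow]; norm_num

lemma rho_succ_eq (k : ℕ) : q.rho (k + 1) = q.L / tau k ^ 2 := by
  rw [rho, tau_pow]
  push_cast
  rw [show (k : ℝ) + 1 + 1 = k + 2 by ring]

lemma momX_eq (k : ℕ) : q.momX k = q.A₄ / tau k ^ 12 := by rw [momX, tau_pow]; norm_num

lemma momY_eq (k : ℕ) : q.momY k = q.A₅ / tau k ^ 8 := by rw [momY, tau_pow]; norm_num

lemma weightX_eq (k : ℕ) : q.weightX k = q.A₆ * tau k ^ 3 := by rw [weightX, tau_pow]; norm_num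

lemma weightY_eq (k : ℕ) : q.weightY k = q.A₇ * tau k ^ 3 := by rw [weightY, tau_pow]; norm_num

lemma eta_pos (k : ℕ) : 0 < eta k := by
  have := tau_pos k
  rw [eta_eq]; positivity

lemma eta_le_one (k : ℕ) : eta k ≤ 1 := by
  rw [eta_eq, div_le_one (by have := tau_pos k; positivity)]
  exact one_le_pow₀ (one_le_tau k)

/-- With `s = tau k` and `t = tau (k + 1)`, the relation `t¹³ - s¹³ = 1` gives `t¹² - s¹² ≤ 1`.
Factoring out `t³ - s³` leaves a cofactor of at least `(1 + 3/4 + 9/16) t⁹ ≥ 13/6 t⁹`, where `s³ ≥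
3/4 t³` uses `k ≥ 1`. The value 6/13 is half of the 12/13 in the lower bounds for `A₄` and `A₅`. -/
lemma tau_cube_sub_le {k : ℕ} (hk : 1 ≤ k) :
    tau (k + 1) ^ 9 * (tau (k + 1) ^ 3 - tau k ^ 3) ≤ 6 / 13 := by
  have h1 := tau_pow_thirteen k
  have h2 := tau_pow_thirteen (k + 1)
  have hs := tau_pos k
  have ht1 := one_le_tau (k + 1)
  have hst := tau_le_succ k
  have hk' : (1 : ℝ) ≤ k := by exact_mod_cast hk
  push_cast at h2
  set s := tau k
  set t := tau (k + 1)
  have ht : 0 < t := by linarith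
  have h3 : 3 / 4 * t ^ 3 ≤ s ^ 3 := by
    by_contra! hlt
    have : s ^ 13 ≤ t ^ 10 * s ^ 3 := by
      calc s ^ 13 = s ^ 10 * s ^ 3 := by ring
        _ ≤ t ^ 10 * s ^ 3 := by gcongr
    have : t ^ 10 * s ^ 3 < t ^ 10 * (3 / 4 * t ^ 3) := by gcongr
    nlinarith
  have hd : 0 ≤ t ^ 3 - s ^ 3 := sub_nonneg.2 (by gcongr)
  have h4 : t * (t ^ 12 - s ^ 12) ≤ 1 := by
    have : s ^ 13 ≤ t * s ^ 12 := by
      calc s ^ 13 = s * s ^ 12 := by ring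
        _ ≤ _ := by gcongr
    nlinarith
  have h5 : t ^ 12 - s ^ 12 = (t ^ 3 - s ^ 3) * (t ^ 9 + t ^ 6 * s ^ 3 + t ^ 3 * (s ^ 3) ^ 2
      + (s ^ 3) ^ 3) := by ring
  have h6 : 13 / 6 * t ^ 9 ≤ t ^ 9 + t ^ 6 * s ^ 3 + t ^ 3 * (s ^ 3) ^ 2 + (s ^ 3) ^ 3 := by
    have a1 : t ^ 6 * (3 / 4 * t ^ 3) ≤ t ^ 6 * s ^ 3 := by gcongr
    have a2 : t ^ 3 * (3 / 4 * t ^ 3) ^ 2 ≤ t ^ 3 * (s ^ 3) ^ 2 := by gcongr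
    have a3 : 0 ≤ (s ^ 3) ^ 3 := by positivity
    have a4 : 0 < t ^ 9 := by positivity
    nlinarith
  have h7 : (t ^ 3 - s ^ 3) * (13 / 6 * t ^ 9) ≤ t ^ 12 - s ^ 12 := by
    rw [h5]
    gcongr
  have h8 : t ^ 12 - s ^ 12 ≤ t * (t ^ 12 - s ^ 12) := by
    have : 0 ≤ t ^ 12 - s ^ 12 := sub_nonneg.2 (by gcongr)
    nlinarith
  linarith

namespace Admissible

variable {q} {nA nB : ℝ} (h : q.Admissible nA nB)

include h

lemma A₄_pos : 0 < q.A₄ := by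
  have := h.A₂_pos; have := h.A₆_pos; have := h.A₄_ge
  have : 0 < 4 * q.A₂ / q.A₆ := by positivity
  linarith

lemma A₅_pos : 0 < q.A₅ := by
  have := h.A₂_pos; have := h.A₇_pos; have := h.A₅_ge
  have : 0 < 640 * q.A₂ / q.A₇ := by positivity
  linarith

lemma alpha_pos (k : ℕ) : 0 < q.alpha k := by
  have := h.A₂_pos; have := tau_pos k
  rw [alpha_eq]; positivity

lemma gamma_pos (k : ℕ) : 0 < q.gamma k := by
  have := h.A₃_pos; have := tau_pos k
  rw [gamma_eq]; positivity

lemma alpha_le (k : ℕ) : q.alpha k ≤ q.A₂ := by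
  rw [alpha_eq]
  exact div_le_self h.A₂_pos.le (one_le_pow₀ (one_le_tau k))

lemma gamma_le (k : ℕ) : q.gamma k ≤ q.A₃ := by
  rw [gamma_eq]
  exact div_le_self h.A₃_pos.le (one_le_pow₀ (one_le_tau k))

lemma momX_nonneg (k : ℕ) : 0 ≤ q.momX k := by
  have := h.A₄_pos; have := tau_pos k
  rw [momX_eq]; positivity

lemma momY_nonneg (k : ℕ) : 0 ≤ q.momY k := by
  have := h.A₅_pos; have := tau_pos k
  rw [momY_eq]; positivity

lemma weightX_pos (k : ℕ) : 0 < q.weightX k := by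
  have := h.A₆_pos; have := tau_pos k
  rw [weightX_eq]; positivity

lemma weightY_pos (k : ℕ) : 0 < q.weightY k := by
  have := h.A₇_pos; have := tau_pos k
  rw [weightY_eq]; positivity

lemma gamma_mul_sq_le (k : ℕ) : q.gamma k * nB ^ 2 ≤ 2 * q.L ^ 2 * q.alpha k := by
  have ht := tau_pos k
  rw [gamma_eq, alpha_eq, div_mul_eq_mul_div, mul_div_assoc']
  have := h.A₃_le₁
  gcongr

lemma b_pos' : (0 : ℝ) < q.b := by exact_mod_cast h.b_pos

lemma weightX_mul_momX_sq_le (k : ℕ) :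
    q.weightX k * q.momX k ^ 2 ≤ q.A₄ ^ 2 * q.A₆ * (1 / ((k : ℝ) + 2)) := by
  have h1 := one_le_tau k
  have h6 := h.A₆_pos
  rw [weightX_eq, momX_eq, ← tau_pow_thirteen]
  set t := tau k
  have ht : 0 < t := by linarith
  have e : q.A₆ * t ^ 3 * (q.A₄ / t ^ 12) ^ 2 = q.A₄ ^ 2 * q.A₆ * (1 / t ^ 21) := by
    field_simp
  rw [e]
  gcongr
  norm_num

omit h in
-- The exponent is exactly `3 - 16 = -13`, so this variance term contributes to the logarithm. The
-- corresponding `x`-term has exponent -21 and is bounded by the same rate only for uniformity.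
lemma weightY_mul_momY_sq_le (k : ℕ) :
    q.weightY k * q.momY k ^ 2 ≤ q.A₅ ^ 2 * q.A₇ * (1 / ((k : ℝ) + 2)) := by
  have ht := tau_pos k
  rw [weightY_eq, momY_eq, ← tau_pow_thirteen]
  refine le_of_eq ?_
  field_simp

variable (hL : 0 < q.L)

include hL

omit h in
lemma rho_pos (k : ℕ) : 0 < q.rho k := by unfold rho; positivity

omit h in
lemma rho_succ_le (k : ℕ) : q.rho (k + 1) ≤ q.rho k := by
  unfold rho
  gcongr
  simp

omit h in
lemma rho_antitone : Antitone q.rho := antitone_nat_of_succ_le (rho_succ_le hL)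

omit h in
lemma rho_le (k : ℕ) : q.rho k ≤ q.L := by
  unfold rho
  exact div_le_self hL.le (Real.one_le_rpow (by simp) (by norm_num))

omit h in
-- The damping decays at least as fast as the regularisation. Hence the curvature `l² / ρ` of the
-- maximum, multiplied by `η`, is at most `L`.
lemma L_mul_eta_le (k : ℕ) : q.L * eta k ≤ q.rho k := by
  unfold rho eta
  rw [mul_one_div]
  gcongr
  calc ((k : ℝ) + 1) ^ (2 / 13 : ℝ) ≤ ((k : ℝ) + 2) ^ (2 / 13 : ℝ) := by gcongr; norm_num
    _ ≤ _ := Real.rpow_le_rpow_of_exponent_le (by linarith [(Nat.cast_nonneg k : (0 : ℝ) ≤ k)])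
      (by norm_num)

lemma alpha_mul_L_le (k : ℕ) : q.alpha k * q.L ≤ 1 / 8 := by
  have := mul_le_mul_of_nonneg_right ((h.alpha_le k).trans h.A₂_le₁) hL.le
  have e : 1 / (8 * q.L) * q.L = 1 / 8 := by field_simp
  linarith

lemma gamma_mul_L_le (k : ℕ) : q.gamma k * q.L ≤ 1 / 4 := by
  have := mul_le_mul_of_nonneg_right ((h.gamma_le k).trans h.A₃_le₂) hL.le
  have e : 1 / (4 * q.L) * q.L = 1 / 4 := by field_simp
  linarith

lemma β_mul_L_le : q.β * q.L ≤ 1 / 6 := by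
  have := mul_le_mul_of_nonneg_right h.β_le hL.le
  have e : 1 / (6 * q.L) * q.L = 1 / 6 := by field_simp
  linarith

omit h hL in
-- The coupling of the time scales: `α` and `ρ²` both decay like `τ⁻⁴`. Powers of `ρ` therefore
-- cancel in the tracking estimates, and conditions on the constants alone remain.
lemma alpha_mul_sq_eq (k : ℕ) : q.alpha k * q.L ^ 2 = q.A₂ * q.rho (k + 1) ^ 2 := by
  have := tau_pos k
  rw [alpha_eq, rho_succ_eq]
  field_simp

omit h hL in
lemma gamma_mul_sq_eq (k : ℕ) : q.gamma k * q.L ^ 2 = q.A₃ * q.rho (k + 1) ^ 2 := by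
  have := tau_pos k
  rw [gamma_eq, rho_succ_eq]
  field_simp

omit hL in
lemma A₂_sq_le : 2560 * q.A₂ ^ 2 ≤ q.β ^ 2 := by
  have h1 := h.A₂_le₂
  have h10 : (0 : ℝ) < √10 := by positivity
  rw [le_div_iff₀ (by positivity)] at h1
  have h2 : (q.A₂ * (16 * √10)) ^ 2 ≤ q.β ^ 2 := by
    have := h.A₂_pos
    gcongr
  have h3 : √10 ^ 2 = (10 : ℝ) := Real.sq_sqrt (by norm_num)
  calc 2560 * q.A₂ ^ 2 = q.A₂ ^ 2 * 256 * √10 ^ 2 := by rw [h3]; ring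
    _ = (q.A₂ * (16 * √10)) ^ 2 := by ring
    _ ≤ _ := h2

omit hL in
lemma A₂_mul_A₃_le : 1280 * q.A₂ * q.A₃ ≤ q.β ^ 2 := by
  have h1 := h.A₃_le₃
  have := h.A₂_pos
  rw [le_div_iff₀ (by positivity)] at h1
  linarith

lemma alpha_sq_mul_le (k : ℕ) :
    2560 * (q.alpha k * q.L ^ 2) ^ 2 ≤ q.β ^ 2 * q.rho (k + 1) ^ 4 := by
  rw [alpha_mul_sq_eq]
  have h1 := h.A₂_sq_le
  have := rho_pos hL (k + 1)
  calc 2560 * (q.A₂ * q.rho (k + 1) ^ 2) ^ 2 = (2560 * q.A₂ ^ 2) * q.rho (k + 1) ^ 4 := by ring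
    _ ≤ _ := by gcongr

lemma alpha_mul_gamma_le (k : ℕ) :
    1280 * (q.alpha k * q.L ^ 2) * (q.gamma k * q.L ^ 2) ≤ q.β ^ 2 * q.rho (k + 1) ^ 4 := by
  rw [alpha_mul_sq_eq, gamma_mul_sq_eq]
  have h1 := h.A₂_mul_A₃_le
  have := rho_pos hL (k + 1)
  calc 1280 * (q.A₂ * q.rho (k + 1) ^ 2) * (q.A₃ * q.rho (k + 1) ^ 2)
      = (1280 * q.A₂ * q.A₃) * q.rho (k + 1) ^ 4 := by ring
    _ ≤ _ := by gcongr

/-- This and its three companions say that the part of the estimator noise caused by the steps is a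
fixed fraction of the step units: 1/12 of `unitX` and 22/3 of `unitY`, for each estimator. -/
lemma weightX_mul_le (k : ℕ) : q.weightX k * (8 * q.L ^ 2) * (eta k * q.alpha k) ≤ q.b / 12 := by
  have h1 := h.A₆_le₁
  have hA := h.A₂_pos
  have h6 := h.A₆_pos
  rw [le_div_iff₀ (by positivity)] at h1
  have ht := tau_pos k
  have e : q.weightX k * (8 * q.L ^ 2) * (eta k * q.alpha k) =
      q.A₆ * (8 * q.A₂ * q.L ^ 2) / tau k ^ 6 := by
    rw [weightX_eq, eta_eq, alpha_eq]
    field_simp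
  rw [e]
  refine (div_le_self (by positivity) (one_le_pow₀ (one_le_tau k))).trans ?_
  linarith

lemma weightY_mul_le (k : ℕ) : q.weightY k * (8 * q.L ^ 2) * (eta k * q.alpha k) ≤ q.b / 12 := by
  have h1 := h.A₇_le₁
  have hA := h.A₂_pos
  have h7 := h.A₇_pos
  rw [le_div_iff₀ (by positivity)] at h1
  have ht := tau_pos k
  have e : q.weightY k * (8 * q.L ^ 2) * (eta k * q.alpha k) =
      q.A₇ * (8 * q.A₂ * q.L ^ 2) / tau k ^ 6 := by
    rw [weightY_eq, eta_eq, alpha_eq]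
    field_simp
  rw [e]
  refine (div_le_self (by positivity) (one_le_pow₀ (one_le_tau k))).trans ?_
  linarith

lemma weightX_mul_le' (k : ℕ) :
    q.weightX k * (8 * q.L ^ 2) * eta k * (q.β * q.rho (k + 1)) ≤
      22 / 3 * q.b * (q.alpha k * q.L ^ 2) := by
  have h1 := h.A₆_le₂
  have hβ := h.β_pos
  rw [le_div_iff₀ (by positivity)] at h1
  have ht := tau_pos k
  have e1 : q.weightX k * (8 * q.L ^ 2) * eta k * (q.β * q.rho (k + 1)) =
      (8 / 12 * q.L ^ 2) * (q.A₆ * (12 * q.L * q.β)) / tau k ^ 4 := by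
    rw [weightX_eq, eta_eq, rho_succ_eq]
    field_simp
  have e2 : 22 / 3 * q.b * (q.alpha k * q.L ^ 2) =
      (8 / 12 * q.L ^ 2) * (11 * q.b * q.A₂) / tau k ^ 4 := by
    rw [alpha_eq]
    field_simp
    ring
  rw [e1, e2]
  gcongr

lemma weightY_mul_le' (k : ℕ) :
    q.weightY k * (8 * q.L ^ 2) * eta k * (q.β * q.rho (k + 1)) ≤
      22 / 3 * q.b * (q.alpha k * q.L ^ 2) := by
  have h1 := h.A₇_le₂
  have hβ := h.β_pos
  rw [le_div_iff₀ (by positivity)] at h1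
  have ht := tau_pos k
  have e1 : q.weightY k * (8 * q.L ^ 2) * eta k * (q.β * q.rho (k + 1)) =
      (8 / 12 * q.L ^ 2) * (q.A₇ * (12 * q.L * q.β)) / tau k ^ 4 := by
    rw [weightY_eq, eta_eq, rho_succ_eq]
    field_simp
  have e2 : 22 / 3 * q.b * (q.alpha k * q.L ^ 2) =
      (8 / 12 * q.L ^ 2) * (11 * q.b * q.A₂) / tau k ^ 4 := by
    rw [alpha_eq]
    field_simp
    ring
  rw [e1, e2]
  gcongr

omit hL in
-- The squared error enters through the descent of the maximum, through the gap, and through its own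
-- contracted recursion, where `(1 - m)² ≤ 1 - m`. The loss due to momentum is `A₄ A₆ / τ⁹`: half of
-- it pays for `2 A₂` and the growth of the weight, a quarter for `3 D₁ A₂`.
lemma errX_coeff_le {k : ℕ} (hk : 1 ≤ k) :
    2 * (eta (k + 1) * q.alpha (k + 1)) + 3 * q.D₁ * (eta (k + 1) * q.alpha (k + 1))
      + q.weightX (k + 1) * (1 - q.momX (k + 1)) ^ 2 ≤ q.weightX k := by
  have h1 := tau_cube_sub_le hk
  have ht := tau_pos (k + 1)
  have hA := h.A₂_pos
  have h6 := h.A₆_pos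
  have hw := h.weightX_pos (k + 1)
  have hm0 := h.momX_nonneg (k + 1)
  have hm1 := h.momX_le (k + 1) (by omega)
  have h2 : q.weightX (k + 1) * (1 - q.momX (k + 1)) ^ 2 ≤
      q.weightX (k + 1) * (1 - q.momX (k + 1)) := by
    gcongr
    nlinarith
  have h3 := h.A₄_ge
  have h4 := h.D₁_le₄
  rw [le_div_iff₀ (by positivity)] at h4
  have h5 : 4 * q.A₂ + 12 / 13 * q.A₆ ≤ q.A₄ * q.A₆ := by
    have := mul_le_mul_of_nonneg_right h3 h6.le
    have e : (4 * q.A₂ / q.A₆ + 12 / 13) * q.A₆ = 4 * q.A₂ + 12 / 13 * q.A₆ := by field_simp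
    linarith
  have h7 : q.A₆ * (tau (k + 1) ^ 9 * (tau (k + 1) ^ 3 - tau k ^ 3)) ≤ q.A₆ * (6 / 13) := by
    gcongr
  have h8 : 2 * q.A₂ + 3 * q.D₁ * q.A₂ +
      q.A₆ * (tau (k + 1) ^ 9 * (tau (k + 1) ^ 3 - tau k ^ 3)) - q.A₄ * q.A₆ ≤ 0 := by
    linarith
  have e : 2 * (eta (k + 1) * q.alpha (k + 1)) + 3 * q.D₁ * (eta (k + 1) * q.alpha (k + 1))
      + q.weightX (k + 1) * (1 - q.momX (k + 1)) - q.weightX k =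
      (2 * q.A₂ + 3 * q.D₁ * q.A₂ +
      q.A₆ * (tau (k + 1) ^ 9 * (tau (k + 1) ^ 3 - tau k ^ 3)) - q.A₄ * q.A₆) / tau (k + 1) ^ 9 := by
    rw [weightX_eq, weightX_eq, eta_eq, alpha_eq, momX_eq]
    field_simp
    ring
  have := div_nonpos_of_nonpos_of_nonneg h8 (by positivity : 0 ≤ tau (k + 1) ^ 9)
  linarith

omit hL in
-- Same balance as for `x`, but here the error is charged with `η ~ τ⁻⁵` instead of `η α ~ τ⁻⁹`, as
-- it enters through the tracking of the maximiser. This is why `momY` decays only like `τ⁻⁸`.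
lemma errY_coeff_le {k : ℕ} (hk : 1 ≤ k) :
    67 * q.A₂ * eta (k + 1) + 6 * q.D₁ * (eta (k + 1) * q.alpha (k + 1))
      + q.weightY (k + 1) * (1 - q.momY (k + 1)) ^ 2 ≤ q.weightY k := by
  have h1 := tau_cube_sub_le hk
  have ht := tau_pos (k + 1)
  have ht1 := one_le_tau (k + 1)
  have hA := h.A₂_pos
  have hD := h.D₁_pos
  have h6 := h.A₇_pos
  have hw := h.weightY_pos (k + 1)
  have hm0 := h.momY_nonneg (k + 1)
  have hm1 := h.momY_le (k + 1) (by omega)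
  have h2 : q.weightY (k + 1) * (1 - q.momY (k + 1)) ^ 2 ≤
      q.weightY (k + 1) * (1 - q.momY (k + 1)) := by
    gcongr
    nlinarith
  have h3 := h.A₅_ge
  have h4 := h.D₁_le₅
  rw [le_div_iff₀ (by positivity)] at h4
  have h5 : 640 * q.A₂ + 12 / 13 * q.A₇ ≤ q.A₅ * q.A₇ := by
    have := mul_le_mul_of_nonneg_right h3 h6.le
    have e : (640 * q.A₂ / q.A₇ + 12 / 13) * q.A₇ = 640 * q.A₂ + 12 / 13 * q.A₇ := by field_simp
    linarith
  have h70 : tau (k + 1) ^ 5 * (tau (k + 1) ^ 3 - tau k ^ 3) ≤ 6 / 13 := by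
    refine le_trans ?_ h1
    have : 0 ≤ tau (k + 1) ^ 3 - tau k ^ 3 :=
      sub_nonneg.2 (pow_le_pow_left₀ (tau_pos k).le (tau_le_succ k) 3)
    gcongr
    norm_num
  have h7 : q.A₇ * (tau (k + 1) ^ 5 * (tau (k + 1) ^ 3 - tau k ^ 3)) ≤ q.A₇ * (6 / 13) := by
    gcongr
  have h9 : q.alpha (k + 1) ≤ q.A₂ := h.alpha_le _
  have h8 : 67 * q.A₂ + 6 * q.D₁ * q.alpha (k + 1) +
      q.A₇ * (tau (k + 1) ^ 5 * (tau (k + 1) ^ 3 - tau k ^ 3)) - q.A₅ * q.A₇ ≤ 0 := by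
    have : q.D₁ * q.alpha (k + 1) ≤ q.D₁ * q.A₂ := by gcongr
    linarith
  have e : 67 * q.A₂ * eta (k + 1) + 6 * q.D₁ * (eta (k + 1) * q.alpha (k + 1))
      + q.weightY (k + 1) * (1 - q.momY (k + 1)) - q.weightY k =
      (67 * q.A₂ + 6 * q.D₁ * q.alpha (k + 1) +
      q.A₇ * (tau (k + 1) ^ 5 * (tau (k + 1) ^ 3 - tau k ^ 3)) - q.A₅ * q.A₇) / tau (k + 1) ^ 5 := by
    rw [weightY_eq, weightY_eq, eta_eq, momY_eq]
    field_simp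
    ring
  have := div_nonpos_of_nonpos_of_nonneg h8 (by positivity : 0 ≤ tau (k + 1) ^ 5)
  linarith

omit hL in
lemma gapX_coeff_le (hA : 0 ≤ nA) (k : ℕ) :
    q.D₁ * (3 + 3 * (q.alpha k * nA) ^ 2) ≤ 1 / 8 := by
  have h1 := h.A₂_le₃
  have h2 : (q.alpha k * (√3 * nA)) ^ 2 ≤ 1 := by
    have h0 := (h.alpha_pos k).le
    refine pow_le_one₀ (by positivity) (le_trans ?_ h1)
    gcongr
    exact h.alpha_le k
  have h3 : √3 ^ 2 = (3 : ℝ) := Real.sq_sqrt (by norm_num)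
  have h4 : (q.alpha k * (√3 * nA)) ^ 2 = 3 * (q.alpha k * nA) ^ 2 := by
    calc _ = √3 ^ 2 * (q.alpha k * nA) ^ 2 := by ring
      _ = _ := by rw [h3]
  have := h.D₁_le₁
  have := h.D₁_pos
  nlinarith

omit hL in
lemma gapY_coeff_le : q.D₁ * (6 + 3 * nB ^ 2 * q.β ^ 2) ≤ 2 * q.L * q.β := by
  have h1 := h.D₁_le₂
  have hβ := h.β_pos
  rw [le_div_iff₀ (by positivity)] at h1
  have h2 := mul_le_mul_of_nonneg_right h1 (by positivity : 0 ≤ 2 * q.β)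
  have e : q.D₁ * (3 / q.β + 3 * nB ^ 2 * q.β) * (2 * q.β) =
      q.D₁ * (6 + 6 * nB ^ 2 * q.β ^ 2) := by
    field_simp
    ring
  have := h.D₁_pos
  have : q.D₁ * (6 + 3 * nB ^ 2 * q.β ^ 2) ≤ q.D₁ * (6 + 6 * nB ^ 2 * q.β ^ 2) := by
    gcongr
    norm_num
  linarith

omit hL in
lemma gapLam_coeff_le (k : ℕ) : q.D₁ * (3 * q.alpha k) ≤ q.gamma k / 8 := by
  have h1 := h.D₁_le₃
  have hA := h.A₂_pos
  rw [le_div_iff₀ (by positivity)] at h1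
  have ht := tau_pos k
  have e1 : q.D₁ * (3 * q.alpha k) = (q.D₁ * (24 * q.A₂)) / (8 * tau k ^ 4) := by
    rw [alpha_eq]; field_simp; ring
  have e2 : q.gamma k / 8 = q.A₃ / (8 * tau k ^ 4) := by rw [gamma_eq]; field_simp
  rw [e1, e2]
  gcongr

/-- Allows the coefficient of the tracking error after a step to be replaced by that of the
preceding index, so that this part of the potential telescopes. -/
lemma alpha_div_rho_succ_le (k : ℕ) :
    q.alpha (k + 1) / q.rho (k + 2) ≤ q.alpha k / q.rho (k + 1) := by
  have h1 := tau_pos k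
  have h2 := tau_pos (k + 1)
  have e : ∀ j, q.alpha j / q.rho (j + 1) = q.A₂ / (q.L * tau j ^ 2) := fun j => by
    have := tau_pos j
    rw [alpha_eq, rho_succ_eq]
    field_simp
  rw [e k, e (k + 1)]
  have := h.A₂_pos
  have := tau_le_succ k
  gcongr

omit h in
lemma thetaX_nonneg (dx : ℕ) {ε : ℝ} (hε : 0 < ε) (k : ℕ) :
    0 ≤ q.thetaX dx ε k := by
  unfold thetaX; positivity

omit h in
lemma thetaY_nonneg (dy : ℕ) {ε : ℝ} (hε : 0 < ε) (k : ℕ) :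
    0 ≤ q.thetaY dy ε k := by
  unfold thetaY; positivity

lemma thetaX_pos {dx : ℕ} (hd : 0 < dx) {ε : ℝ} (hε : 0 < ε) (k : ℕ) :
    0 < q.thetaX dx ε k := by
  have := h.D₁_pos; have := h.A₆_pos; have := h.A₂_pos; have := h.b_pos'
  have : (0 : ℝ) < dx := by exact_mod_cast hd
  unfold thetaX; positivity

lemma thetaY_pos {dy : ℕ} (hd : 0 < dy) {ε : ℝ} (hε : 0 < ε) (k : ℕ) :
    0 < q.thetaY dy ε k := by
  have := h.D₁_pos; have := h.A₇_pos; have := h.A₂_pos; have := h.b_pos'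
  have : (0 : ℝ) < dy := by exact_mod_cast hd
  unfold thetaY; positivity

omit h in
lemma thetaX_antitone (dx : ℕ) {ε : ℝ} (hε : 0 < ε) : Antitone (q.thetaX dx ε) := by
  intro j k hjk
  unfold thetaX
  gcongr

omit h in
lemma thetaY_antitone (dy : ℕ) {ε : ℝ} (hε : 0 < ε) : Antitone (q.thetaY dy ε) := by
  intro j k hjk
  unfold thetaY
  gcongr

lemma thetaX_sq_le (dx : ℕ) (ε : ℝ) (k : ℕ) :
    dx * q.L ^ 2 * q.thetaX dx ε k ^ 2 * (24 * q.D₁ + 16 + 64 * q.A₆ / (q.b * q.A₂)) ≤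
      ε ^ 2 * q.D₁ / tau k ^ 12 := by
  have := h.D₁_pos; have := h.A₆_pos; have := h.A₂_pos; have := h.b_pos'
  have ht := tau_pos k
  set M := 24 * q.D₁ + 16 + 64 * q.A₆ / (q.b * q.A₂) with hM
  have hM0 : 0 < M := by positivity
  have e : ((k : ℝ) + 2) ^ (6 / 13 : ℝ) = tau k ^ 6 := by rw [tau_pow]; norm_num
  unfold thetaX
  rw [e, mul_pow, Real.sq_sqrt (by positivity)]
  -- For `dx = 0` the radicand is a division by zero and `θ = 0`; this case is the reason for
  -- stating an inequality rather than an equality.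
  rcases Nat.eq_zero_or_pos dx with hd | hd
  · subst hd
    simp only [Nat.cast_zero, zero_mul]
    positivity
  · have : (0 : ℝ) < dx := by exact_mod_cast hd
    rw [← hM]
    refine le_of_eq ?_
    field_simp

lemma thetaY_sq_le (dy : ℕ) (ε : ℝ) (k : ℕ) :
    dy * q.L ^ 2 * q.thetaY dy ε k ^ 2 * (24 * q.D₁ + 1280 + 64 * q.A₇ / (q.b * q.A₂)) ≤
      ε ^ 2 * q.D₁ / tau k ^ 12 := by
  have := h.D₁_pos; have := h.A₇_pos; have := h.A₂_pos; have := h.b_pos'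
  have ht := tau_pos k
  set M := 24 * q.D₁ + 1280 + 64 * q.A₇ / (q.b * q.A₂) with hM
  have hM0 : 0 < M := by positivity
  have e : ((k : ℝ) + 2) ^ (6 / 13 : ℝ) = tau k ^ 6 := by rw [tau_pow]; norm_num
  unfold thetaY
  rw [e, mul_pow, Real.sq_sqrt (by positivity)]
  rcases Nat.eq_zero_or_pos dy with hd | hd
  · subst hd
    simp only [Nat.cast_zero, zero_mul]
    positivity
  · have : (0 : ℝ) < dy := by exact_mod_cast hd
    rw [← hM]
    refine le_of_eq ?_
    field_simp

/-- The bracket collects the coefficients with which the squared bias enters one iteration: descent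
of the maximum, gap, and noise of the estimator. The radicand of `θ` dominates them all; `θ² ~ τ⁻¹²`
against the weight `τ³` leaves `τ⁻⁹ ~ η α`. The `x` and `y` parts, 1/16 each, together cost 1/8. -/
lemma biasX_total_le (dx : ℕ) (ε : ℝ) (k : ℕ) :
    dx * q.L ^ 2 * q.thetaX dx ε k ^ 2 *
        (eta k * q.alpha k / 2 + 3 / 4 * q.D₁ * (eta k * q.alpha k) + 4 * q.weightX k / q.b) ≤
      1 / 16 * (q.D₁ * (eta k * q.alpha k) * ε ^ 2) := by
  have h1 := h.thetaX_sq_le hL dx ε k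
  have hD := h.D₁_pos; have hA := h.A₂_pos; have hb := h.b_pos'; have h6 := h.A₆_pos
  have ht := tau_pos k
  have hea : eta k * q.alpha k ≤ q.A₂ * tau k ^ 3 := by
    calc eta k * q.alpha k ≤ 1 * q.A₂ := by
          gcongr
          · exact (h.alpha_pos k).le
          · exact eta_le_one k
          · exact h.alpha_le k
      _ ≤ _ := by nlinarith [one_le_pow₀ (one_le_tau k) (n := 3)]
  have h2 : eta k * q.alpha k / 2 + 3 / 4 * q.D₁ * (eta k * q.alpha k) + 4 * q.weightX k / q.b ≤
      (q.A₂ * tau k ^ 3) * (24 * q.D₁ + 16 + 64 * q.A₆ / (q.b * q.A₂)) / 16 := by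
    have e : (q.A₂ * tau k ^ 3) * (24 * q.D₁ + 16 + 64 * q.A₆ / (q.b * q.A₂)) / 16 =
        3 / 2 * q.D₁ * (q.A₂ * tau k ^ 3) + q.A₂ * tau k ^ 3 + 4 * q.weightX k / q.b := by
      rw [weightX_eq]
      field_simp
      ring
    rw [e]
    have : 3 / 4 * q.D₁ * (eta k * q.alpha k) ≤ 3 / 4 * q.D₁ * (q.A₂ * tau k ^ 3) := by gcongr
    have : 0 < q.A₂ * tau k ^ 3 := by positivity
    have : 0 < q.D₁ * (q.A₂ * tau k ^ 3) := by positivity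
    linarith
  calc _ ≤ dx * q.L ^ 2 * q.thetaX dx ε k ^ 2 *
        ((q.A₂ * tau k ^ 3) * (24 * q.D₁ + 16 + 64 * q.A₆ / (q.b * q.A₂)) / 16) := by gcongr
    _ = (q.A₂ * tau k ^ 3 / 16) * (dx * q.L ^ 2 * q.thetaX dx ε k ^ 2 *
        (24 * q.D₁ + 16 + 64 * q.A₆ / (q.b * q.A₂))) := by ring
    _ ≤ (q.A₂ * tau k ^ 3 / 16) * (ε ^ 2 * q.D₁ / tau k ^ 12) := by gcongr
    _ = _ := by
      rw [eta_eq, alpha_eq]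
      field_simp

lemma biasY_total_le (dy : ℕ) (ε : ℝ) (k : ℕ) :
    dy * q.L ^ 2 * q.thetaY dy ε k ^ 2 *
        (67 / 4 * q.A₂ * eta k + 3 / 2 * q.D₁ * (eta k * q.alpha k) + 4 * q.weightY k / q.b) ≤
      1 / 16 * (q.D₁ * (eta k * q.alpha k) * ε ^ 2) := by
  have h1 := h.thetaY_sq_le hL dy ε k
  have hD := h.D₁_pos; have hA := h.A₂_pos; have hb := h.b_pos'; have h6 := h.A₇_pos
  have ht := tau_pos k
  have hτ := one_le_pow₀ (one_le_tau k) (n := 3)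
  have hea : eta k * q.alpha k ≤ q.A₂ * tau k ^ 3 := by
    calc eta k * q.alpha k ≤ 1 * q.A₂ := by
          gcongr
          · exact (h.alpha_pos k).le
          · exact eta_le_one k
          · exact h.alpha_le k
      _ ≤ _ := by nlinarith
  have h2 : 67 / 4 * q.A₂ * eta k + 3 / 2 * q.D₁ * (eta k * q.alpha k) + 4 * q.weightY k / q.b ≤
      (q.A₂ * tau k ^ 3) * (24 * q.D₁ + 1280 + 64 * q.A₇ / (q.b * q.A₂)) / 16 := by
    have e : (q.A₂ * tau k ^ 3) * (24 * q.D₁ + 1280 + 64 * q.A₇ / (q.b * q.A₂)) / 16 =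
        3 / 2 * q.D₁ * (q.A₂ * tau k ^ 3) + 80 * (q.A₂ * tau k ^ 3) + 4 * q.weightY k / q.b := by
      rw [weightY_eq]
      field_simp
      ring
    rw [e]
    have : 3 / 2 * q.D₁ * (eta k * q.alpha k) ≤ 3 / 2 * q.D₁ * (q.A₂ * tau k ^ 3) := by gcongr
    have : q.A₂ * eta k ≤ q.A₂ * tau k ^ 3 := by
      gcongr
      exact (eta_le_one k).trans hτ
    have : 0 < q.A₂ * tau k ^ 3 := by positivity
    linarith
  calc _ ≤ dy * q.L ^ 2 * q.thetaY dy ε k ^ 2 *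
        ((q.A₂ * tau k ^ 3) * (24 * q.D₁ + 1280 + 64 * q.A₇ / (q.b * q.A₂)) / 16) := by gcongr
    _ = (q.A₂ * tau k ^ 3 / 16) * (dy * q.L ^ 2 * q.thetaY dy ε k ^ 2 *
        (24 * q.D₁ + 1280 + 64 * q.A₇ / (q.b * q.A₂))) := by ring
    _ ≤ (q.A₂ * tau k ^ 3 / 16) * (ε ^ 2 * q.D₁ / tau k ^ 12) := by gcongr
    _ = _ := by
      rw [eta_eq, alpha_eq]
      field_simp

end Admissible

end Params

end ZORMPDPG

namespace ZORMPDPG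

/-! ### Scalar inequalities -/

/-- The curvature term takes 3/16 by `L η ≤ ρ` and `α L ≤ 1/8`; the cross term with the tracking
error takes 1/32 by Young, at the price of 8 units of `e²`. -/
lemma scalar_step_x_le {η α ρ L l X e : ℝ} (hη : 0 < η) (hη1 : η ≤ 1) (hα : 0 < α) (hρ : 0 < ρ)
    (hL : 0 < L) (hl : 0 < l) (hlL : l ≤ L) (hLη : L * η ≤ ρ) (hαL : α * L ≤ 1 / 8) (hX : 0 ≤ X)
    (he : 0 ≤ e) :
    (l / 2 + l ^ 2 / ρ) * (η * X) ^ 2 + l * (η * X) * e ≤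
      7 / 32 * (η / α * X ^ 2) + 8 * (η * α * L ^ 2 * e ^ 2) := by
  have b1 : (l / 2 + l ^ 2 / ρ) * (η * X) ^ 2 ≤ 3 / 16 * (η / α * X ^ 2) := by
    have c1 : l ^ 2 / ρ * η ≤ L := by
      rw [div_mul_eq_mul_div, div_le_iff₀ hρ]
      calc l ^ 2 * η ≤ L ^ 2 * η := by gcongr
        _ = L * (L * η) := by ring
        _ ≤ _ := by gcongr
    have c2 : l / 2 * η ≤ L / 2 * 1 := by gcongr
    have c3 : (l / 2 + l ^ 2 / ρ) * η ≤ 3 / 16 * (1 / α) := by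
      have : L ≤ 1 / 8 * (1 / α) := by
        rw [mul_one_div, le_div_iff₀ hα]; linarith only [hαL]
      linarith only [this, c1, c2]
    calc (l / 2 + l ^ 2 / ρ) * (η * X) ^ 2 = ((l / 2 + l ^ 2 / ρ) * η) * (η * X ^ 2) := by ring
      _ ≤ (3 / 16 * (1 / α)) * (η * X ^ 2) := by gcongr
      _ = _ := by ring
  have b3 : l * (η * X) * e ≤ 1 / 32 * (η / α * X ^ 2) + 8 * (η * α * L ^ 2 * e ^ 2) := by
    have c1 : 0 ≤ η / (32 * α) * (X - 16 * (α * L * e)) ^ 2 := by positivity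
    have e1 : η / (32 * α) * (X - 16 * (α * L * e)) ^ 2 =
        1 / 32 * (η / α * X ^ 2) + 8 * (η * α * L ^ 2 * e ^ 2) - L * (η * X) * e := by
      field_simp
      ring
    have : l * (η * X) * e ≤ L * (η * X) * e := by gcongr
    linarith only [this, e1, c1]
  linarith only [b1, b3]

/-- Here the cross term is governed by `B² γ ≤ 2 L² α`, which converts steps in `λ` into the same
units of tracking error as steps in `x`. -/
lemma scalar_step_lam_le {η α γ ρ L B Λ e : ℝ} (hη : 0 < η) (hα : 0 < α)
    (hγ : 0 < γ) (hρ : 0 < ρ) (hL : 0 < L) (hB : 0 ≤ B) (hBL : B ≤ L) (hLη : L * η ≤ ρ)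
    (hγL : γ * L ≤ 1 / 4) (hγB : γ * B ^ 2 ≤ 2 * L ^ 2 * α) :
    B ^ 2 / ρ * (η * Λ) ^ 2 + B * (η * Λ) * e ≤
      5 / 16 * (η / γ * Λ ^ 2) + 8 * (η * α * L ^ 2 * e ^ 2) := by
  have b2 : B ^ 2 / ρ * (η * Λ) ^ 2 ≤ 1 / 4 * (η / γ * Λ ^ 2) := by
    have c1 : B ^ 2 / ρ * η ≤ L := by
      rw [div_mul_eq_mul_div, div_le_iff₀ hρ]
      calc B ^ 2 * η ≤ L ^ 2 * η := by gcongr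
        _ = L * (L * η) := by ring
        _ ≤ _ := by gcongr
    have c3 : L ≤ 1 / 4 * (1 / γ) := by
      rw [mul_one_div, le_div_iff₀ hγ]; linarith only [hγL]
    calc B ^ 2 / ρ * (η * Λ) ^ 2 = (B ^ 2 / ρ * η) * (η * Λ ^ 2) := by ring
      _ ≤ (1 / 4 * (1 / γ)) * (η * Λ ^ 2) :=
        mul_le_mul_of_nonneg_right (c1.trans c3) (by positivity)
      _ = _ := by ring
  have hBα : B ^ 2 / (α * L ^ 2) ≤ 2 / γ := by
    rw [div_le_div_iff₀ (by positivity) hγ]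
    linarith only [hγB]
  have b4 : B * (η * Λ) * e ≤ 1 / 16 * (η / γ * Λ ^ 2) + 8 * (η * α * L ^ 2 * e ^ 2) := by
    have c1 : 0 ≤ η / (32 * (α * L ^ 2)) * (B * Λ - 16 * (α * L ^ 2 * e)) ^ 2 := by positivity
    have e1 : η / (32 * (α * L ^ 2)) * (B * Λ - 16 * (α * L ^ 2 * e)) ^ 2 =
        η * Λ ^ 2 / 32 * (B ^ 2 / (α * L ^ 2)) + 8 * (η * α * L ^ 2 * e ^ 2)
          - B * (η * Λ) * e := by
      field_simp
      ring
    have c2 : η * Λ ^ 2 / 32 * (B ^ 2 / (α * L ^ 2)) ≤ η * Λ ^ 2 / 32 * (2 / γ) := by gcongr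
    have e2 : η * Λ ^ 2 / 32 * (2 / γ) = 1 / 16 * (η / γ * Λ ^ 2) := by ring
    linarith only [c1, e1, c2, e2]
  linarith only [b2, b4]

/-- Pays for computing the `λ`-step at the new `y` while the maximum is expanded at the old one; the
smallness of `β ρ'` makes a unit of `Y²` large enough. -/
lemma scalar_step_y_le {η α γ ρ' β L B Λ Y : ℝ} (hη : 0 < η) (hη1 : η ≤ 1) (hα : 0 < α)
    (hγ : 0 < γ) (hβ : 0 < β) (hρ' : 0 < ρ') (hβρ : β * ρ' ≤ 1 / 6)
    (hγB : γ * B ^ 2 ≤ 2 * L ^ 2 * α) :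
    B * (η * Λ) * (η * Y) ≤ 1 / 8 * (η / γ * Λ ^ 2) + η * α * L ^ 2 / (β * ρ') * Y ^ 2 := by
  have c0 : 0 ≤ η / (8 * γ) * (Λ - 4 * (η * γ * B * Y)) ^ 2 := by positivity
  have e1 : η / (8 * γ) * (Λ - 4 * (η * γ * B * Y)) ^ 2 =
      1 / 8 * (η / γ * Λ ^ 2) + 2 * η ^ 3 * Y ^ 2 * (γ * B ^ 2) - B * (η * Λ) * (η * Y) := by
    field_simp
    ring
  have c1 : 2 * η ^ 3 * Y ^ 2 * (γ * B ^ 2) ≤ 2 * η ^ 3 * Y ^ 2 * (2 * L ^ 2 * α) := by gcongr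
  have c2 : 4 ≤ 1 / (β * ρ') := by
    rw [le_div_iff₀ (by positivity)]
    linarith only [hβρ]
  have c3 : η ^ 2 ≤ 1 := pow_le_one₀ hη.le hη1
  have c4 : (η * α * L ^ 2 * Y ^ 2) * (η ^ 2 * 4) ≤
      (η * α * L ^ 2 * Y ^ 2) * (1 * (1 / (β * ρ'))) := by gcongr
  have e2 : (η * α * L ^ 2 * Y ^ 2) * (1 * (1 / (β * ρ'))) =
      η * α * L ^ 2 / (β * ρ') * Y ^ 2 := by ring
  linarith only [c0, e1, c1, c4, e2]

lemma sq_norm_sub_le_two_mul {n : ℕ} (M G v : Vec n) :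
    ‖G - v‖ ^ 2 ≤ 2 * (‖M - v‖ ^ 2 + ‖M - G‖ ^ 2) := by
  have a3 : ‖G - v‖ ≤ ‖M - v‖ + ‖M - G‖ := by
    have := norm_sub_le_norm_sub_add_norm_sub G M v
    rw [norm_sub_rev G M] at this
    linarith
  calc _ ≤ (‖M - v‖ + ‖M - G‖) ^ 2 := by gcongr
    _ ≤ _ := by nlinarith [sq_nonneg (‖M - v‖ - ‖M - G‖)]

/-- Inner products with an inexact gradient `v` in place of `G`. -/
lemma inner_le_of_inexact {n : ℕ} (M G v d : Vec n) {α : ℝ} (hα : 0 < α) :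
    inner ℝ G d ≤ inner ℝ v d
      + (‖d‖ ^ 2 / (4 * α) + 2 * α * (‖M - v‖ ^ 2 + ‖M - G‖ ^ 2)) := by
  have a1 : inner ℝ G d = inner ℝ v d + inner ℝ (G - v) d := by
    rw [inner_sub_left]; ring
  have a2 := real_inner_le_norm (G - v) d
  have c : 0 ≤ (‖d‖ - 2 * α * ‖G - v‖) ^ 2 / (4 * α) := by positivity
  have e : (‖d‖ - 2 * α * ‖G - v‖) ^ 2 / (4 * α) =
      ‖d‖ ^ 2 / (4 * α) + α * ‖G - v‖ ^ 2 - ‖G - v‖ * ‖d‖ := by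
    field_simp
    ring
  have a6 : α * ‖G - v‖ ^ 2 ≤ α * (2 * (‖M - v‖ ^ 2 + ‖M - G‖ ^ 2)) := by
    gcongr
    exact sq_norm_sub_le_two_mul M G v
  linarith

/-- Combination of the contraction of an ascent step with the movement of the maximiser. -/
lemma scalar_tracking_le {η α ρ ρ' β L A E Y g N r2 d2 t2 C R F : ℝ} (hη : 0 < η) (hη1 : η ≤ 1)
    (hα : 0 < α) (hβ : 0 < β) (hρ' : 0 < ρ') (hρ : ρ' ≤ ρ) (hβρ : β * ρ ≤ 1 / 6) (hA : 0 < A)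
    (hN : 0 ≤ N) (hE : 0 ≤ E) (hαρ : α * L ^ 2 = A * ρ' ^ 2)
    (hF : F = 32 * α * L ^ 2 / (β * ρ')) (hg : g ≤ 2 * N) (hd0 : 0 ≤ d2)
    (htri : ∀ c : ℝ, 0 < c → t2 ≤ (1 + c) * r2 + (1 + 1 / c) * d2)
    (hr : r2 ≤ (1 - η * β * ρ) * E - 5 / 6 * η * Y ^ 2 + η * β / ρ * g)
    (hd : d2 ≤ (ρ - ρ') / ρ' * C + R) :
    F * t2 ≤ F * E - 24 * (η * α * L ^ 2 * E) - 80 / 3 * (η * α * L ^ 2 / (β * ρ') * Y ^ 2)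
      + 67 * A * η * N + 160 * α * L ^ 2 * (ρ - ρ') / (η * β ^ 2 * ρ' ^ 3) * C
      + 160 * α * L ^ 2 / (η * β ^ 2 * ρ' ^ 2) * R := by
  have hρ0 : 0 < ρ := hρ'.trans_le hρ
  -- A quarter of the contraction rate as Young parameter: `(1 + σ)(1 - 4σ) ≤ 1 - 3σ` keeps three
  -- quarters of the contraction, and movement of the maximiser is amplified by at most `5 / (η β
  -- ρ')`. Multiplied by `F`, the retained part is at least 24 units of tracking error.
  obtain ⟨σ, hσ⟩ : ∃ σ, σ = η * β * ρ / 4 := ⟨_, rfl⟩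
  have hσ0 : 0 < σ := by rw [hσ]; positivity
  have hηβ : η * (β * ρ) ≤ 1 * (1 / 6) := by gcongr
  have hσ1 : σ ≤ 1 / 24 := by rw [hσ]; linarith only [hηβ]
  have hcoef : 1 + 1 / σ ≤ 5 / (η * β * ρ') := by
    have c1 : 1 + 1 / σ ≤ 5 / (η * β * ρ) := by
      have : 1 / σ = 4 / (η * β * ρ) := by rw [hσ]; field_simp
      rw [this, ← sub_nonneg]
      have e4 : 5 / (η * β * ρ) - (1 + 4 / (η * β * ρ)) = 1 / (η * β * ρ) - 1 := by ring
      rw [e4, sub_nonneg, le_div_iff₀ (by positivity)]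
      linarith only [hηβ]
    refine c1.trans ?_
    gcongr
  have hr' : (1 + σ) * r2 ≤ (1 - 3 * σ) * E - 5 / 6 * η * Y ^ 2
      + 25 / 24 * (η * β / ρ * (2 * N)) := by
    have c1 : (1 + σ) * r2 ≤ (1 + σ) * ((1 - η * β * ρ) * E
        - 5 / 6 * η * Y ^ 2 + η * β / ρ * g) := by gcongr
    have c2 : (1 + σ) * (1 - η * β * ρ) ≤ 1 - 3 * σ := by
      have : η * β * ρ = 4 * σ := by rw [hσ]; ring
      rw [this]
      linarith only [sq_nonneg σ]
    have c3 : (1 + σ) * (1 - η * β * ρ) * E ≤ (1 - 3 * σ) * E := by gcongr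
    have c4 : 0 ≤ σ * (5 / 6 * η * Y ^ 2) := by positivity
    have c5 : (1 + σ) * (η * β / ρ * g) ≤ (1 + σ) * (η * β / ρ * (2 * N)) := by gcongr
    have c6 : (1 + σ) * (η * β / ρ * (2 * N)) ≤ 25 / 24 * (η * β / ρ * (2 * N)) := by
      gcongr
      linarith only [hσ1]
    linarith only [c1, c3, c4, c5, c6]
  have hΔ : (1 + 1 / σ) * d2 ≤ 5 / (η * β * ρ') * ((ρ - ρ') / ρ' * C + R) := by
    calc _ ≤ 5 / (η * β * ρ') * d2 := by gcongr
      _ ≤ _ := by gcongr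
  have hL2 : 0 < α * L ^ 2 := by rw [hαρ]; positivity
  have hF0 : 0 < F := by
    rw [hF, mul_assoc 32]
    positivity
  have hmain := mul_le_mul_of_nonneg_left ((htri σ hσ0).trans (add_le_add hr' hΔ)) hF0.le
  have t1 : 24 * (η * α * L ^ 2 * E) ≤ F * (3 * σ * E) := by
    have e5 : F * (3 * σ * E) = 24 * (η * (α * L ^ 2) * E) * (ρ / ρ') := by
      rw [hF, hσ]; field_simp; ring
    have e6 : 24 * (η * α * L ^ 2 * E) = 24 * (η * (α * L ^ 2) * E) := by ring
    rw [e5, e6]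
    exact le_mul_of_one_le_right (by positivity) ((one_le_div hρ').2 hρ)
  have t2' : F * (5 / 6 * η * Y ^ 2) = 80 / 3 * (η * α * L ^ 2 / (β * ρ') * Y ^ 2) := by
    rw [hF]; ring
  -- The exact factor is 200/3, rounded up to 67; the powers of `ρ` disappear because `α L² = A ρ'²`
  -- and `ρ' ≤ ρ`.
  have t3 : F * (25 / 24 * (η * β / ρ * (2 * N))) ≤ 67 * A * η * N := by
    have e6 : F * (25 / 24 * (η * β / ρ * (2 * N))) =
        200 / 3 * (η * (α * L ^ 2) / (ρ' * ρ)) * N := by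
      rw [hF]; field_simp; ring
    rw [e6, hαρ]
    have c1 : η * (A * ρ' ^ 2) / (ρ' * ρ) ≤ A * η := by
      rw [div_le_iff₀ (by positivity)]
      have : A * η * (ρ' * ρ') ≤ A * η * (ρ' * ρ) := by gcongr
      linarith only [this]
    have c2 : 200 / 3 * (η * (A * ρ' ^ 2) / (ρ' * ρ)) * N ≤ 200 / 3 * (A * η) * N := by gcongr
    have : 0 ≤ A * η * N := by positivity
    linarith only [c2, this]
  have t4 : F * (5 / (η * β * ρ') * ((ρ - ρ') / ρ' * C + R)) =
      160 * α * L ^ 2 * (ρ - ρ') / (η * β ^ 2 * ρ' ^ 3) * C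
        + 160 * α * L ^ 2 / (η * β ^ 2 * ρ' ^ 2) * R := by
    rw [hF]; field_simp; ring
  rw [mul_add, t4] at hmain
  linarith only [hmain, t1, t2', t3]

namespace Problem

variable {dx dy p : ℕ} {Ξ : Type*} [MeasurableSpace Ξ]

/-! ### The deterministic part of an iteration -/

section Steps

variable (P : Problem dx dy p Ξ) (q : Params) (k : ℕ) (s : Iterate dx dy p)

/-- The undamped step in `x`. -/
noncomputable def stepX : Vec dx := proj P.X (s.x - q.alpha k • s.v) - s.x

/-- The undamped step in `y`. -/
noncomputable def stepY : Vec dy := proj P.Y (s.y + q.β • s.w) - s.y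

/-- The next `x`. -/
noncomputable def nextX : Vec dx := s.x + Params.eta k • P.stepX q k s

/-- The next `y`. -/
noncomputable def nextY : Vec dy := s.y + Params.eta k • P.stepY q s

/-- The undamped step in `λ`. -/
noncomputable def stepLam : Vec p :=
  proj P.Lam (s.lam + q.gamma k • (P.A (P.nextX q k s) + P.B (P.nextY q k s) - P.c)) - s.lam

/-- The next `λ`. -/
noncomputable def nextLam : Vec p := s.lam + Params.eta k • P.stepLam q k s

/-- A state whose variables lie in the feasible sets. -/
structure Feasible : Prop where
  x_mem : s.x ∈ P.X
  y_mem : s.y ∈ P.Y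
  lam_mem : s.lam ∈ P.Lam

/-- The squared step in `x`, in the units in which it enters the descent estimate. -/
noncomputable def unitX : ℝ := Params.eta k / q.alpha k * ‖P.stepX q k s‖ ^ 2

/-- The squared step in `λ`, in the units in which it enters the descent estimate. -/
noncomputable def unitLam : ℝ := Params.eta k / q.gamma k * ‖P.stepLam q k s‖ ^ 2

/-- The squared step in `y`, in the units in which it enters the descent estimate. -/
noncomputable def unitY : ℝ :=
  Params.eta k * q.alpha k * q.L ^ 2 / (q.β * q.rho (k + 1)) * ‖P.stepY q s‖ ^ 2

/-- The squared distance to the regularised maximiser, in the units in which it enters the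
descent estimate. -/
noncomputable def unitE : ℝ :=
  Params.eta k * q.alpha k * q.L ^ 2 * ‖s.y - P.argMax q k s.x s.lam‖ ^ 2

/-- The coefficient of `‖y_k^*‖²` in the potential. -/
noncomputable def argCoeff : ℝ :=
  160 * q.alpha k * q.L ^ 2 * (q.rho k - q.rho (k + 1)) /
    (Params.eta k * q.β ^ 2 * q.rho (k + 1) ^ 3)

variable {P q k s}

lemma Feasible.next {U : Set (Vec dx)} {V : Set (Vec dy)} {l : ℝ} (hs : P.Feasible s)
    (h : P.Regular U V l) :
    P.nextX q k s ∈ P.X ∧ P.nextY q k s ∈ P.Y ∧ P.nextLam q k s ∈ P.Lam := by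
  have hη : Params.eta k ∈ Set.Icc (0 : ℝ) 1 := ⟨(Params.eta_pos k).le, Params.eta_le_one k⟩
  exact ⟨h.X_conv.add_smul_sub_mem hs.x_mem
      (proj_spec h.X_ne h.X_comp.isClosed h.X_conv _).1 hη,
    h.Y_conv.add_smul_sub_mem hs.y_mem
      (proj_spec h.Y_ne h.Y_comp.isClosed h.Y_conv _).1 hη,
    P.lam_conv.add_smul_sub_mem hs.lam_mem
      (proj_spec P.Lam_ne P.lam_closed P.lam_conv _).1 hη⟩

end Steps

lemma norm_le_sigma {P : Problem dx dy p Ξ} (hY : IsCompact P.Y) {y : Vec dy} (hy : y ∈ P.Y) :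
    ‖y‖ ≤ P.sigma :=
  le_csSup (hY.image continuous_norm).bddAbove ⟨y, hy, rfl⟩

lemma sq_norm_le_sigma {P : Problem dx dy p Ξ} (hY : IsCompact P.Y) {y : Vec dy} (hy : y ∈ P.Y) :
    ‖y‖ ^ 2 ≤ P.sigma ^ 2 := by
  have := norm_le_sigma hY hy
  gcongr

/-- The relations between `L` and the Lipschitz constants of the problem. -/
structure Scaled (P : Problem dx dy p Ξ) (q : Params) (l : ℝ) : Prop where
  L_pos : 0 < q.L
  add_rho_le : ∀ k, 1 ≤ k → l + q.rho k ≤ q.L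
  normA_le : ‖P.A‖ ≤ q.L
  normB_le : ‖P.B‖ ≤ q.L

lemma Scaled.of_eq {P : Problem dx dy p Ξ} {q : Params} {l : ℝ} (hl : 0 < l)
    (hL : q.L = max (l + q.rho 1) (max ‖P.A‖ ‖P.B‖)) : P.Scaled q l := by
  have hA : ‖P.A‖ ≤ q.L := hL ▸ (le_max_left _ _).trans (le_max_right _ _)
  have hB : ‖P.B‖ ≤ q.L := hL ▸ (le_max_right _ _).trans (le_max_right _ _)
  have h1 : l + q.rho 1 ≤ q.L := by
    have := le_max_left (l + q.rho 1) (max ‖P.A‖ ‖P.B‖)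
    rwa [← hL] at this
  have h0 : 0 ≤ q.L := (norm_nonneg _).trans hA
  have hpos : 0 < q.L := by
    have : 0 ≤ q.rho 1 := by unfold Params.rho; positivity
    linarith
  refine ⟨hpos, fun k hk => ?_, hA, hB⟩
  linarith [Params.Admissible.rho_antitone hpos hk]

section Descent

variable {P : Problem dx dy p Ξ} {q : Params} {U : Set (Vec dx)} {V : Set (Vec dy)} {l ε : ℝ}
  {k : ℕ} {s : Iterate dx dy p}

variable (h : P.Regular U V l) (hq : q.Admissible ‖P.A‖ ‖P.B‖) (hsc : P.Scaled q l)

include hsc in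
lemma l_le_L : l ≤ q.L := by
  have := hsc.add_rho_le 1 le_rfl
  have := Params.Admissible.rho_pos hsc.L_pos 1
  linarith

include h hsc

/-- The new maximiser is a competitor in the old problem, so weakening the regularisation raises the
maximum by a telescoping amount. -/
lemma maxVal_succ_le {x : Vec dx} (hx : x ∈ P.X) (lam : Vec p) :
    P.maxVal q (k + 1) x lam ≤
      P.maxVal q k x lam + (q.rho k - q.rho (k + 1)) / 2 * P.sigma ^ 2 := by
  have hm := h.argMax_mem q (k + 1) hx lam
  have h1 : P.lagReg q k x (P.argMax q (k + 1) x lam) lam ≤ P.lagReg q k x (P.argMax q k x lam) lam :=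
    (h.argMax_spec q k hx lam).2 hm
  have h2 := sq_norm_le_sigma h.Y_comp hm
  have h3 := Params.Admissible.rho_succ_le hsc.L_pos k
  rw [h.maxVal_eq q _ hx, h.maxVal_eq q _ hx]
  unfold lagReg at h1 ⊢
  nlinarith

include hq

/-- The variational inequalities of the two projections gain one unit in `x` and one in `λ`. In `x`,
1/4 goes to the inexact gradient and 7/32 to curvature and coupling, leaving 17/32. In `λ`, 5/16 +
1/8 is lost, leaving 9/16. -/
lemma descent_maxVal (hs : P.Feasible s) :
    P.maxVal q (k + 1) (P.nextX q k s) (P.nextLam q k s) ≤ P.maxVal q k s.x s.lam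
      - 17 / 32 * P.unitX q k s - 9 / 16 * P.unitLam q k s + 16 * P.unitE q k s + P.unitY q k s
      + 2 * (Params.eta k * q.alpha k) * (‖P.meanEstX q ε k s.x s.y s.lam - s.v‖ ^ 2
        + ‖P.meanEstX q ε k s.x s.y s.lam - P.lagGradX s.x s.y s.lam‖ ^ 2)
      + (q.rho k - q.rho (k + 1)) / 2 * P.sigma ^ 2 := by
  obtain ⟨hx', hy', hl'⟩ := hs.next (q := q) (k := k) h
  have hL := hsc.L_pos
  have hlL := l_le_L hsc
  have hl0 := h.l_pos
  have hB := hsc.normB_le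
  have hη := Params.eta_pos k
  have hη1 := Params.eta_le_one k
  have hα := hq.alpha_pos k
  have hγ := hq.gamma_pos k
  have hβ := hq.β_pos
  have hρ := Params.Admissible.rho_pos hL k
  have hρ' := Params.Admissible.rho_pos hL (k + 1)
  have hLη := Params.Admissible.L_mul_eta_le hL k
  have hαL := hq.alpha_mul_L_le hL k
  have hγL := hq.gamma_mul_L_le hL k
  have hγB := hq.gamma_mul_sq_le k
  have hβL := hq.β_mul_L_le hL
  have hβρ : q.β * q.rho (k + 1) ≤ 1 / 6 :=
    (mul_le_mul_of_nonneg_left (Params.Admissible.rho_le hL (k + 1)) hβ.le).trans hβL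
  -- With `z` the new `y`, the linear term in `λ` contains precisely the residual used in the
  -- `λ`-step, so the variational inequality of that projection applies without error.
  have hst := h.maxVal_step_le q k hρ (z := P.nextY q k s) hs.x_mem hx' hs.y_mem s.lam
    (P.nextLam q k s)
  have hsucc := maxVal_succ_le (k := k) h hsc hx' (P.nextLam q k s)
  have ex : P.nextX q k s - s.x = Params.eta k • P.stepX q k s := by simp [nextX]
  have ey : P.nextY q k s - s.y = Params.eta k • P.stepY q s := by simp [nextY]
  have el : P.nextLam q k s - s.lam = Params.eta k • P.stepLam q k s := by simp [nextLam]
  have hvx : inner ℝ s.v (P.stepX q k s) ≤ -(‖P.stepX q k s‖ ^ 2 / q.alpha k) :=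
    proj_step_inner_le h.X_ne h.X_comp.isClosed h.X_conv hs.x_mem hα
  have hvl : inner ℝ (-(P.A (P.nextX q k s) + P.B (P.nextY q k s) - P.c)) (P.stepLam q k s) ≤
      -(‖P.stepLam q k s‖ ^ 2 / q.gamma k) := by
    have := proj_step_inner_le P.Lam_ne P.lam_closed P.lam_conv
      (v := -(P.A (P.nextX q k s) + P.B (P.nextY q k s) - P.c)) hs.lam_mem hγ
    rwa [smul_neg, sub_neg_eq_add] at this
  rw [inner_neg_left, real_inner_comm] at hvl
  set u := P.A (P.nextX q k s) + P.B (P.nextY q k s) - P.c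
  rw [ex, ey, el, norm_smul, norm_smul, norm_smul, Real.norm_of_nonneg hη.le,
    real_inner_smul_right, real_inner_smul_left] at hst
  set G := P.lagGradX s.x s.y s.lam
  set M := P.meanEstX q ε k s.x s.y s.lam
  have hGv := inner_le_of_inexact M G s.v (P.stepX q k s) hα
  have hGv' := mul_le_mul_of_nonneg_left (hGv.trans (add_le_add_left hvx _)) hη.le
  have hvl' := mul_le_mul_of_nonneg_left hvl hη.le
  set e := ‖s.y - P.argMax q k s.x s.lam‖ with he
  have eE : P.unitE q k s = Params.eta k * q.alpha k * q.L ^ 2 * e ^ 2 := rfl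
  have eX : P.unitX q k s = Params.eta k / q.alpha k * ‖P.stepX q k s‖ ^ 2 := rfl
  have eL : P.unitLam q k s = Params.eta k / q.gamma k * ‖P.stepLam q k s‖ ^ 2 := rfl
  have eY : P.unitY q k s = Params.eta k * q.alpha k * q.L ^ 2 / (q.β * q.rho (k + 1)) *
    ‖P.stepY q s‖ ^ 2 := rfl
  rw [eE, eX, eL, eY]
  have hX0 := norm_nonneg (P.stepX q k s)
  have hY0 := norm_nonneg (P.stepY q s)
  have hΛ0 := norm_nonneg (P.stepLam q k s)
  have hB0 := norm_nonneg P.B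
  set X := ‖P.stepX q k s‖
  set Y := ‖P.stepY q s‖
  set Λ := ‖P.stepLam q k s‖
  set η := Params.eta k
  set α := q.alpha k
  set γ := q.gamma k
  set ρ := q.rho k
  set ρ' := q.rho (k + 1)
  set nB := ‖P.B‖
  have b1 := scalar_step_x_le hη hη1 hα hρ hL hl0 hlL hLη hαL hX0 (norm_nonneg _ : 0 ≤ e)
  have b2 := scalar_step_lam_le (e := e) (Λ := Λ) hη hα hγ hρ hL hB0 hB hLη hγL hγB
  have b3 := scalar_step_y_le (Λ := Λ) (Y := Y) hη hη1 hα hγ hβ hρ' hβρ hγB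
  have e6 : η * (-(X ^ 2 / α) + (X ^ 2 / (4 * α) + 2 * α * (‖M - s.v‖ ^ 2 + ‖M - G‖ ^ 2))) =
      -(3 / 4 * (η / α * X ^ 2)) + 2 * (η * α) * (‖M - s.v‖ ^ 2 + ‖M - G‖ ^ 2) := by
    field_simp
    ring
  have e7 : η * -(Λ ^ 2 / γ) = -(η / γ * Λ ^ 2) := by ring
  rw [e6] at hGv'
  rw [e7] at hvl'
  linarith only [hst, hsucc, hGv', hvl', b1, b2, b3]

/-- The contraction `ascent_step_le` towards the old maximiser is combined with its displacement
`argMax_step_le`. The displacement is charged to the steps in `x` and `λ` and to the change of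
`‖y*‖²`. Here `k ≥ 1` is needed for `l + ρ_k ≤ L`. -/
lemma descent_argMax (hk : 1 ≤ k) (hs : P.Feasible s) :
    32 * q.alpha k * q.L ^ 2 / (q.β * q.rho (k + 1)) *
        ‖P.nextY q k s - P.argMax q (k + 1) (P.nextX q k s) (P.nextLam q k s)‖ ^ 2 ≤
      32 * q.alpha k * q.L ^ 2 / (q.β * q.rho (k + 1)) *
          ‖s.y - P.argMax q k s.x s.lam‖ ^ 2
        - 24 * P.unitE q k s - 80 / 3 * P.unitY q k s
        + 67 * q.A₂ * Params.eta k * (‖P.meanEstY q ε k s.x s.y s.lam - s.w‖ ^ 2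
          + ‖P.meanEstY q ε k s.x s.y s.lam - P.regGradY q k s.x s.y s.lam‖ ^ 2)
        + argCoeff q k * (‖P.argMax q (k + 1) (P.nextX q k s) (P.nextLam q k s)‖ ^ 2
          - ‖P.argMax q k s.x s.lam‖ ^ 2)
        + 1 / 8 * P.unitX q k s + 1 / 4 * P.unitLam q k s := by
  obtain ⟨hx', hy', hl'⟩ := hs.next (q := q) (k := k) h
  have hL := hsc.L_pos
  have hlL := l_le_L hsc
  have hl0 := h.l_pos
  have hB := hsc.normB_le
  have hη := Params.eta_pos k
  have hη1 := Params.eta_le_one k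
  have hα := hq.alpha_pos k
  have hγ := hq.gamma_pos k
  have hβ := hq.β_pos
  have hρ := Params.Admissible.rho_pos hL k
  have hρ' := Params.Admissible.rho_pos hL (k + 1)
  have hρρ := Params.Admissible.rho_succ_le hL k
  have hβL := hq.β_mul_L_le hL
  have hρL := Params.Admissible.rho_le hL k
  have hA₂ := hq.A₂_pos
  have hβl : q.β * (l + q.rho k) ≤ 1 / 6 := by
    have := mul_le_mul_of_nonneg_left (hsc.add_rho_le k hk) hβ.le
    linarith
  have h1 := h.ascent_step_le q k hβ hη.le hη1 hρ hβl hs.x_mem hs.y_mem s.lam s.w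
  have h2 := h.argMax_step_le q hρ' hρρ hs.x_mem hx' s.lam (P.nextLam q k s)
  have e1 : s.y + Params.eta k • (proj P.Y (s.y + q.β • s.w) - s.y) = P.nextY q k s := rfl
  have e2 : proj P.Y (s.y + q.β • s.w) - s.y = P.stepY q s := rfl
  rw [e1, e2] at h1
  have ex : P.nextX q k s - s.x = Params.eta k • P.stepX q k s := by simp [nextX]
  have el : P.nextLam q k s - s.lam = Params.eta k • P.stepLam q k s := by simp [nextLam]
  rw [ex, el, norm_smul, norm_smul, Real.norm_of_nonneg hη.le] at h2
  have htri := norm_sub_le_norm_sub_add_norm_sub (P.nextY q k s) (P.argMax q k s.x s.lam)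
    (P.argMax q (k + 1) (P.nextX q k s) (P.nextLam q k s))
  rw [norm_sub_rev (P.argMax q k s.x s.lam)] at htri
  have eE : P.unitE q k s = Params.eta k * q.alpha k * q.L ^ 2 *
    ‖s.y - P.argMax q k s.x s.lam‖ ^ 2 := rfl
  have eX : P.unitX q k s = Params.eta k / q.alpha k * ‖P.stepX q k s‖ ^ 2 := rfl
  have eL : P.unitLam q k s = Params.eta k / q.gamma k * ‖P.stepLam q k s‖ ^ 2 := rfl
  have eY : P.unitY q k s = Params.eta k * q.alpha k * q.L ^ 2 / (q.β * q.rho (k + 1)) *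
    ‖P.stepY q s‖ ^ 2 := rfl
  have eC : argCoeff q k = 160 * q.alpha k * q.L ^ 2 * (q.rho k - q.rho (k + 1)) /
    (Params.eta k * q.β ^ 2 * q.rho (k + 1) ^ 3) := rfl
  have hsq := hq.alpha_sq_mul_le hL k
  have hsq' := hq.alpha_mul_gamma_le hL k
  have hαρ := Params.Admissible.alpha_mul_sq_eq (q := q) k
  rw [eE, eX, eL, eY, eC]
  set M := P.meanEstY q ε k s.x s.y s.lam
  set G := P.regGradY q k s.x s.y s.lam
  set a := P.argMax q k s.x s.lam
  set a' := P.argMax q (k + 1) (P.nextX q k s) (P.nextLam q k s)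
  have hn := sq_norm_sub_le_two_mul M G s.w
  set N := ‖M - s.w‖ ^ 2 + ‖M - G‖ ^ 2
  set X := ‖P.stepX q k s‖
  set Y := ‖P.stepY q s‖
  set Λ := ‖P.stepLam q k s‖
  set η := Params.eta k
  set α := q.alpha k
  set γ := q.gamma k
  set ρ := q.rho k
  set ρ' := q.rho (k + 1)
  set nB := ‖P.B‖
  set E := ‖s.y - a‖ ^ 2
  set Δ := ‖a' - a‖
  set r := ‖P.nextY q k s - a‖
  set β := q.β
  have hβρ : β * ρ ≤ 1 / 6 := (mul_le_mul_of_nonneg_left hρL hβ.le).trans hβL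
  have hyoung : ∀ c : ℝ, 0 < c →
      ‖P.nextY q k s - a'‖ ^ 2 ≤ (1 + c) * r ^ 2 + (1 + 1 / c) * Δ ^ 2 := by
    intro c hc
    have c1 : ‖P.nextY q k s - a'‖ ^ 2 ≤ (r + Δ) ^ 2 := by gcongr
    have c2 : 0 ≤ (c * r - Δ) ^ 2 / c := by positivity
    have e3 : (c * r - Δ) ^ 2 / c = c * r ^ 2 - 2 * r * Δ + 1 / c * Δ ^ 2 := by
      field_simp
      ring
    linarith only [c1, c2, e3]
  have hmain := scalar_tracking_le hη hη1 hα hβ hρ' hρρ hβρ hA₂ (by positivity : 0 ≤ N)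
    (by positivity : 0 ≤ E) hαρ rfl hn (sq_nonneg Δ) hyoung h1 h2
  have t4 : 160 * α * q.L ^ 2 / (η * β ^ 2 * ρ' ^ 2) *
      (2 * (l ^ 2 * (η * X) ^ 2 + nB ^ 2 * (η * Λ) ^ 2) / ρ' ^ 2) =
        320 * (α * q.L ^ 2) * η / (β ^ 2 * ρ' ^ 4) * (l ^ 2 * X ^ 2)
        + 320 * (α * q.L ^ 2) * η / (β ^ 2 * ρ' ^ 4) * (nB ^ 2 * Λ ^ 2) := by
    field_simp
    ring
  -- The factor 1/8 amounts to `2560 (α L²)² ≤ β² ρ'⁴`, which reduces to the bound of `A₂` by `β /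
  -- (16 √10)`; the analogous 1/4 for `λ` comes from the bound on `A₂ A₃`.
  have t5 : 320 * (α * q.L ^ 2) * η / (β ^ 2 * ρ' ^ 4) * (l ^ 2 * X ^ 2) ≤
      1 / 8 * (η / α * X ^ 2) := by
    calc _ ≤ 320 * (α * q.L ^ 2) * η / (β ^ 2 * ρ' ^ 4) * (q.L ^ 2 * X ^ 2) := by gcongr
      _ = (η * X ^ 2 / (8 * α)) * ((2560 * (α * q.L ^ 2) ^ 2) / (β ^ 2 * ρ' ^ 4)) := by
        field_simp; ring
      _ ≤ (η * X ^ 2 / (8 * α)) * 1 := by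
        gcongr
        exact div_le_one_of_le₀ hsq (by positivity)
      _ = _ := by field_simp
  have t6 : 320 * (α * q.L ^ 2) * η / (β ^ 2 * ρ' ^ 4) * (nB ^ 2 * Λ ^ 2) ≤
      1 / 4 * (η / γ * Λ ^ 2) := by
    calc _ ≤ 320 * (α * q.L ^ 2) * η / (β ^ 2 * ρ' ^ 4) * (q.L ^ 2 * Λ ^ 2) := by gcongr
      _ = (η * Λ ^ 2 / (4 * γ)) * ((1280 * (α * q.L ^ 2) * (γ * q.L ^ 2)) / (β ^ 2 * ρ' ^ 4)) := by
        field_simp; ring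
      _ ≤ (η * Λ ^ 2 / (4 * γ)) * 1 := by
        gcongr
        exact div_le_one_of_le₀ hsq' (by positivity)
      _ = _ := by field_simp
  rw [t4] at hmain
  linarith only [hmain, t5, t6]

end Descent

end Problem

end ZORMPDPG

/-! ### The stationarity gap in terms of steps and gradient errors. -/

namespace ZORMPDPG

lemma add_sq_le_three_mul (a b c : ℝ) : (a + b + c) ^ 2 ≤ 3 * (a ^ 2 + b ^ 2 + c ^ 2) := by
  nlinarith [sq_nonneg (a - b), sq_nonneg (b - c), sq_nonneg (a - c)]

/-- A gradient mapping compared with an undamped step along an inexact gradient. -/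
lemma norm_gradientMapping_le {n : ℕ} {Z : Set (Vec n)} (hne : Z.Nonempty) (hcl : IsClosed Z)
    (hconv : Convex ℝ Z) {a : ℝ} (ha : 0 < a) (x g v : Vec n) :
    ‖(1 / a) • (x - proj Z (x - a • g))‖ ≤ ‖proj Z (x - a • v) - x‖ / a + ‖g - v‖ := by
  have h1 := proj_nonexpansive hne hcl hconv (x - a • v) (x - a • g)
  have e : x - a • v - (x - a • g) = a • (g - v) := by module
  rw [e, norm_smul, Real.norm_of_nonneg ha.le] at h1
  have h2 := norm_sub_le_norm_sub_add_norm_sub x (proj Z (x - a • v)) (proj Z (x - a • g))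
  rw [norm_sub_rev x (proj Z (x - a • v))] at h2
  rw [norm_smul, Real.norm_of_nonneg (by positivity), div_add' _ _ _ ha.ne', one_div,
    inv_mul_eq_div]
  gcongr
  linarith

namespace Problem

variable {dx dy p : ℕ} {Ξ : Type*} [MeasurableSpace Ξ]

section Gap

variable {P : Problem dx dy p Ξ} {q : Params} {U : Set (Vec dx)} {V : Set (Vec dy)} {l ε : ℝ}
  {k : ℕ} {s : Iterate dx dy p}

lemma gradient_lag_x (h : P.Regular U V l) (hs : P.Feasible s) :
    gradient (fun x' => P.lag x' s.y s.lam) s.x = P.lagGradX s.x s.y s.lam := by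
  have h1 := h.mean.hasGrad_x s.x (h.X_sub hs.x_mem) s.y (h.Y_sub hs.y_mem)
  refine HasGradientAt.gradient ?_
  rw [hasGradientAt_iff_hasFDerivAt] at h1 ⊢
  have h2 : HasFDerivAt (fun x' : Vec dx => inner ℝ s.lam (P.A x' + P.B s.y - P.c))
      ((innerSL ℝ s.lam).comp P.A) s.x :=
    (innerSL ℝ s.lam).hasFDerivAt.comp s.x
      ((P.A.hasFDerivAt.add_const (P.B s.y)).sub_const P.c)
  refine (h1.sub h2).congr_fderiv ?_
  ext z
  simp [lagGradX, ContinuousLinearMap.adjoint_inner_left]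

lemma gradient_lag_y (h : P.Regular U V l) (hs : P.Feasible s) :
    gradient (fun y' => P.lag s.x y' s.lam) s.y =
      P.regGradY q k s.x s.y s.lam + q.rho k • s.y := by
  have h1 := h.mean.hasGrad_y s.x (h.X_sub hs.x_mem) s.y (h.Y_sub hs.y_mem)
  refine HasGradientAt.gradient ?_
  rw [hasGradientAt_iff_hasFDerivAt] at h1 ⊢
  have h2 : HasFDerivAt (fun y' : Vec dy => inner ℝ s.lam (P.A s.x + P.B y' - P.c))
      ((innerSL ℝ s.lam).comp P.B) s.y :=
    (innerSL ℝ s.lam).hasFDerivAt.comp s.y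
      ((P.B.hasFDerivAt.const_add (P.A s.x)).sub_const P.c)
  refine (h1.sub h2).congr_fderiv ?_
  ext z
  simp [regGradY, ContinuousLinearMap.adjoint_inner_left]

lemma gradient_lag_lam (x : Vec dx) (y : Vec dy) (lam : Vec p) :
    gradient (fun l => P.lag x y l) lam = -(P.A x + P.B y - P.c) := by
  refine HasGradientAt.gradient ?_
  rw [hasGradientAt_iff_hasFDerivAt]
  have h2 : HasFDerivAt (fun l : Vec p => P.g x y - inner ℝ (P.A x + P.B y - P.c) l)
      (-(innerSL ℝ (P.A x + P.B y - P.c))) lam :=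
    (innerSL ℝ (P.A x + P.B y - P.c)).hasFDerivAt.const_sub (P.g x y)
  have e : (fun l => P.lag x y l) = fun l => P.g x y - inner ℝ (P.A x + P.B y - P.c) l := by
    funext l
    rw [lag, real_inner_comm]
  rw [e]
  refine h2.congr_fderiv ?_
  ext z
  simp

variable (h : P.Regular U V l) (hq : q.Admissible ‖P.A‖ ‖P.B‖) (hsc : P.Scaled q l)

include h hq

/-- Each block is a gradient mapping compared with the step actually taken. The `y`-block also pays
the regularisation bias `ρ σ`. The `λ`-block pays the displacements of `x` and `y`, since the
algorithm uses the residual at the new point. -/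
lemma gap_sq_le (hρ : 0 ≤ q.rho k) (hs : P.Feasible s) :
    ‖P.gap (q.alpha k) q.β (q.gamma k) s.x s.y s.lam‖ ^ 2 ≤
      3 * ((‖P.stepX q k s‖ / q.alpha k) ^ 2 + ‖P.meanEstX q ε k s.x s.y s.lam - s.v‖ ^ 2
        + ‖P.meanEstX q ε k s.x s.y s.lam - P.lagGradX s.x s.y s.lam‖ ^ 2)
      + (2 * (q.rho k ^ 2 * P.sigma ^ 2) + 6 * ((‖P.stepY q s‖ / q.β) ^ 2
        + ‖P.meanEstY q ε k s.x s.y s.lam - s.w‖ ^ 2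
        + ‖P.meanEstY q ε k s.x s.y s.lam - P.regGradY q k s.x s.y s.lam‖ ^ 2))
      + 3 * ((‖P.stepLam q k s‖ / q.gamma k) ^ 2
        + (‖P.A‖ * (Params.eta k * ‖P.stepX q k s‖)) ^ 2
        + (‖P.B‖ * (Params.eta k * ‖P.stepY q s‖)) ^ 2) := by
  have hα := hq.alpha_pos k
  have hβ := hq.β_pos
  have hγ := hq.gamma_pos k
  have hη := Params.eta_pos k
  have e : ‖P.gap (q.alpha k) q.β (q.gamma k) s.x s.y s.lam‖ ^ 2 =
      ‖(1 / q.alpha k) • (s.x - proj P.X (s.x - q.alpha k • P.lagGradX s.x s.y s.lam))‖ ^ 2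
      + (‖(1 / q.β) • (s.y - proj P.Y (s.y + q.β •
          (P.regGradY q k s.x s.y s.lam + q.rho k • s.y)))‖ ^ 2
      + ‖(1 / q.gamma k) • (s.lam - proj P.Lam (s.lam - q.gamma k •
          -(P.A s.x + P.B s.y - P.c)))‖ ^ 2) := by
    rw [gap, WithLp.prod_norm_sq_eq_of_L2, WithLp.prod_norm_sq_eq_of_L2, gradient_lag_x h hs,
      gradient_lag_y (q := q) (k := k) h hs, gradient_lag_lam]
    rfl
  rw [e]
  have hx := norm_gradientMapping_le h.X_ne h.X_comp.isClosed h.X_conv hα s.x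
    (P.lagGradX s.x s.y s.lam) s.v
  have hx2 : ‖P.lagGradX s.x s.y s.lam - s.v‖ ≤ ‖P.meanEstX q ε k s.x s.y s.lam - s.v‖
      + ‖P.meanEstX q ε k s.x s.y s.lam - P.lagGradX s.x s.y s.lam‖ := by
    have := norm_sub_le_norm_sub_add_norm_sub (P.lagGradX s.x s.y s.lam)
      (P.meanEstX q ε k s.x s.y s.lam) s.v
    rw [norm_sub_rev (P.lagGradX s.x s.y s.lam) (P.meanEstX q ε k s.x s.y s.lam)] at this
    linarith
  -- Ascent is treated as descent along the negated vectors.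
  have hy := norm_gradientMapping_le h.Y_ne h.Y_comp.isClosed h.Y_conv hβ s.y
    (-(P.regGradY q k s.x s.y s.lam + q.rho k • s.y)) (-s.w)
  have hy2 : ‖-(P.regGradY q k s.x s.y s.lam + q.rho k • s.y) - -s.w‖ ≤
      q.rho k * P.sigma + (‖P.meanEstY q ε k s.x s.y s.lam - s.w‖
      + ‖P.meanEstY q ε k s.x s.y s.lam - P.regGradY q k s.x s.y s.lam‖) := by
    have e1 : -(P.regGradY q k s.x s.y s.lam + q.rho k • s.y) - -s.w =
        -(q.rho k • s.y + (P.regGradY q k s.x s.y s.lam - s.w)) := by abel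
    rw [e1, norm_neg]
    refine (norm_add_le _ _).trans (add_le_add ?_ ?_)
    · rw [norm_smul, Real.norm_of_nonneg hρ]
      exact mul_le_mul_of_nonneg_left (norm_le_sigma h.Y_comp hs.y_mem) hρ
    · have := norm_sub_le_norm_sub_add_norm_sub (P.regGradY q k s.x s.y s.lam)
        (P.meanEstY q ε k s.x s.y s.lam) s.w
      rw [norm_sub_rev (P.regGradY q k s.x s.y s.lam) (P.meanEstY q ε k s.x s.y s.lam)] at this
      linarith
  have hl := norm_gradientMapping_le P.Lam_ne P.lam_closed P.lam_conv hγ s.lam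
    (-(P.A s.x + P.B s.y - P.c)) (-(P.A (P.nextX q k s) + P.B (P.nextY q k s) - P.c))
  have hl2 : ‖-(P.A s.x + P.B s.y - P.c) - -(P.A (P.nextX q k s) + P.B (P.nextY q k s) - P.c)‖ ≤
      ‖P.A‖ * (Params.eta k * ‖P.stepX q k s‖) + ‖P.B‖ * (Params.eta k * ‖P.stepY q s‖) := by
    have e1 : -(P.A s.x + P.B s.y - P.c) - -(P.A (P.nextX q k s) + P.B (P.nextY q k s) - P.c) =
        P.A (Params.eta k • P.stepX q k s) + P.B (Params.eta k • P.stepY q s) := by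
      simp only [nextX, nextY, map_add]
      abel
    rw [e1]
    refine (norm_add_le _ _).trans (add_le_add ?_ ?_)
    · refine (P.A.le_opNorm _).trans (le_of_eq ?_)
      rw [norm_smul, Real.norm_of_nonneg hη.le]
    · refine (P.B.le_opNorm _).trans (le_of_eq ?_)
      rw [norm_smul, Real.norm_of_nonneg hη.le]
  rw [smul_neg, sub_neg_eq_add, smul_neg, sub_neg_eq_add] at hy
  rw [smul_neg, sub_neg_eq_add, smul_neg, sub_neg_eq_add] at hl
  rw [smul_neg, sub_neg_eq_add]
  have ex : proj P.X (s.x - q.alpha k • s.v) - s.x = P.stepX q k s := rfl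
  have ey : proj P.Y (s.y + q.β • s.w) - s.y = P.stepY q s := rfl
  have el : proj P.Lam (s.lam + q.gamma k • (P.A (P.nextX q k s) + P.B (P.nextY q k s) - P.c))
    - s.lam = P.stepLam q k s := rfl
  rw [ex] at hx
  rw [ey] at hy
  rw [el] at hl
  rw [← add_assoc]
  refine add_le_add (add_le_add ?_ ?_) ?_
  · refine le_trans ?_ (add_sq_le_three_mul _ _ _)
    gcongr
    linarith
  · have c1 := (pow_le_pow_left₀ (norm_nonneg _) (hy.trans (add_le_add_right hy2 _)) 2)
    have c2 := add_sq_le_three_mul (‖P.stepY q s‖ / q.β)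
      ‖P.meanEstY q ε k s.x s.y s.lam - s.w‖
      ‖P.meanEstY q ε k s.x s.y s.lam - P.regGradY q k s.x s.y s.lam‖
    refine c1.trans ?_
    set a := ‖P.stepY q s‖ / q.β
    set b := ‖P.meanEstY q ε k s.x s.y s.lam - s.w‖
    set c := ‖P.meanEstY q ε k s.x s.y s.lam - P.regGradY q k s.x s.y s.lam‖
    set d := q.rho k * P.sigma with hd
    have e2 : q.rho k ^ 2 * P.sigma ^ 2 = d ^ 2 := by rw [hd]; ring
    rw [e2]
    linarith only [c2, sq_nonneg (d - (a + b + c))]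
  · refine le_trans ?_ (add_sq_le_three_mul _ _ _)
    gcongr
    linarith

include hsc

/-- The upper bounds on `D₁` are made for this: after multiplication by `D₁ η α` the gap fits into
what the descent leaves over, apart from gradient errors and the regularisation bias. -/
lemma scaled_gap_le (hs : P.Feasible s) :
    q.D₁ * (Params.eta k * q.alpha k) *
        ‖P.gap (q.alpha k) q.β (q.gamma k) s.x s.y s.lam‖ ^ 2 ≤
      1 / 8 * P.unitX q k s + 2 * P.unitY q k s + 1 / 8 * P.unitLam q k s
      + q.D₁ * (Params.eta k * q.alpha k) * (3 * (‖P.meanEstX q ε k s.x s.y s.lam - s.v‖ ^ 2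
        + ‖P.meanEstX q ε k s.x s.y s.lam - P.lagGradX s.x s.y s.lam‖ ^ 2)
      + 6 * (‖P.meanEstY q ε k s.x s.y s.lam - s.w‖ ^ 2
        + ‖P.meanEstY q ε k s.x s.y s.lam - P.regGradY q k s.x s.y s.lam‖ ^ 2)
      + 2 * (q.rho k ^ 2 * P.sigma ^ 2)) := by
  have hL := hsc.L_pos
  have hρ := Params.Admissible.rho_pos hL k
  have hρ' := Params.Admissible.rho_pos hL (k + 1)
  have hρL := Params.Admissible.rho_le hL (k + 1)
  have hα := hq.alpha_pos k
  have hγ := hq.gamma_pos k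
  have hη := Params.eta_pos k
  have hη1 := Params.eta_le_one k
  have hβ := hq.β_pos
  have hD := hq.D₁_pos
  have h1 := gap_sq_le (ε := ε) h hq hρ.le hs
  have hX := hq.gapX_coeff_le (norm_nonneg _) k
  have hY := hq.gapY_coeff_le
  have hΛ := hq.gapLam_coeff_le k
  have eX : P.unitX q k s = Params.eta k / q.alpha k * ‖P.stepX q k s‖ ^ 2 := rfl
  have eL : P.unitLam q k s = Params.eta k / q.gamma k * ‖P.stepLam q k s‖ ^ 2 := rfl
  have eY : P.unitY q k s = Params.eta k * q.alpha k * q.L ^ 2 / (q.β * q.rho (k + 1)) *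
    ‖P.stepY q s‖ ^ 2 := rfl
  rw [eX, eL, eY]
  have hnA := norm_nonneg P.A
  have hnB := norm_nonneg P.B
  set X := ‖P.stepX q k s‖
  set Y := ‖P.stepY q s‖
  set Λ := ‖P.stepLam q k s‖
  set η := Params.eta k
  set α := q.alpha k
  set γ := q.gamma k
  set β := q.β
  set ρ := q.rho k
  set ρ' := q.rho (k + 1)
  set nA := ‖P.A‖
  set nB := ‖P.B‖
  set D := q.D₁
  have hη2 : η ^ 2 ≤ 1 := pow_le_one₀ hη.le hη1
  have c1 : D * (η * α) * (3 * (X / α) ^ 2 + 3 * (nA * (η * X)) ^ 2) ≤ 1 / 8 * (η / α * X ^ 2) := by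
    calc D * (η * α) * (3 * (X / α) ^ 2 + 3 * (nA * (η * X)) ^ 2)
        = (η / α * X ^ 2) * (D * (3 + 3 * (α * nA) ^ 2 * η ^ 2)) := by field_simp
      _ ≤ (η / α * X ^ 2) * (D * (3 + 3 * (α * nA) ^ 2 * 1)) := by gcongr
      _ ≤ (η / α * X ^ 2) * (1 / 8) := by rw [mul_one]; gcongr
      _ = _ := by ring
  have c2 : D * (η * α) * (6 * (Y / β) ^ 2 + 3 * (nB * (η * Y)) ^ 2) ≤
      2 * (η * α * q.L ^ 2 / (β * ρ') * Y ^ 2) := by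
    calc D * (η * α) * (6 * (Y / β) ^ 2 + 3 * (nB * (η * Y)) ^ 2)
        = (η * α * Y ^ 2 / β ^ 2) * (D * (6 + 3 * nB ^ 2 * β ^ 2 * η ^ 2)) := by field_simp
      _ ≤ (η * α * Y ^ 2 / β ^ 2) * (D * (6 + 3 * nB ^ 2 * β ^ 2 * 1)) := by gcongr
      _ ≤ (η * α * Y ^ 2 / β ^ 2) * (2 * q.L * β) := by rw [mul_one]; gcongr
      _ = 2 * (η * α * Y ^ 2 / β) * q.L := by field_simp
      _ ≤ 2 * (η * α * Y ^ 2 / β) * (q.L ^ 2 / ρ') := by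
        gcongr
        rw [le_div_iff₀ hρ', sq]
        gcongr
      _ = _ := by field_simp
  have c3 : D * (η * α) * (3 * (Λ / γ) ^ 2) ≤ 1 / 8 * (η / γ * Λ ^ 2) := by
    calc D * (η * α) * (3 * (Λ / γ) ^ 2) = (η * Λ ^ 2 / γ ^ 2) * (D * (3 * α)) := by field_simp
      _ ≤ (η * Λ ^ 2 / γ ^ 2) * (γ / 8) := by gcongr
      _ = _ := by field_simp
  have h2 := mul_le_mul_of_nonneg_left h1 (by positivity : 0 ≤ D * (η * α))
  linarith only [h2, c1, c2, c3]

end Gap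

end Problem

end ZORMPDPG

/-! ### Finite-difference bias on the feasible sets. -/

namespace ZORMPDPG

namespace Problem

variable {dx dy p : ℕ} {Ξ : Type*} [MeasurableSpace Ξ]

section Stencil

variable {P : Problem dx dy p Ξ} {q : Params} {U : Set (Vec dx)} {V : Set (Vec dy)} {l ε : ℝ}
  {k : ℕ}

variable (hq : q.Admissible ‖P.A‖ ‖P.B‖) (hsc : P.Scaled q l) (hε : 0 < ε)
  (hst : P.StencilIn q ε U V)

lemma StencilIn.x_mem (hst : P.StencilIn q ε U V) (hL : 0 < q.L) (hε : 0 < ε) (hk : 1 ≤ k)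
    {x : Vec dx} (hx : x ∈ P.X) (i : Fin dx) {t : ℝ} (ht : t ∈ Set.Icc 0 (q.thetaX dx ε k)) :
    x + t • dir i ∈ U :=
  hst.1 x hx i t ⟨ht.1, ht.2.trans (Params.Admissible.thetaX_antitone hL dx hε hk)⟩

lemma StencilIn.y_mem (hst : P.StencilIn q ε U V) (hL : 0 < q.L) (hε : 0 < ε) (hk : 1 ≤ k)
    {y : Vec dy} (hy : y ∈ P.Y) (i : Fin dy) {t : ℝ} (ht : t ∈ Set.Icc 0 (q.thetaY dy ε k)) :
    y + t • dir i ∈ V :=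
  hst.2 y hy i t ⟨ht.1, ht.2.trans (Params.Admissible.thetaY_antitone hL dy hε hk)⟩

include hq hsc hε hst

/-- Stated for an arbitrary smooth `f`, since it is applied both to the mean objective and to
individual samples. -/
lemma norm_fdX_sub_sq_le (hl : 0 < l) (hk : 1 ≤ k) {f : Vec dx → Vec dy → ℝ}
    {gr : Vec dx → Vec dx} {x : Vec dx} {y : Vec dy} (hx : x ∈ P.X)
    (hf : ∀ z ∈ U, HasGradientAt (fun x => f x y) (gr z) z)
    (hlip : ∀ z ∈ U, ∀ z' ∈ U, ‖gr z - gr z'‖ ≤ l * ‖z - z'‖) :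
    ‖fdX f (q.thetaX dx ε k) x y - gr x‖ ^ 2 ≤ dx * q.L ^ 2 * q.thetaX dx ε k ^ 2 / 4 := by
  have hlL := l_le_L hsc
  have := norm_fd_sub_gradient_sq_le hf hlip x
    (Params.Admissible.thetaX_nonneg hsc.L_pos dx hε k)
    (fun hd => hq.thetaX_pos hsc.L_pos hd hε k)
    (fun i t ht => hst.x_mem hsc.L_pos hε hk hx i ht)
  refine (this : ‖fdX f (q.thetaX dx ε k) x y - gr x‖ ^ 2 ≤ _).trans ?_
  gcongr

lemma norm_fdY_sub_sq_le (hl : 0 < l) (hk : 1 ≤ k) {f : Vec dx → Vec dy → ℝ}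
    {gr : Vec dy → Vec dy} {x : Vec dx} {y : Vec dy} (hy : y ∈ P.Y)
    (hf : ∀ z ∈ V, HasGradientAt (f x) (gr z) z)
    (hlip : ∀ z ∈ V, ∀ z' ∈ V, ‖gr z - gr z'‖ ≤ l * ‖z - z'‖) :
    ‖fdY f (q.thetaY dy ε k) x y - gr y‖ ^ 2 ≤ dy * q.L ^ 2 * q.thetaY dy ε k ^ 2 / 4 := by
  have hlL := l_le_L hsc
  have := norm_fd_sub_gradient_sq_le hf hlip y
    (Params.Admissible.thetaY_nonneg hsc.L_pos dy hε k)
    (fun hd => hq.thetaY_pos hsc.L_pos hd hε k)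
    (fun i t ht => hst.y_mem hsc.L_pos hε hk hy i ht)
  refine (this : ‖fdY f (q.thetaY dy ε k) x y - gr y‖ ^ 2 ≤ _).trans ?_
  gcongr

variable (h : P.Regular U V l)

include h in
lemma biasX_le (hk : 1 ≤ k) {x : Vec dx} {y : Vec dy} (hx : x ∈ P.X) (hy : y ∈ P.Y) (lam : Vec p) :
    ‖P.meanEstX q ε k x y lam - P.lagGradX x y lam‖ ^ 2 ≤
      dx * q.L ^ 2 * q.thetaX dx ε k ^ 2 / 4 := by
  have := norm_fdX_sub_sq_le hq hsc hε hst h.l_pos hk (f := P.g) hx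
    (fun z hz => h.mean.hasGrad_x z hz y (h.Y_sub hy))
    (fun z hz z' hz' => h.mean.lip_xx z hz z' hz' y (h.Y_sub hy))
  simpa [meanEstX, lagGradX] using this

include h in
lemma biasY_le (hk : 1 ≤ k) {x : Vec dx} {y : Vec dy} (hx : x ∈ P.X) (hy : y ∈ P.Y) (lam : Vec p) :
    ‖P.meanEstY q ε k x y lam - P.regGradY q k x y lam‖ ^ 2 ≤
      dy * q.L ^ 2 * q.thetaY dy ε k ^ 2 / 4 := by
  have := norm_fdY_sub_sq_le hq hsc hε hst h.l_pos hk (f := P.g) hy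
    (fun z hz => h.mean.hasGrad_y x (h.X_sub hx) z hz)
    (fun z hz z' hz' => h.mean.lip_yy x (h.X_sub hx) z hz z' hz')
  simpa [meanEstY, regGradY] using this

omit hq hsc hε hst in
/-- Comparison of two vectors through approximations of them. -/
lemma norm_sub_sq_le_of_approx {n : ℕ} {a a' g g' : Vec n} {c L X Y : ℝ}
    (ha : ‖a - g‖ ^ 2 ≤ c / 4) (ha' : ‖a' - g'‖ ^ 2 ≤ c / 4) (hg : ‖g' - g‖ ≤ L * X + L * Y) :
    ‖a' - a‖ ^ 2 ≤ 2 * c + 4 * L ^ 2 * (X ^ 2 + Y ^ 2) := by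
  have e : a' - a = (a' - g') + (g' - g) - (a - g) := by abel
  have h1 : ‖a' - a‖ ≤ ‖a' - g'‖ + (L * X + L * Y) + ‖a - g‖ := by
    rw [e]
    refine (norm_sub_le _ _).trans (add_le_add_left ((norm_add_le _ _).trans ?_) _)
    gcongr
  have h2 : ‖a' - a‖ ^ 2 ≤ (‖a' - g'‖ + (L * X + L * Y) + ‖a - g‖) ^ 2 := by gcongr
  have h3 : ∀ u v w z : ℝ, (u + (v + w) + z) ^ 2 ≤ 4 * (u ^ 2 + v ^ 2 + w ^ 2 + z ^ 2) := by
    intro u v w z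
    nlinarith [sq_nonneg (u - v), sq_nonneg (u - w), sq_nonneg (u - z), sq_nonneg (v - w),
      sq_nonneg (v - z), sq_nonneg (w - z)]
  have h4 := h3 ‖a' - g'‖ (L * X) (L * Y) ‖a - g‖
  linarith

/-- Consecutive estimators on one sample differ in point and in smoothing parameter; the comparison
passes through the exact gradients at both points. Both biases are at most that of index `k`, as `θ`
decreases. -/
lemma norm_fdX_sample_sub_sq_le (hl : 0 < l) (hU : IsOpen U) (hV : IsOpen V)
    (hXU : P.X ⊆ U) (hYV : P.Y ⊆ V) (hsm : P.SmoothOn U V l) (hk : 1 ≤ k) {x x' : Vec dx}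
    {y y' : Vec dy} (hx : x ∈ P.X) (hx' : x' ∈ P.X) (hy : y ∈ P.Y) (hy' : y' ∈ P.Y) (ζ : Ξ) :
    ‖fdX (fun x y => P.G x y ζ) (q.thetaX dx ε (k + 1)) x' y'
        - fdX (fun x y => P.G x y ζ) (q.thetaX dx ε k) x y‖ ^ 2 ≤
      2 * (dx * q.L ^ 2 * q.thetaX dx ε k ^ 2)
        + 4 * q.L ^ 2 * (‖x' - x‖ ^ 2 + ‖y' - y‖ ^ 2) := by
  have h1 := norm_fdX_sub_sq_le hq hsc hε hst hl hk (f := fun x y => P.G x y ζ) hx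
    (fun z hz => (hsm.differentiableAt_x hU hV hz (hYV hy) ζ).hasGradientAt)
    (fun z hz z' hz' => hsm.lip_xx ζ z hz z' hz' y (hYV hy))
  have h2 := norm_fdX_sub_sq_le hq hsc hε hst hl (k := k + 1) (by omega)
    (f := fun x y => P.G x y ζ) hx'
    (fun z hz => (hsm.differentiableAt_x hU hV hz (hYV hy') ζ).hasGradientAt)
    (fun z hz z' hz' => hsm.lip_xx ζ z hz z' hz' y' (hYV hy'))
  have hθ := Params.Admissible.thetaX_antitone hsc.L_pos dx hε (Nat.le_succ k)
  have hθ0 := Params.Admissible.thetaX_nonneg hsc.L_pos dx hε (k + 1)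
  refine norm_sub_sq_le_of_approx h1 (h2.trans (by gcongr)) ?_
  refine (norm_sub_le_norm_sub_add_norm_sub _
    (gradient (fun x => P.G x y' ζ) x) _).trans (add_le_add ?_ ?_)
  · exact (hsm.lip_xx ζ x' (hXU hx') x (hXU hx) y' (hYV hy')).trans
      (mul_le_mul_of_nonneg_right (l_le_L hsc) (norm_nonneg _))
  · exact (hsm.lip_xy ζ x (hXU hx) y' (hYV hy') y (hYV hy)).trans
      (mul_le_mul_of_nonneg_right (l_le_L hsc) (norm_nonneg _))

lemma norm_fdY_sample_sub_sq_le (hl : 0 < l) (hU : IsOpen U) (hV : IsOpen V)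
    (hXU : P.X ⊆ U) (hYV : P.Y ⊆ V) (hsm : P.SmoothOn U V l) (hk : 1 ≤ k) {x x' : Vec dx}
    {y y' : Vec dy} (hx : x ∈ P.X) (hx' : x' ∈ P.X) (hy : y ∈ P.Y) (hy' : y' ∈ P.Y) (ζ : Ξ) :
    ‖fdY (fun x y => P.G x y ζ) (q.thetaY dy ε (k + 1)) x' y'
        - fdY (fun x y => P.G x y ζ) (q.thetaY dy ε k) x y‖ ^ 2 ≤
      2 * (dy * q.L ^ 2 * q.thetaY dy ε k ^ 2)
        + 4 * q.L ^ 2 * (‖x' - x‖ ^ 2 + ‖y' - y‖ ^ 2) := by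
  have h1 := norm_fdY_sub_sq_le hq hsc hε hst hl hk (f := fun x y => P.G x y ζ) (x := x) hy
    (fun z hz => (hsm.differentiableAt_y hU hV (hXU hx) hz ζ).hasGradientAt)
    (fun z hz z' hz' => hsm.lip_yy ζ x (hXU hx) z hz z' hz')
  have h2 := norm_fdY_sub_sq_le hq hsc hε hst hl (k := k + 1) (by omega)
    (f := fun x y => P.G x y ζ) (x := x') hy'
    (fun z hz => (hsm.differentiableAt_y hU hV (hXU hx') hz ζ).hasGradientAt)
    (fun z hz z' hz' => hsm.lip_yy ζ x' (hXU hx') z hz z' hz')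
  have hθ := Params.Admissible.thetaY_antitone hsc.L_pos dy hε (Nat.le_succ k)
  have hθ0 := Params.Admissible.thetaY_nonneg hsc.L_pos dy hε (k + 1)
  refine norm_sub_sq_le_of_approx h1 (h2.trans (by gcongr)) ?_
  refine (norm_sub_le_norm_sub_add_norm_sub _
    (gradient (fun y => P.G x y ζ) y') _).trans (add_le_add ?_ ?_)
  · exact (hsm.lip_yx ζ x' (hXU hx') x (hXU hx) y' (hYV hy')).trans
      (mul_le_mul_of_nonneg_right (l_le_L hsc) (norm_nonneg _))
  · exact (hsm.lip_yy ζ x (hXU hx) y' (hYV hy') y (hYV hy)).trans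
      (mul_le_mul_of_nonneg_right (l_le_L hsc) (norm_nonneg _))

end Stencil

/-! ### The descent of the potential along one iteration -/

section Master

variable (P : Problem dx dy p Ξ) (q : Params) (ε δ : ℝ) (k : ℕ) (s : Iterate dx dy p)

/-- A bound of the conditional variance that one iteration adds to the `x`-gradient estimator. -/
noncomputable def noiseX : ℝ :=
  (2 * q.momX k ^ 2 * δ ^ 2 + 2 * (2 * (dx * q.L ^ 2 * q.thetaX dx ε k ^ 2)
    + 4 * q.L ^ 2 * (‖P.nextX q k s - s.x‖ ^ 2 + ‖P.nextY q k s - s.y‖ ^ 2))) / q.b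

/-- A bound of the conditional variance that one iteration adds to the `y`-gradient estimator. -/
noncomputable def noiseY : ℝ :=
  (2 * q.momY k ^ 2 * δ ^ 2 + 2 * (2 * (dy * q.L ^ 2 * q.thetaY dy ε k ^ 2)
    + 4 * q.L ^ 2 * (‖P.nextX q k s - s.x‖ ^ 2 + ‖P.nextY q k s - s.y‖ ^ 2))) / q.b

/-- The squared error of the `x`-gradient estimator. -/
noncomputable def errX : ℝ := ‖P.meanEstX q ε k s.x s.y s.lam - s.v‖ ^ 2

/-- The squared error of the `y`-gradient estimator. -/
noncomputable def errY : ℝ := ‖P.meanEstY q ε k s.x s.y s.lam - s.w‖ ^ 2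

/-- The part of the potential that depends on the variables only. -/
noncomputable def primal (x : Vec dx) (y : Vec dy) (lam : Vec p) : ℝ :=
  P.maxVal q k x lam
    + 32 * q.alpha (k - 1) * q.L ^ 2 / (q.β * q.rho k) * ‖y - P.argMax q k x lam‖ ^ 2

variable {P q ε δ k s} {U : Set (Vec dx)} {V : Set (Vec dy)} {l : ℝ}

variable (h : P.Regular U V l) (hq : q.Admissible ‖P.A‖ ‖P.B‖) (hsc : P.Scaled q l) (hε : 0 < ε)
  (hst : P.StencilIn q ε U V)

include h hq hsc hε hst

/-- The balance of units. `unitX`: 17/32 gained against 1/8 (moving maximiser), 1/8 (gap) and 2 ·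
1/12 (noise). `unitLam`: 9/16 against 1/4 + 1/8. `unitY`: 80/3 against 1 + 2 + 2 · 22/3. `unitE`: 24
against 16. The next errors do not appear themselves; in their place stand `(1 - m)² err + noise`,
the bounds available in expectation. The condition `k ≥ 2` makes the weights of index `k - 1`
subject to `tau_cube_sub_le`. -/
theorem potential_descent (hk : 2 ≤ k) (hs : P.Feasible s) :
    q.D₁ * (Params.eta k * q.alpha k) *
        ‖P.gap (q.alpha k) q.β (q.gamma k) s.x s.y s.lam‖ ^ 2
      + P.primal q (k + 1) (P.nextX q k s) (P.nextY q k s) (P.nextLam q k s)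
      + q.weightX k * ((1 - q.momX k) ^ 2 * P.errX q ε k s + P.noiseX q ε δ k s)
      + q.weightY k * ((1 - q.momY k) ^ 2 * P.errY q ε k s + P.noiseY q ε δ k s) ≤
      P.primal q k s.x s.y s.lam + q.weightX (k - 1) * P.errX q ε k s
      + q.weightY (k - 1) * P.errY q ε k s
      + argCoeff q k * (‖P.argMax q (k + 1) (P.nextX q k s) (P.nextLam q k s)‖ ^ 2
          - ‖P.argMax q k s.x s.lam‖ ^ 2)
      + (q.rho k - q.rho (k + 1)) / 2 * P.sigma ^ 2
      + 2 * q.D₁ * (Params.eta k * q.alpha k) * q.rho k ^ 2 * P.sigma ^ 2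
      + 2 * δ ^ 2 / q.b * (q.weightX k * q.momX k ^ 2 + q.weightY k * q.momY k ^ 2)
      + 1 / 8 * (q.D₁ * (Params.eta k * q.alpha k) * ε ^ 2) := by
  obtain ⟨j, rfl⟩ : ∃ j, k = j + 1 := ⟨k - 1, by omega⟩
  have hL := hsc.L_pos
  have h1 := descent_maxVal (ε := ε) (k := j + 1) h hq hsc hs
  have h2 := descent_argMax (ε := ε) (k := j + 1) h hq hsc (by omega) hs
  have h3 := scaled_gap_le (ε := ε) (k := j + 1) h hq hsc hs
  have hbx := biasX_le hq hsc hε hst h (k := j + 1) (by omega) hs.x_mem hs.y_mem s.lam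
  have hby := biasY_le hq hsc hε hst h (k := j + 1) (by omega) hs.x_mem hs.y_mem s.lam
  have hcx := hq.errX_coeff_le (k := j) (by omega)
  have hcy := hq.errY_coeff_le (k := j) (by omega)
  have htx := hq.biasX_total_le hL dx ε (j + 1)
  have hty := hq.biasY_total_le hL dy ε (j + 1)
  have hF := hq.alpha_div_rho_succ_le hL j
  have hwx := hq.weightX_mul_le hL (j + 1)
  have hwy := hq.weightY_mul_le hL (j + 1)
  have hwx' := hq.weightX_mul_le' hL (j + 1)
  have hwy' := hq.weightY_mul_le' hL (j + 1)
  have hb := hq.b_pos'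
  have hη := Params.eta_pos (j + 1)
  have hα := hq.alpha_pos (j + 1)
  have hγ := hq.gamma_pos (j + 1)
  have hβ := hq.β_pos
  have hD := hq.D₁_pos
  have hA₂ := hq.A₂_pos
  have hρ' := Params.Admissible.rho_pos hL (j + 1 + 1)
  have hX0 : 0 ≤ P.unitX q (j + 1) s := by unfold unitX; positivity
  have hY0 : 0 ≤ P.unitY q (j + 1) s := by unfold unitY; positivity
  have hΛ0 : 0 ≤ P.unitLam q (j + 1) s := by unfold unitLam; positivity
  have hE0 : 0 ≤ P.unitE q (j + 1) s := by unfold unitE; positivity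
  have hwx0 := hq.weightX_pos (j + 1)
  have hwy0 := hq.weightY_pos (j + 1)
  have ex : ‖P.nextX q (j + 1) s - s.x‖ ^ 2 = Params.eta (j + 1) ^ 2 * ‖P.stepX q (j + 1) s‖ ^ 2 := by
    rw [nextX, add_sub_cancel_left, norm_smul, mul_pow, Real.norm_eq_abs, sq_abs]
  have ey : ‖P.nextY q (j + 1) s - s.y‖ ^ 2 = Params.eta (j + 1) ^ 2 * ‖P.stepY q s‖ ^ 2 := by
    rw [nextY, add_sub_cancel_left, norm_smul, mul_pow, Real.norm_eq_abs, sq_abs]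
  -- the noise terms in the units of the descent estimate
  have hX : ∀ w : ℝ, w * (8 * q.L ^ 2) * (Params.eta (j + 1) * q.alpha (j + 1)) ≤ q.b / 12 →
      w * (8 * q.L ^ 2 * ‖P.nextX q (j + 1) s - s.x‖ ^ 2 / q.b) ≤ 1 / 12 * P.unitX q (j + 1) s := by
    intro w hw
    rw [ex, unitX]
    calc w * (8 * q.L ^ 2 * (Params.eta (j + 1) ^ 2 * ‖P.stepX q (j + 1) s‖ ^ 2) / q.b)
        = (w * (8 * q.L ^ 2) * (Params.eta (j + 1) * q.alpha (j + 1))) *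
          (Params.eta (j + 1) / q.alpha (j + 1) * ‖P.stepX q (j + 1) s‖ ^ 2 / q.b) := by
            field_simp
      _ ≤ (q.b / 12) *
          (Params.eta (j + 1) / q.alpha (j + 1) * ‖P.stepX q (j + 1) s‖ ^ 2 / q.b) := by gcongr
      _ = _ := by field_simp
  have hY : ∀ w : ℝ, w * (8 * q.L ^ 2) * Params.eta (j + 1) * (q.β * q.rho (j + 1 + 1)) ≤
        22 / 3 * q.b * (q.alpha (j + 1) * q.L ^ 2) →
      w * (8 * q.L ^ 2 * ‖P.nextY q (j + 1) s - s.y‖ ^ 2 / q.b) ≤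
        22 / 3 * P.unitY q (j + 1) s := by
    intro w hw
    rw [ey, unitY]
    calc w * (8 * q.L ^ 2 * (Params.eta (j + 1) ^ 2 * ‖P.stepY q s‖ ^ 2) / q.b)
        = (w * (8 * q.L ^ 2) * Params.eta (j + 1) * (q.β * q.rho (j + 1 + 1))) *
          (Params.eta (j + 1) / (q.β * q.rho (j + 1 + 1)) * ‖P.stepY q s‖ ^ 2 / q.b) := by
            field_simp
      _ ≤ (22 / 3 * q.b * (q.alpha (j + 1) * q.L ^ 2)) *
          (Params.eta (j + 1) / (q.β * q.rho (j + 1 + 1)) * ‖P.stepY q s‖ ^ 2 / q.b) := by gcongr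
      _ = _ := by field_simp
  have n1 := hX _ hwx
  have n2 := hX _ hwy
  have n3 := hY _ hwx'
  have n4 := hY _ hwy'
  have hE : 32 * q.alpha (j + 1) * q.L ^ 2 / (q.β * q.rho (j + 1 + 1)) *
        ‖s.y - P.argMax q (j + 1) s.x s.lam‖ ^ 2 ≤
      32 * q.alpha j * q.L ^ 2 / (q.β * q.rho (j + 1)) *
        ‖s.y - P.argMax q (j + 1) s.x s.lam‖ ^ 2 := by
    refine mul_le_mul_of_nonneg_right ?_ (sq_nonneg _)
    have e1 : 32 * q.alpha (j + 1) * q.L ^ 2 / (q.β * q.rho (j + 1 + 1)) =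
        (32 * q.L ^ 2 / q.β) * (q.alpha (j + 1) / q.rho (j + 2)) := by field_simp
    have e2 : 32 * q.alpha j * q.L ^ 2 / (q.β * q.rho (j + 1)) =
        (32 * q.L ^ 2 / q.β) * (q.alpha j / q.rho (j + 1)) := by ring
    rw [e1, e2]
    gcongr
  have eNX : q.weightX (j + 1) * P.noiseX q ε δ (j + 1) s =
      2 * δ ^ 2 / q.b * (q.weightX (j + 1) * q.momX (j + 1) ^ 2)
      + dx * q.L ^ 2 * q.thetaX dx ε (j + 1) ^ 2 * (4 * q.weightX (j + 1) / q.b)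
      + q.weightX (j + 1) * (8 * q.L ^ 2 * ‖P.nextX q (j + 1) s - s.x‖ ^ 2 / q.b)
      + q.weightX (j + 1) * (8 * q.L ^ 2 * ‖P.nextY q (j + 1) s - s.y‖ ^ 2 / q.b) := by
    unfold noiseX
    ring
  have eNY : q.weightY (j + 1) * P.noiseY q ε δ (j + 1) s =
      2 * δ ^ 2 / q.b * (q.weightY (j + 1) * q.momY (j + 1) ^ 2)
      + dy * q.L ^ 2 * q.thetaY dy ε (j + 1) ^ 2 * (4 * q.weightY (j + 1) / q.b)
      + q.weightY (j + 1) * (8 * q.L ^ 2 * ‖P.nextX q (j + 1) s - s.x‖ ^ 2 / q.b)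
      + q.weightY (j + 1) * (8 * q.L ^ 2 * ‖P.nextY q (j + 1) s - s.y‖ ^ 2 / q.b) := by
    unfold noiseY
    ring
  have hcx' := mul_le_mul_of_nonneg_right hcx (sq_nonneg ‖P.meanEstX q ε (j + 1) s.x s.y s.lam - s.v‖)
  have hcy' := mul_le_mul_of_nonneg_right hcy (sq_nonneg ‖P.meanEstY q ε (j + 1) s.x s.y s.lam - s.w‖)
  have hbx' := mul_le_mul_of_nonneg_left hbx
    (by positivity : 0 ≤ 2 * (Params.eta (j + 1) * q.alpha (j + 1))
      + 3 * q.D₁ * (Params.eta (j + 1) * q.alpha (j + 1)))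
  have hby' := mul_le_mul_of_nonneg_left hby
    (by positivity : 0 ≤ 67 * q.A₂ * Params.eta (j + 1)
      + 6 * q.D₁ * (Params.eta (j + 1) * q.alpha (j + 1)))
  unfold primal errX errY
  rw [mul_add (q.weightX (j + 1)), mul_add (q.weightY (j + 1)), eNX, eNY]
  simp only [Nat.add_sub_cancel]
  linarith only [h1, h2, h3, n1, n2, n3, n4, hE, hcx', hcy', hbx', hby', htx, hty, hX0, hY0, hΛ0, hE0]

end Master

end Problem

end ZORMPDPG

namespace ZORMPDPG

/-! ### Second moments of mini-batch averages -/

section Probability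

lemma enorm_sq_eq_ofReal {n : ℕ} (v : Vec n) : ‖v‖ₑ ^ 2 = ENNReal.ofReal (‖v‖ ^ 2) := by
  rw [← ofReal_norm, ENNReal.ofReal_pow (norm_nonneg _)]

lemma integrable_sq_of_lintegral_le {n : ℕ} {α : Type*} [MeasurableSpace α] {μ : Measure α}
    {f : α → Vec n} (hf : AEStronglyMeasurable f μ) {C : ℝ}
    (h : ∫⁻ a, ‖f a‖ₑ ^ 2 ∂μ ≤ ENNReal.ofReal C) (hC : 0 ≤ C) :
    MemLp f 2 μ ∧ ∫ a, ‖f a‖ ^ 2 ∂μ ≤ C := by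
  have h1 : MemLp f 2 μ := by
    refine ⟨hf, ?_⟩
    rw [eLpNorm_lt_top_iff_lintegral_rpow_enorm_lt_top two_ne_zero ENNReal.ofNat_ne_top]
    simp only [ENNReal.toReal_ofNat, ENNReal.rpow_ofNat]
    exact h.trans_lt ENNReal.ofReal_lt_top
  refine ⟨h1, ?_⟩
  have h2 := (memLp_two_iff_integrable_sq_norm hf).1 h1
  simp only [enorm_sq_eq_ofReal] at h
  rw [← ofReal_integral_eq_lintegral_ofReal h2 (ae_of_all _ fun a => sq_nonneg _)] at h
  exact (ENNReal.ofReal_le_ofReal_iff hC).1 h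

/-- The second moment of a constant perturbed by an average of centred i.i.d. variables. -/
lemma integral_pi_average_sq_le {b : ℕ} (hb : 0 < b) {Ξ : Type*} [MeasurableSpace Ξ]
    {D : Measure Ξ} [IsProbabilityMeasure D] {X : Ξ → ℝ} (hX : MemLp X 2 D)
    (hmean : ∫ ζ, X ζ ∂D = 0) (a : ℝ) :
    MemLp (fun i : Fin b → Ξ => a + (1 / (b : ℝ)) * ∑ j, X (i j)) 2 (Measure.pi fun _ => D) ∧
      ∫ i, (a + (1 / (b : ℝ)) * ∑ j, X (i j)) ^ 2 ∂(Measure.pi fun _ : Fin b => D) ≤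
        a ^ 2 + 1 / b * ∫ ζ, X ζ ^ 2 ∂D := by
  have hb' : (0 : ℝ) < b := by exact_mod_cast hb
  have hev : ∀ j : Fin b, MeasurePreserving (Function.eval j) (Measure.pi fun _ : Fin b => D) D :=
    fun j => measurePreserving_eval _ j
  have hXj : ∀ j : Fin b, MemLp (fun i : Fin b → Ξ => X (i j)) 2 (Measure.pi fun _ => D) :=
    fun j => hX.comp_measurePreserving (hev j)
  have hsum : MemLp (fun i : Fin b → Ξ => ∑ j, X (i j)) 2 (Measure.pi fun _ => D) :=
    memLp_finsetSum _ fun j _ => hXj j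
  have hsum' : MemLp (fun i : Fin b → Ξ => (1 / (b : ℝ)) * ∑ j, X (i j)) 2
      (Measure.pi fun _ => D) := hsum.const_mul _
  have hZ : MemLp (fun i : Fin b → Ξ => a + (1 / (b : ℝ)) * ∑ j, X (i j)) 2
      (Measure.pi fun _ => D) := (memLp_const a).add hsum'
  refine ⟨hZ, ?_⟩
  have hv : Var[fun i : Fin b → Ξ => a + (1 / (b : ℝ)) * ∑ j, X (i j); Measure.pi fun _ => D]
      = 1 / b * Var[X; D] := by
    have h1 := variance_sum_pi (μ := fun _ : Fin b => D) (X := fun _ => X) fun _ => hX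
    have h2 : (∑ j, fun i : Fin b → Ξ => X (i j)) = fun i => ∑ j, X (i j) := by
      funext i
      simp
    rw [h2] at h1
    rw [variance_const_add hsum'.aestronglyMeasurable, variance_const_mul, h1]
    simp only [Finset.sum_const, Finset.card_univ, Fintype.card_fin, nsmul_eq_mul]
    field_simp
  have hm : ∫ i, (a + (1 / (b : ℝ)) * ∑ j, X (i j)) ∂(Measure.pi fun _ : Fin b => D) = a := by
    rw [integral_add (integrable_const _) (hsum'.integrable one_le_two), integral_const_mul,
      integral_finsetSum _ fun j _ => (hXj j).integrable one_le_two]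
    have e2 : ∀ j : Fin b, ∫ i, X (i j) ∂(Measure.pi fun _ : Fin b => D) = 0 := fun j => by
      have h4 := integral_map (hev j).measurable.aemeasurable (f := X)
        (by rw [(hev j).map_eq]; exact hX.aestronglyMeasurable)
      rw [(hev j).map_eq, hmean] at h4
      exact h4.symm
    simp [e2]
  have hsub := variance_eq_sub hZ
  have hvle := variance_le_expectation_sq hX.aestronglyMeasurable
  rw [hv, hm] at hsub
  have h5 : 1 / (b : ℝ) * Var[X; D] ≤ 1 / b * ∫ ζ, X ζ ^ 2 ∂D :=
    mul_le_mul_of_nonneg_left hvle (by positivity)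
  simp only [Pi.pow_apply] at hsub
  linarith

/-- The second moment of a constant vector perturbed by an average of centred i.i.d. vectors. -/
lemma lintegral_pi_average_le {n b : ℕ} (hb : 0 < b) {Ξ : Type*} [MeasurableSpace Ξ]
    {D : Measure Ξ} [IsProbabilityMeasure D] {ξ : Ξ → Vec n} (hξ : AEStronglyMeasurable ξ D)
    (hmean : ∫ ζ, ξ ζ ∂D = 0) {C : ℝ} (hC : 0 ≤ C)
    (hvar : ∫⁻ ζ, ‖ξ ζ‖ₑ ^ 2 ∂D ≤ ENNReal.ofReal C) (a : Vec n) :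
    ∫⁻ i, ‖a + (1 / (b : ℝ)) • ∑ j, ξ (i j)‖ₑ ^ 2 ∂(Measure.pi fun _ : Fin b => D) ≤
      ENNReal.ofReal (‖a‖ ^ 2 + C / b) := by
  obtain ⟨hL2, hsq⟩ := integrable_sq_of_lintegral_le hξ hvar hC
  -- Reduction to coordinates, where the variance of a sum of independent real variables is
  -- additive.
  have hc : ∀ c, MemLp (fun ζ => ξ ζ c) 2 D := hL2.eval_piLp
  have hc0 : ∀ c, ∫ ζ, ξ ζ c ∂D = 0 := fun c => by
    rw [← eval_integral_piLp (fun i => (hc i).integrable one_le_two) c, hmean]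
    rfl
  have hco := fun c => integral_pi_average_sq_le hb (hc c) (hc0 c) (a c)
  have e : ∀ (i : Fin b → Ξ) c, (a + (1 / (b : ℝ)) • ∑ j, ξ (i j)) c =
      a c + (1 / (b : ℝ)) * ∑ j, ξ (i j) c := fun i c => by simp
  have hZL2 : MemLp (fun i : Fin b → Ξ => a + (1 / (b : ℝ)) • ∑ j, ξ (i j)) 2
      (Measure.pi fun _ : Fin b => D) := MemLp.of_eval_piLp fun c => by
    simp only [e]
    exact (hco c).1
  have hI := (memLp_two_iff_integrable_sq_norm hZL2.aestronglyMeasurable).1 hZL2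
  simp only [enorm_sq_eq_ofReal]
  rw [← ofReal_integral_eq_lintegral_ofReal hI (ae_of_all _ fun a => sq_nonneg _)]
  refine ENNReal.ofReal_le_ofReal ?_
  have e3 : ∀ v : Vec n, ‖v‖ ^ 2 = ∑ c, v c ^ 2 := fun v => by
    simp [EuclideanSpace.norm_sq_eq]
  have e4 : ∫ i, ‖a + (1 / (b : ℝ)) • ∑ j, ξ (i j)‖ ^ 2 ∂(Measure.pi fun _ : Fin b => D) =
      ∑ c, ∫ i, (a c + (1 / (b : ℝ)) * ∑ j, ξ (i j) c) ^ 2 ∂(Measure.pi fun _ : Fin b => D) := by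
    rw [← integral_finsetSum _ fun c _ => (hco c).1.integrable_sq]
    refine integral_congr_ae (ae_of_all _ fun i => ?_)
    simp only [e3, e]
  have e5 : ∫ ζ, ‖ξ ζ‖ ^ 2 ∂D = ∑ c, ∫ ζ, ξ ζ c ^ 2 ∂D := by
    rw [← integral_finsetSum _ fun c _ => (hc c).integrable_sq]
    exact integral_congr_ae (ae_of_all _ fun i => e3 _)
  rw [e4]
  calc _ ≤ ∑ c, (a c ^ 2 + 1 / b * ∫ ζ, ξ ζ c ^ 2 ∂D) := Finset.sum_le_sum fun c _ => (hco c).2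
    _ = ‖a‖ ^ 2 + 1 / b * ∫ ζ, ‖ξ ζ‖ ^ 2 ∂D := by
      rw [Finset.sum_add_distrib, ← Finset.mul_sum, e3 a, e5]
    _ ≤ ‖a‖ ^ 2 + 1 / b * C := by gcongr
    _ = _ := by ring

/-- The second moment of a random vector perturbed by an average over a mini-batch that is
independent of it. -/
lemma lintegral_average_le {n b : ℕ} (hb : 0 < b) {Ξ Ω W : Type*} [MeasurableSpace Ξ]
    [MeasurableSpace Ω] [MeasurableSpace W] {D : Measure Ξ} [IsProbabilityMeasure D]
    {μ : Measure Ω} [IsProbabilityMeasure μ] {w : Ω → W} (hw : Measurable w)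
    {I : Fin b → Ω → Ξ} (hI : ∀ j, Measurable (I j)) (hlaw : ∀ j, μ.map (I j) = D)
    (hind : iIndepFun I μ) (hwI : IndepFun w (fun ω j => I j ω) μ)
    {a : W → Vec n} (ha : Measurable a) {ξ : W → Ξ → Vec n}
    (hξ : Measurable fun z : W × Ξ => ξ z.1 z.2) {C : Ω → ℝ} (hC : ∀ ω, 0 ≤ C ω)
    (hmean : ∀ ω, ∫ ζ, ξ (w ω) ζ ∂D = 0)
    (hvar : ∀ ω, ∫⁻ ζ, ‖ξ (w ω) ζ‖ₑ ^ 2 ∂D ≤ ENNReal.ofReal (C ω)) :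
    ∫⁻ ω, ‖a (w ω) + (1 / (b : ℝ)) • ∑ j, ξ (w ω) (I j ω)‖ₑ ^ 2 ∂μ ≤
      ∫⁻ ω, ENNReal.ofReal (‖a (w ω)‖ ^ 2 + C ω / b) ∂μ := by
  have hII : Measurable fun ω (j : Fin b) => I j ω := measurable_pi_lambda _ hI
  set T : W × (Fin b → Ξ) → ENNReal :=
    fun z => ‖a z.1 + (1 / (b : ℝ)) • ∑ j, ξ z.1 (z.2 j)‖ₑ ^ 2 with hT
  have hTm : Measurable T := by
    have h1 : ∀ j : Fin b, Measurable fun z : W × (Fin b → Ξ) => ξ z.1 (z.2 j) := fun j =>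
      hξ.comp (measurable_fst.prodMk ((measurable_pi_apply j).comp measurable_snd))
    have h2 : Measurable fun z : W × (Fin b → Ξ) => ∑ j, ξ z.1 (z.2 j) :=
      Finset.measurable_fun_sum _ fun j _ => h1 j
    have h3 : Measurable fun z : W × (Fin b → Ξ) => (1 / (b : ℝ)) • ∑ j, ξ z.1 (z.2 j) :=
      h2.const_smul (1 / (b : ℝ))
    have h4 : Measurable fun z : W × (Fin b → Ξ) => a z.1 := ha.comp measurable_fst
    exact ((h4.add h3).enorm).pow_const 2
  -- Independence makes the joint law a product, so Tonelli lets the state be frozen while the batch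
  -- is averaged; no conditional expectation is needed.
  have hmap : μ.map (fun ω => (w ω, fun j => I j ω)) =
      (μ.map w).prod (Measure.pi fun _ : Fin b => D) := by
    rw [(indepFun_iff_map_prod_eq_prod_map_map hw.aemeasurable hII.aemeasurable).1 hwI,
      hind.map_fun_eq_pi_map fun j => (hI j).aemeasurable]
    simp only [hlaw]
  calc ∫⁻ ω, ‖a (w ω) + (1 / (b : ℝ)) • ∑ j, ξ (w ω) (I j ω)‖ₑ ^ 2 ∂μ
      = ∫⁻ ω, T (w ω, fun j => I j ω) ∂μ := rfl
    _ = ∫⁻ z, T z ∂(μ.map fun ω => (w ω, fun j => I j ω)) :=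
      (lintegral_map hTm (hw.prodMk hII)).symm
    _ = ∫⁻ x, ∫⁻ i, T (x, i) ∂(Measure.pi fun _ : Fin b => D) ∂(μ.map w) := by
      rw [hmap, lintegral_prod _ hTm.aemeasurable]
    _ = ∫⁻ ω, ∫⁻ i, T (w ω, i) ∂(Measure.pi fun _ : Fin b => D) ∂μ :=
      lintegral_map hTm.lintegral_prod_right' hw
    _ ≤ _ := by
      refine lintegral_mono fun ω => ?_
      exact lintegral_pi_average_le hb
        (hξ.comp (measurable_const.prodMk measurable_id)).aestronglyMeasurable
        (hmean ω) (hC ω) (hvar ω) (a (w ω))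

/-- Variance does not exceed the second moment, for a bounded random vector. -/
lemma lintegral_sub_integral_sq_le {n : ℕ} {Ξ : Type*} [MeasurableSpace Ξ] {D : Measure Ξ}
    [IsProbabilityMeasure D] {B : Ξ → Vec n} (hB : AEStronglyMeasurable B D) {C : ℝ}
    (hBC : ∀ ζ, ‖B ζ‖ ^ 2 ≤ C) :
    ∫⁻ ζ, ‖B ζ - ∫ z, B z ∂D‖ₑ ^ 2 ∂D ≤ ENNReal.ofReal C := by
  have hb : ∀ ζ, ‖B ζ‖ ≤ √C := fun ζ => Real.le_sqrt_of_sq_le (hBC ζ)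
  have hL : MemLp B 2 D := MemLp.of_bound hB (√C) (ae_of_all _ hb)
  have hI := hL.integrable one_le_two
  set m := ∫ z, B z ∂D with hm
  have hLm : MemLp (fun ζ => B ζ - m) 2 D := hL.sub (memLp_const m)
  have hI2 := (memLp_two_iff_integrable_sq_norm hLm.aestronglyMeasurable).1 hLm
  have hI3 := (memLp_two_iff_integrable_sq_norm hB).1 hL
  simp only [enorm_sq_eq_ofReal]
  rw [← ofReal_integral_eq_lintegral_ofReal hI2 (ae_of_all _ fun a => sq_nonneg _)]
  refine ENNReal.ofReal_le_ofReal ?_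
  have e : ∀ ζ, ‖B ζ - m‖ ^ 2 = ‖B ζ‖ ^ 2 - 2 * inner ℝ m (B ζ) + ‖m‖ ^ 2 := fun ζ => by
    rw [norm_sub_sq_real, real_inner_comm]
  have hin : ∫ ζ, inner ℝ m (B ζ) ∂D = ‖m‖ ^ 2 := by
    rw [integral_inner hI, ← hm, real_inner_self_eq_norm_sq]
  simp only [e]
  have hI4 : Integrable (fun ζ => ‖B ζ‖ ^ 2 - 2 * inner ℝ m (B ζ)) D :=
    hI3.sub ((hI.const_inner m).const_mul 2)
  rw [integral_add hI4 (integrable_const _), integral_sub hI3 ((hI.const_inner m).const_mul 2), integral_const_mul, hin]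
  have h1 : ∫ ζ, ‖B ζ‖ ^ 2 ∂D ≤ C := by
    have := integral_mono hI3 (integrable_const C) hBC
    simpa using this
  simp only [integral_const, probReal_univ, one_smul]
  linarith [sq_nonneg ‖m‖]

/-- The innovation splits into `r` times the new centred gradient and `1 - r` times the centred
difference of two gradients at the same sample. The first has variance of order `r² δ²`, the second
is small whenever the iterates are close. This is the variance reduction behind the recursive
estimator. -/
lemma lintegral_momentum_sq_le {n : ℕ} {Ξ : Type*} [MeasurableSpace Ξ] {D : Measure Ξ}
    [IsProbabilityMeasure D] {a a' : Ξ → Vec n} (ha : Integrable a D) (ha' : Integrable a' D)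
    {r δ C : ℝ} (hr0 : 0 ≤ r) (hr1 : r ≤ 1) (hC : 0 ≤ C)
    (hvar' : ∫⁻ ζ, ‖a' ζ - ∫ z, a' z ∂D‖ₑ ^ 2 ∂D ≤ ENNReal.ofReal (δ ^ 2))
    (hdiff : ∀ ζ, ‖a' ζ - a ζ‖ ^ 2 ≤ C) :
    ∫⁻ ζ, ‖((∫ z, a' z ∂D) - a' ζ) - (1 - r) • ((∫ z, a z ∂D) - a ζ)‖ₑ ^ 2 ∂D ≤
      ENNReal.ofReal (2 * r ^ 2 * δ ^ 2 + 2 * C) := by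
  have hd := lintegral_sub_integral_sq_le (D := D) (B := fun ζ => a' ζ - a ζ)
    (ha'.sub ha).aestronglyMeasurable hdiff
  rw [integral_sub ha' ha] at hd
  set m := ∫ z, a z ∂D
  set m' := ∫ z, a' z ∂D
  have hpt : ∀ ζ, ‖(m' - a' ζ) - (1 - r) • (m - a ζ)‖ₑ ^ 2 ≤
      ENNReal.ofReal (2 * r ^ 2) * ‖a' ζ - m'‖ₑ ^ 2 + ENNReal.ofReal 2 * ‖a' ζ - a ζ - (m' - m)‖ₑ ^ 2 := by
    intro ζ
    have e : (m' - a' ζ) - (1 - r) • (m - a ζ) =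
        -(r • (a' ζ - m') + (1 - r) • (a' ζ - a ζ - (m' - m))) := by module
    rw [e, enorm_neg, enorm_sq_eq_ofReal, enorm_sq_eq_ofReal, enorm_sq_eq_ofReal,
      ← ENNReal.ofReal_mul (by positivity), ← ENNReal.ofReal_mul (by positivity),
      ← ENNReal.ofReal_add (by positivity) (by positivity)]
    refine ENNReal.ofReal_le_ofReal ?_
    have h3 := norm_add_le (r • (a' ζ - m')) ((1 - r) • (a' ζ - a ζ - (m' - m)))
    rw [norm_smul, norm_smul, Real.norm_of_nonneg hr0, Real.norm_of_nonneg (sub_nonneg.2 hr1)] at h3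
    set u := ‖a' ζ - m'‖
    set v := ‖a' ζ - a ζ - (m' - m)‖
    have hv : 0 ≤ v := norm_nonneg _
    have h4 : (1 - r) * v ≤ v := by nlinarith
    calc _ ≤ (r * u + v) ^ 2 := by
          refine pow_le_pow_left₀ (norm_nonneg _) (h3.trans ?_) 2
          linarith
      _ ≤ _ := by nlinarith [sq_nonneg (r * u - v)]
  have hm1 : AEMeasurable (fun ζ => ‖a' ζ - m'‖ₑ ^ 2) D :=
    ((ha'.aestronglyMeasurable.sub aestronglyMeasurable_const).enorm).pow_const 2
  calc _ ≤ ∫⁻ ζ, (ENNReal.ofReal (2 * r ^ 2) * ‖a' ζ - m'‖ₑ ^ 2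
          + ENNReal.ofReal 2 * ‖a' ζ - a ζ - (m' - m)‖ₑ ^ 2) ∂D := lintegral_mono hpt
    _ = ENNReal.ofReal (2 * r ^ 2) * ∫⁻ ζ, ‖a' ζ - m'‖ₑ ^ 2 ∂D
          + ENNReal.ofReal 2 * ∫⁻ ζ, ‖a' ζ - a ζ - (m' - m)‖ₑ ^ 2 ∂D := by
      rw [lintegral_add_left' (hm1.const_mul _), lintegral_const_mul' _ _ ENNReal.ofReal_ne_top,
        lintegral_const_mul' _ _ ENNReal.ofReal_ne_top]
    _ ≤ ENNReal.ofReal (2 * r ^ 2) * ENNReal.ofReal (δ ^ 2) + ENNReal.ofReal 2 * ENNReal.ofReal C := by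
      gcongr
    _ = _ := by
        rw [← ENNReal.ofReal_mul (by positivity), ← ENNReal.ofReal_mul (by positivity),
        ← ENNReal.ofReal_add (by positivity) (by positivity)]

/-- Second moments are compared through `lintegral`, where nothing has to be integrable beforehand;
this converts the outcome into integrability and a real inequality. -/
lemma integrable_of_lintegral_le {α : Type*} [MeasurableSpace α] {μ : Measure α} {f g : α → ℝ}
    (hf : Measurable f) (hf0 : ∀ a, 0 ≤ f a) (hg : Integrable g μ) (hg0 : ∀ a, 0 ≤ g a)
    (h : ∫⁻ a, ENNReal.ofReal (f a) ∂μ ≤ ∫⁻ a, ENNReal.ofReal (g a) ∂μ) :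
    Integrable f μ ∧ ∫ a, f a ∂μ ≤ ∫ a, g a ∂μ := by
  rw [← ofReal_integral_eq_lintegral_ofReal hg (ae_of_all _ hg0)] at h
  have hfi : Integrable f μ := by
    refine ⟨hf.aestronglyMeasurable, ?_⟩
    rw [hasFiniteIntegral_iff_ofReal (ae_of_all _ hf0)]
    exact h.trans_lt ENNReal.ofReal_lt_top
  refine ⟨hfi, ?_⟩
  rw [← ofReal_integral_eq_lintegral_ofReal hfi (ae_of_all _ hf0)] at h
  exact (ENNReal.ofReal_le_ofReal_iff (integral_nonneg hg0)).1 h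

end Probability

end ZORMPDPG

namespace ZORMPDPG

/-! ### Measurability of the iterates -/

section Measurability

variable {dx dy p : ℕ} {Ξ : Type*} [MeasurableSpace Ξ]

/-- The components of a state. -/
def Iterate.tuple (s : Iterate dx dy p) : Vec dx × Vec dy × Vec p × Vec dx × Vec dy :=
  (s.x, s.y, s.lam, s.v, s.w)

instance Iterate.instMeasurableSpace : MeasurableSpace (Iterate dx dy p) := MeasurableSpace.comap Iterate.tuple inferInstance

lemma Iterate.measurable_tuple : Measurable (Iterate.tuple (dx := dx) (dy := dy) (p := p)) :=
  comap_measurable _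

lemma Iterate.measurable_x : Measurable (Iterate.x (dx := dx) (dy := dy) (p := p)) :=
  measurable_fst.comp Iterate.measurable_tuple

lemma Iterate.measurable_y : Measurable (Iterate.y (dx := dx) (dy := dy) (p := p)) :=
  (measurable_fst.comp measurable_snd).comp Iterate.measurable_tuple

lemma Iterate.measurable_lam : Measurable (Iterate.lam (dx := dx) (dy := dy) (p := p)) :=
  (measurable_fst.comp (measurable_snd.comp measurable_snd)).comp Iterate.measurable_tuple

lemma Iterate.measurable_v : Measurable (Iterate.v (dx := dx) (dy := dy) (p := p)) :=
  (measurable_fst.comp (measurable_snd.comp (measurable_snd.comp measurable_snd))).comp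
    Iterate.measurable_tuple

lemma Iterate.measurable_w : Measurable (Iterate.w (dx := dx) (dy := dy) (p := p)) :=
  (measurable_snd.comp (measurable_snd.comp (measurable_snd.comp measurable_snd))).comp
    Iterate.measurable_tuple

variable {α : Type*} [MeasurableSpace α]

lemma Iterate.measurable_mk {x : α → Vec dx} {y : α → Vec dy} {lam : α → Vec p} {v : α → Vec dx}
    {w : α → Vec dy} (hx : Measurable x) (hy : Measurable y) (hlam : Measurable lam)
    (hv : Measurable v) (hw : Measurable w) :
    Measurable fun a => Iterate.mk (x a) (y a) (lam a) (v a) (w a) :=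
  measurable_comap_iff.2 (hx.prodMk (hy.prodMk (hlam.prodMk (hv.prodMk hw))))

namespace Problem

variable {P : Problem dx dy p Ξ} {q : Params} {U : Set (Vec dx)} {V : Set (Vec dy)} {l : ℝ}

section

variable (hG : Measurable (fun z : (Vec dx × Vec dy) × Ξ => P.G z.1.1 z.1.2 z.2))

include hG

lemma measurable_fdX_G (θ : ℝ) {x : α → Vec dx} {y : α → Vec dy} {ζ : α → Ξ} (hx : Measurable x)
    (hy : Measurable y) (hζ : Measurable ζ) :
    Measurable fun a => fdX (fun x' y' => P.G x' y' (ζ a)) θ (x a) (y a) := by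
  unfold fdX
  refine Finset.measurable_fun_sum _ fun i _ => ?_
  have h1 : Measurable fun a => P.G (x a + θ • dir i) (y a) (ζ a) :=
    hG.comp (((hx.add_const _).prodMk hy).prodMk hζ)
  have h2 : Measurable fun a => P.G (x a) (y a) (ζ a) := hG.comp ((hx.prodMk hy).prodMk hζ)
  exact ((h1.sub h2).div_const θ).smul_const _

lemma measurable_fdY_G (θ : ℝ) {x : α → Vec dx} {y : α → Vec dy} {ζ : α → Ξ} (hx : Measurable x)
    (hy : Measurable y) (hζ : Measurable ζ) :
    Measurable fun a => fdY (fun x' y' => P.G x' y' (ζ a)) θ (x a) (y a) := by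
  unfold fdY
  refine Finset.measurable_fun_sum _ fun i _ => ?_
  have h1 : Measurable fun a => P.G (x a) (y a + θ • dir i) (ζ a) :=
    hG.comp ((hx.prodMk (hy.add_const _)).prodMk hζ)
  have h2 : Measurable fun a => P.G (x a) (y a) (ζ a) := hG.comp ((hx.prodMk hy).prodMk hζ)
  exact ((h1.sub h2).div_const θ).smul_const _

lemma measurable_g [IsProbabilityMeasure P.D] {x : α → Vec dx} {y : α → Vec dy}
    (hx : Measurable x) (hy : Measurable y) : Measurable fun a => P.g (x a) (y a) := by
  have h1 := (hG.stronglyMeasurable.integral_prod_right' (ν := P.D)).measurable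
  exact h1.comp (hx.prodMk hy)

lemma measurable_fdX_g [IsProbabilityMeasure P.D] (θ : ℝ) {x : α → Vec dx} {y : α → Vec dy}
    (hx : Measurable x) (hy : Measurable y) : Measurable fun a => fdX P.g θ (x a) (y a) := by
  unfold fdX
  refine Finset.measurable_fun_sum _ fun i _ => ?_
  exact (((measurable_g hG (hx.add_const _) hy).sub (measurable_g hG hx hy)).div_const θ).smul_const _

lemma measurable_fdY_g [IsProbabilityMeasure P.D] (θ : ℝ) {x : α → Vec dx} {y : α → Vec dy}
    (hx : Measurable x) (hy : Measurable y) : Measurable fun a => fdY P.g θ (x a) (y a) := by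
  unfold fdY
  refine Finset.measurable_fun_sum _ fun i _ => ?_
  exact (((measurable_g hG hx (hy.add_const _)).sub (measurable_g hG hx hy)).div_const θ).smul_const _

lemma measurable_meanEstX [IsProbabilityMeasure P.D] (ε : ℝ) (k : ℕ) {x : α → Vec dx}
    {y : α → Vec dy} {lam : α → Vec p} (hx : Measurable x) (hy : Measurable y)
    (hlam : Measurable lam) : Measurable fun a => P.meanEstX q ε k (x a) (y a) (lam a) :=
  (measurable_fdX_g hG _ hx hy).sub ((ContinuousLinearMap.continuous _).measurable.comp hlam)

lemma measurable_meanEstY [IsProbabilityMeasure P.D] (ε : ℝ) (k : ℕ) {x : α → Vec dx}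
    {y : α → Vec dy} {lam : α → Vec p} (hx : Measurable x) (hy : Measurable y)
    (hlam : Measurable lam) : Measurable fun a => P.meanEstY q ε k (x a) (y a) (lam a) :=
  ((measurable_fdY_g hG _ hx hy).sub ((ContinuousLinearMap.continuous _).measurable.comp hlam)).sub
    (hy.const_smul (q.rho k))

lemma measurable_estX (ε : ℝ) (k : ℕ) {x : α → Vec dx} {y : α → Vec dy} {lam : α → Vec p}
    {I : Fin q.b → α → Ξ} (hx : Measurable x) (hy : Measurable y) (hlam : Measurable lam)
    (hI : ∀ j, Measurable (I j)) :
    Measurable fun a => P.estX q ε k (x a) (y a) (lam a) (fun j => I j a) := by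
  unfold estX
  refine (Finset.measurable_fun_sum _ fun j _ => ?_).const_smul (1 / (q.b : ℝ))
  exact (measurable_fdX_G hG _ hx hy (hI j)).sub
    ((ContinuousLinearMap.continuous _).measurable.comp hlam)

lemma measurable_estY (ε : ℝ) (k : ℕ) {x : α → Vec dx} {y : α → Vec dy} {lam : α → Vec p}
    {I : Fin q.b → α → Ξ} (hx : Measurable x) (hy : Measurable y) (hlam : Measurable lam)
    (hI : ∀ j, Measurable (I j)) :
    Measurable fun a => P.estY q ε k (x a) (y a) (lam a) (fun j => I j a) := by
  unfold estY
  refine (Finset.measurable_fun_sum _ fun j _ => ?_).const_smul (1 / (q.b : ℝ))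
  exact ((measurable_fdY_G hG _ hx hy (hI j)).sub
    ((ContinuousLinearMap.continuous _).measurable.comp hlam)).sub (hy.const_smul (q.rho k))

end

section

variable (h : P.Regular U V l)

include h

lemma measurable_nextX (k : ℕ) : Measurable (P.nextX q k) := by
  have h1 := (continuous_proj h.X_ne h.X_comp.isClosed h.X_conv).measurable
  have h2 : Measurable fun s : Iterate dx dy p => s.x - q.alpha k • s.v :=
    Iterate.measurable_x.sub (Iterate.measurable_v.const_smul (q.alpha k))
  have h3 : Measurable fun s : Iterate dx dy p => proj P.X (s.x - q.alpha k • s.v) - s.x :=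
    (h1.comp h2).sub Iterate.measurable_x
  exact Iterate.measurable_x.add (h3.const_smul (Params.eta k))

lemma measurable_nextY (k : ℕ) : Measurable (P.nextY q k) := by
  have h1 := (continuous_proj h.Y_ne h.Y_comp.isClosed h.Y_conv).measurable
  have h2 : Measurable fun s : Iterate dx dy p => s.y + q.β • s.w :=
    Iterate.measurable_y.add (Iterate.measurable_w.const_smul q.β)
  have h3 : Measurable fun s : Iterate dx dy p => proj P.Y (s.y + q.β • s.w) - s.y :=
    (h1.comp h2).sub Iterate.measurable_y
  exact Iterate.measurable_y.add (h3.const_smul (Params.eta k))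

lemma measurable_nextLam (k : ℕ) : Measurable (P.nextLam q k) := by
  have h1 := (continuous_proj P.Lam_ne P.lam_closed P.lam_conv).measurable
  have h2 : Measurable fun s => P.A (P.nextX q k s) + P.B (P.nextY q k s) - P.c :=
    ((P.A.continuous.measurable.comp (measurable_nextX h k)).add
      (P.B.continuous.measurable.comp (measurable_nextY h k))).sub_const _
  have h3 : Measurable fun s => s.lam
      + q.gamma k • (P.A (P.nextX q k s) + P.B (P.nextY q k s) - P.c) :=
    Iterate.measurable_lam.add (h2.const_smul (q.gamma k))
  have h4 : Measurable fun s => proj P.Lam (s.lam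
      + q.gamma k • (P.A (P.nextX q k s) + P.B (P.nextY q k s) - P.c)) - s.lam :=
    (h1.comp h3).sub Iterate.measurable_lam
  exact Iterate.measurable_lam.add (h4.const_smul (Params.eta k))

/-- For equal regularisation the signed term in `argMax_step_le` vanishes and the maximiser is
Lipschitz in `(x, λ)`. This gives measurability of an object defined by choice; the domain is the
subtype because nothing is known off `P.X`. -/
lemma continuous_argMax (hL : 0 < q.L) (k : ℕ) :
    Continuous fun z : P.X × Vec p => P.argMax q k z.1 z.2 := by
  have hρ := Params.Admissible.rho_pos hL k
  refine continuous_iff_continuousAt.2 fun z => tendsto_iff_norm_sub_tendsto_zero.2 ?_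
  have h1 : ∀ z' : P.X × Vec p, ‖P.argMax q k z'.1 z'.2 - P.argMax q k z.1 z.2‖ ≤
      √(2 * (l ^ 2 * ‖(z'.1 : Vec dx) - z.1‖ ^ 2 + ‖P.B‖ ^ 2 * ‖z'.2 - z.2‖ ^ 2) /
        q.rho k ^ 2) := fun z' => by
    have := h.argMax_step_le q hρ le_rfl z.1.2 z'.1.2 z.2 z'.2
    rw [sub_self, zero_div, zero_mul, zero_add] at this
    exact Real.le_sqrt_of_sq_le this
  refine squeeze_zero (fun _ => norm_nonneg _) h1 ?_
  have h2 : Continuous fun z' : P.X × Vec p =>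
      √(2 * (l ^ 2 * ‖(z'.1 : Vec dx) - z.1‖ ^ 2 + ‖P.B‖ ^ 2 * ‖z'.2 - z.2‖ ^ 2) /
        q.rho k ^ 2) := by fun_prop
  have h3 := h2.tendsto z
  simp only [sub_self, norm_zero] at h3
  norm_num at h3
  exact h3

lemma measurable_argMax (hL : 0 < q.L) (k : ℕ) {x : α → Vec dx} {lam : α → Vec p}
    (hx : Measurable x) (hlam : Measurable lam) (hxX : ∀ a, x a ∈ P.X) :
    Measurable fun a => P.argMax q k (x a) (lam a) := by
  have h3 : Measurable fun a => ((⟨x a, hxX a⟩ : P.X), lam a) := hx.subtype_mk.prodMk hlam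
  have h4 : Measurable (fun z : P.X × Vec p => P.argMax q k z.1 z.2) :=
    (continuous_argMax (q := q) h hL k).measurable
  have e : (fun a => P.argMax q k (x a) (lam a)) =
      (fun z : P.X × Vec p => P.argMax q k z.1 z.2) ∘ fun a => ((⟨x a, hxX a⟩ : P.X), lam a) :=
    rfl
  rw [e]
  exact h4.comp h3

lemma measurable_maxVal [IsProbabilityMeasure P.D]
    (hG : Measurable (fun z : (Vec dx × Vec dy) × Ξ => P.G z.1.1 z.1.2 z.2)) (hL : 0 < q.L)
    (k : ℕ) {x : α → Vec dx} {lam : α → Vec p} (hx : Measurable x) (hlam : Measurable lam)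
    (hxX : ∀ a, x a ∈ P.X) : Measurable fun a => P.maxVal q k (x a) (lam a) := by
  have hm := measurable_argMax (q := q) h hL k hx hlam hxX
  simp only [fun a => h.maxVal_eq q k (hxX a) (lam a)]
  have h2 : Measurable fun a => P.A (x a) + P.B (P.argMax q k (x a) (lam a)) - P.c :=
    ((P.A.continuous.measurable.comp hx).add (P.B.continuous.measurable.comp hm)).sub_const _
  exact ((measurable_g hG hx hm).sub (hlam.inner h2)).sub ((hm.norm.pow_const 2).const_mul _)

/-- The iterates are measurable functions of the samples drawn so far. -/
theorem measurable_iter (hG : Measurable (fun z : (Vec dx × Vec dy) × Ξ => P.G z.1.1 z.1.2 z.2))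
    (ε : ℝ) (x₁ : Vec dx) (y₁ : Vec dy) (lam₁ : Vec p) {ζ : ℕ → Fin q.b → α → Ξ} :
    ∀ k : ℕ, 1 ≤ k → (∀ n ≤ k, ∀ j, Measurable (ζ n j)) →
      Measurable fun a => P.iter q ε x₁ y₁ lam₁ (fun n j => ζ n j a) k
  | 0, hk, _ => by omega
  | 1, _, hζ => by
    simp only [iter, if_true]
    exact Iterate.measurable_mk measurable_const measurable_const measurable_const
      (measurable_estX hG ε 1 measurable_const measurable_const measurable_const (hζ 1 le_rfl))
      (measurable_estY hG ε 1 measurable_const measurable_const measurable_const (hζ 1 le_rfl))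
  | k + 2, _, hζ => by
    have ih := measurable_iter hG ε x₁ y₁ lam₁ (k + 1) (by omega)
      fun n hn j => hζ n (by omega) j
    have e : (fun a => P.iter q ε x₁ y₁ lam₁ (fun n j => ζ n j a) (k + 2)) =
        fun a => P.step q ε (fun n j => ζ n j a) (k + 1)
          (P.iter q ε x₁ y₁ lam₁ (fun n j => ζ n j a) (k + 1)) := by
      funext a
      rw [iter, if_neg (by omega)]
    rw [e]
    have hx := Iterate.measurable_x.comp ih
    have hy := Iterate.measurable_y.comp ih
    have hlam := Iterate.measurable_lam.comp ih
    have hx' := (measurable_nextX (q := q) h (k + 1)).comp ih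
    have hy' := (measurable_nextY (q := q) h (k + 1)).comp ih
    have hlam' := (measurable_nextLam (q := q) h (k + 1)).comp ih
    have hI := hζ (k + 2) le_rfl
    exact Iterate.measurable_mk hx' hy' hlam'
      ((measurable_estX hG ε _ hx' hy' hlam' hI).add
        (((Iterate.measurable_v.comp ih).sub (measurable_estX hG ε _ hx hy hlam hI)).const_smul
          (1 - q.momX (k + 1))))
      ((measurable_estY hG ε _ hx' hy' hlam' hI).add
        (((Iterate.measurable_w.comp ih).sub (measurable_estY hG ε _ hx hy hlam hI)).const_smul
          (1 - q.momY (k + 1))))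

end

end Problem

end Measurability

end ZORMPDPG

namespace ZORMPDPG

namespace Problem

variable {dx dy p : ℕ} {Ξ : Type*} [MeasurableSpace Ξ]

/-! ### Bounds that do not depend on the accuracy -/

/-- A common bound of the data of the problem over the feasible sets. -/
structure BoundedBy (P : Problem dx dy p Ξ) (M : ℝ) : Prop where
  nonneg : 0 ≤ M
  norm_x_le : ∀ x ∈ P.X, ‖x‖ ≤ M
  norm_y_le : ∀ y ∈ P.Y, ‖y‖ ≤ M
  abs_g_le : ∀ x ∈ P.X, ∀ y ∈ P.Y, |P.g x y| ≤ M
  residual_le : ∀ x ∈ P.X, ∀ y ∈ P.Y, ‖P.A x + P.B y - P.c‖ ≤ M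

variable {P : Problem dx dy p Ξ} {q : Params} {U : Set (Vec dx)} {V : Set (Vec dy)} {l M ε : ℝ}

/-- The bound of `g` uses compactness in `y` for one fixed `x₀` and the expansion in `x` from there,
whose gradient is bounded through its Lipschitz dependence on `y`. -/
lemma Regular.exists_boundedBy (h : P.Regular U V l) : ∃ M, P.BoundedBy M := by
  obtain ⟨x₀, hx₀⟩ := h.X_ne
  obtain ⟨y₀, hy₀⟩ := h.Y_ne
  obtain ⟨R₁, hR₁⟩ := h.X_comp.isBounded.exists_norm_le
  obtain ⟨R₂, hR₂⟩ := h.Y_comp.isBounded.exists_norm_le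
  obtain ⟨R₃, hR₃⟩ := h.Y_comp.exists_bound_of_continuousOn (h.continuousOn_g_y hx₀)
  have hl := h.l_pos
  have hR₁0 : 0 ≤ R₁ := (norm_nonneg _).trans (hR₁ x₀ hx₀)
  have hR₂0 : 0 ≤ R₂ := (norm_nonneg _).trans (hR₂ y₀ hy₀)
  have hR₃0 : 0 ≤ R₃ := (norm_nonneg _).trans (hR₃ y₀ hy₀)
  set M₁ := R₃ + (‖P.gradX x₀ y₀‖ + l * (R₂ + R₂)) * (R₁ + R₁) + l / 2 * (R₁ + R₁) ^ 2 with hM₁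
  set M₂ := ‖P.A‖ * R₁ + ‖P.B‖ * R₂ + ‖P.c‖ with hM₂
  have h1 : 0 ≤ M₁ := by positivity
  have h2 : 0 ≤ M₂ := by positivity
  refine ⟨R₁ + R₂ + M₁ + M₂, by positivity, fun x hx => ?_, fun y hy => ?_, fun x hx y hy => ?_,
    fun x hx y hy => ?_⟩
  · linarith [hR₁ x hx]
  · linarith [hR₂ y hy]
  · have e1 := h.abs_g_x_le hx₀ hx hy
    have e2 := hR₃ y hy
    rw [Real.norm_eq_abs] at e2
    have e3 : ‖P.gradX x₀ y‖ ≤ ‖P.gradX x₀ y₀‖ + l * (R₂ + R₂) := by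
      have := h.mean.lip_xy x₀ (h.X_sub hx₀) y (h.Y_sub hy) y₀ (h.Y_sub hy₀)
      have h3 : ‖y - y₀‖ ≤ R₂ + R₂ := (norm_sub_le _ _).trans (add_le_add (hR₂ y hy) (hR₂ y₀ hy₀))
      have h4 : l * ‖y - y₀‖ ≤ l * (R₂ + R₂) := by gcongr
      have h5 := norm_le_norm_add_norm_sub (P.gradX x₀ y₀) (P.gradX x₀ y)
      rw [norm_sub_rev] at h5
      linarith
    have e4 : ‖x - x₀‖ ≤ R₁ + R₁ := (norm_sub_le _ _).trans (add_le_add (hR₁ x hx) (hR₁ x₀ hx₀))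
    have e5 : |inner ℝ (P.gradX x₀ y) (x - x₀)| ≤
        (‖P.gradX x₀ y₀‖ + l * (R₂ + R₂)) * (R₁ + R₁) :=
      (abs_real_inner_le_norm _ _).trans (by gcongr)
    have e6 : l / 2 * ‖x - x₀‖ ^ 2 ≤ l / 2 * (R₁ + R₁) ^ 2 := by gcongr
    rw [abs_le] at e1 e2 e5 ⊢
    constructor <;> linarith
  · have e1 := P.A.le_of_opNorm_le_of_le le_rfl (hR₁ x hx)
    have e2 := P.B.le_of_opNorm_le_of_le le_rfl (hR₂ y hy)
    have e3 := norm_sub_le (P.A x + P.B y) P.c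
    have e4 := norm_add_le (P.A x) (P.B y)
    linarith

section

variable (h : P.Regular U V l) (hM : P.BoundedBy M) (k : ℕ)

include h hM

lemma abs_maxVal_le (hL : 0 < q.L) {x : Vec dx} (hx : x ∈ P.X) (lam : Vec p) :
    |P.maxVal q k x lam| ≤ M + ‖lam‖ * M + q.L / 2 * P.sigma ^ 2 := by
  have hy := h.argMax_mem q k hx lam
  rw [h.maxVal_eq q k hx]
  have h1 := hM.abs_g_le x hx _ hy
  have h2 : |inner ℝ lam (P.A x + P.B (P.argMax q k x lam) - P.c)| ≤ ‖lam‖ * M :=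
    (abs_real_inner_le_norm _ _).trans
      (mul_le_mul_of_nonneg_left (hM.residual_le x hx _ hy) (norm_nonneg _))
  have h3 := sq_norm_le_sigma h.Y_comp hy
  have h4 : q.rho k / 2 * ‖P.argMax q k x lam‖ ^ 2 ≤ q.L / 2 * P.sigma ^ 2 := by
    have := Params.Admissible.rho_le hL k
    gcongr
  have h5 : 0 ≤ q.rho k / 2 * ‖P.argMax q k x lam‖ ^ 2 := by
    have := Params.Admissible.rho_pos hL k
    positivity
  unfold lagReg lag
  rw [abs_le] at h1 h2 ⊢
  constructor <;> linarith

/-- Evaluating at a `y` feasible for the coupled constraint makes the multiplier term favourable, so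
the bound does not depend on `λ`. -/
lemma le_maxVal (hL : 0 < q.L)
    (hfeas : ∀ x ∈ P.X, ∃ y ∈ P.Y, P.rel.holds (P.A x + P.B y) P.c) {x : Vec dx} (hx : x ∈ P.X)
    {lam : Vec p} (hlam : lam ∈ P.Lam) : -M - q.L / 2 * P.sigma ^ 2 ≤ P.maxVal q k x lam := by
  obtain ⟨y, hy, hr⟩ := hfeas x hx
  have h1 := (abs_le.1 (hM.abs_g_le x hx y hy)).1
  have h2 := inner_multiplier_nonpos hlam hr
  have h3 := sq_norm_le_sigma h.Y_comp hy
  have h4 : q.rho k / 2 * ‖y‖ ^ 2 ≤ q.L / 2 * P.sigma ^ 2 := by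
    have := Params.Admissible.rho_le hL k
    gcongr
  have h5 : P.lagReg q k x y lam ≤ P.lagReg q k x (P.argMax q k x lam) lam :=
    (h.argMax_spec q k hx lam).2 hy
  rw [h.maxVal_eq q k hx]
  unfold lagReg lag at *
  linarith

omit hM in
lemma sq_norm_sub_argMax_le {x : Vec dx} {y : Vec dy} (hx : x ∈ P.X) (hy : y ∈ P.Y)
    (lam : Vec p) : ‖y - P.argMax q k x lam‖ ^ 2 ≤ 4 * P.sigma ^ 2 := by
  have h1 := norm_le_sigma h.Y_comp hy
  have h2 := norm_le_sigma h.Y_comp (h.argMax_mem q k hx lam)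
  have h3 : ‖y - P.argMax q k x lam‖ ≤ 2 * P.sigma := by
    linarith [norm_sub_le y (P.argMax q k x lam)]
  calc _ ≤ (2 * P.sigma) ^ 2 := by gcongr
    _ = _ := by ring

end

/-! ### The iterates -/

section Iter

variable {x₁ : Vec dx} {y₁ : Vec dy} {lam₁ : Vec p}

lemma iter_one (I : ℕ → Fin q.b → Ξ) :
    P.iter q ε x₁ y₁ lam₁ I 1 = P.start q ε x₁ y₁ lam₁ I := by
  simp [iter]

lemma iter_succ (I : ℕ → Fin q.b → Ξ) {k : ℕ} (hk : 1 ≤ k) :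
    P.iter q ε x₁ y₁ lam₁ I (k + 1) = P.step q ε I k (P.iter q ε x₁ y₁ lam₁ I k) := by
  rw [iter, if_neg (by omega)]

lemma feasible_iter (h : P.Regular U V l) (hx₁ : x₁ ∈ P.X) (hy₁ : y₁ ∈ P.Y)
    (hlam₁ : lam₁ ∈ P.Lam) (I : ℕ → Fin q.b → Ξ) {k : ℕ} (hk : 1 ≤ k) :
    P.Feasible (P.iter q ε x₁ y₁ lam₁ I k) := by
  induction k, hk using Nat.le_induction with
  | base =>
    rw [iter_one]
    exact ⟨hx₁, hy₁, hlam₁⟩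
  | succ k hk ih =>
    rw [iter_succ I hk]
    obtain ⟨e1, e2, e3⟩ := ih.next (q := q) (k := k) h
    exact ⟨e1, e2, e3⟩

/-- Linear growth is enough: the bound serves only the integrability at each fixed `k` and the
estimate of the potential at `k = 2`. -/
lemma norm_lam_iter_le (h : P.Regular U V l) (hq : q.Admissible ‖P.A‖ ‖P.B‖)
    (hM : P.BoundedBy M) (hx₁ : x₁ ∈ P.X) (hy₁ : y₁ ∈ P.Y) (hlam₁ : lam₁ ∈ P.Lam)
    (I : ℕ → Fin q.b → Ξ) {k : ℕ} (hk : 1 ≤ k) :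
    ‖(P.iter q ε x₁ y₁ lam₁ I k).lam‖ ≤ ‖lam₁‖ + k * (q.A₃ * M) := by
  have hA := hq.A₃_pos
  have hM0 := hM.nonneg
  induction k, hk using Nat.le_induction with
  | base =>
    rw [iter_one]
    have : 0 ≤ ((1 : ℕ) : ℝ) * (q.A₃ * M) := by positivity
    exact le_add_of_nonneg_right this
  | succ k hk ih =>
    have hs := feasible_iter (q := q) (ε := ε) h hx₁ hy₁ hlam₁ I hk
    rw [iter_succ I hk]
    set s := P.iter q ε x₁ y₁ lam₁ I k
    obtain ⟨e1, e2, e3⟩ := hs.next (q := q) (k := k) h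
    change ‖P.nextLam q k s‖ ≤ _
    have h1 : ‖P.stepLam q k s‖ ≤ q.A₃ * M := by
      have h2 := proj_nonexpansive P.Lam_ne P.lam_closed P.lam_conv
        (s.lam + q.gamma k • (P.A (P.nextX q k s) + P.B (P.nextY q k s) - P.c)) s.lam
      rw [proj_eq_self P.Lam_ne P.lam_closed P.lam_conv hs.lam_mem, add_sub_cancel_left, norm_smul,
        Real.norm_of_nonneg (hq.gamma_pos k).le] at h2
      exact h2.trans (mul_le_mul (hq.gamma_le k) (hM.residual_le _ e1 _ e2) (norm_nonneg _) hA.le)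
    have h2 : ‖P.nextLam q k s‖ ≤ ‖s.lam‖ + ‖P.stepLam q k s‖ := by
      refine (norm_add_le _ _).trans ?_
      rw [norm_smul, Real.norm_of_nonneg (Params.eta_pos k).le]
      have := mul_le_of_le_one_left (norm_nonneg (P.stepLam q k s)) (Params.eta_le_one k)
      linarith
    push_cast
    linarith

lemma meanEstX_sub_estX (hb : 0 < q.b) (k : ℕ) (x : Vec dx) (y : Vec dy) (lam : Vec p)
    (I : Fin q.b → Ξ) :
    P.meanEstX q ε k x y lam - P.estX q ε k x y lam I =
      (1 / (q.b : ℝ)) • ∑ j, (fdX P.g (q.thetaX dx ε k) x y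
        - fdX (fun x' y' => P.G x' y' (I j)) (q.thetaX dx ε k) x y) := by
  have hb' : (q.b : ℝ) ≠ 0 := by exact_mod_cast hb.ne'
  unfold meanEstX estX
  simp only [Finset.sum_sub_distrib, Finset.sum_const, Finset.card_univ, Fintype.card_fin,
    ← Nat.cast_smul_eq_nsmul ℝ, smul_sub, smul_smul]
  rw [one_div_mul_cancel hb', one_smul, one_smul]
  abel

lemma meanEstY_sub_estY (hb : 0 < q.b) (k : ℕ) (x : Vec dx) (y : Vec dy) (lam : Vec p)
    (I : Fin q.b → Ξ) :
    P.meanEstY q ε k x y lam - P.estY q ε k x y lam I =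
      (1 / (q.b : ℝ)) • ∑ j, (fdY P.g (q.thetaY dy ε k) x y
        - fdY (fun x' y' => P.G x' y' (I j)) (q.thetaY dy ε k) x y) := by
  have hb' : (q.b : ℝ) ≠ 0 := by exact_mod_cast hb.ne'
  unfold meanEstY estY
  simp only [Finset.sum_sub_distrib, Finset.sum_const, Finset.card_univ, Fintype.card_fin,
    ← Nat.cast_smul_eq_nsmul ℝ, smul_sub, smul_smul]
  rw [← mul_assoc, one_div_mul_cancel hb']
  simp only [one_smul, one_mul]
  abel

/-- The deviation of the sampled `x`-gradients in one iteration from their means, as it enters the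
recursive estimator. -/
noncomputable def innovX (P : Problem dx dy p Ξ) (q : Params) (ε : ℝ) (k : ℕ)
    (s : Iterate dx dy p) (ζ : Ξ) : Vec dx :=
  (fdX P.g (q.thetaX dx ε (k + 1)) (P.nextX q k s) (P.nextY q k s)
      - fdX (fun x y => P.G x y ζ) (q.thetaX dx ε (k + 1)) (P.nextX q k s) (P.nextY q k s))
    - (1 - q.momX k) • (fdX P.g (q.thetaX dx ε k) s.x s.y
      - fdX (fun x y => P.G x y ζ) (q.thetaX dx ε k) s.x s.y)

/-- The deviation of the sampled `y`-gradients in one iteration from their means, as it enters the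
recursive estimator. -/
noncomputable def innovY (P : Problem dx dy p Ξ) (q : Params) (ε : ℝ) (k : ℕ)
    (s : Iterate dx dy p) (ζ : Ξ) : Vec dy :=
  (fdY P.g (q.thetaY dy ε (k + 1)) (P.nextX q k s) (P.nextY q k s)
      - fdY (fun x y => P.G x y ζ) (q.thetaY dy ε (k + 1)) (P.nextX q k s) (P.nextY q k s))
    - (1 - q.momY k) • (fdY P.g (q.thetaY dy ε k) s.x s.y
      - fdY (fun x y => P.G x y ζ) (q.thetaY dy ε k) s.x s.y)

lemma errX_start (hb : 0 < q.b) (I : ℕ → Fin q.b → Ξ) :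
    P.errX q ε 1 (P.start q ε x₁ y₁ lam₁ I) =
      ‖(1 / (q.b : ℝ)) • ∑ j, (fdX P.g (q.thetaX dx ε 1) x₁ y₁
        - fdX (fun x y => P.G x y (I 1 j)) (q.thetaX dx ε 1) x₁ y₁)‖ ^ 2 := by
  rw [← meanEstX_sub_estX hb 1 x₁ y₁ lam₁]
  rfl

lemma errY_start (hb : 0 < q.b) (I : ℕ → Fin q.b → Ξ) :
    P.errY q ε 1 (P.start q ε x₁ y₁ lam₁ I) =
      ‖(1 / (q.b : ℝ)) • ∑ j, (fdY P.g (q.thetaY dy ε 1) x₁ y₁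
        - fdY (fun x y => P.G x y (I 1 j)) (q.thetaY dy ε 1) x₁ y₁)‖ ^ 2 := by
  rw [← meanEstY_sub_estY hb 1 x₁ y₁ lam₁]
  rfl

/-- In `meanEstX - estX` the multiplier cancels, so inserting the recursion for `v` leaves the old
error scaled by `1 - momX` plus the batch average of innovations. -/
lemma errX_step (hb : 0 < q.b) (I : ℕ → Fin q.b → Ξ) (k : ℕ) (s : Iterate dx dy p) :
    P.errX q ε (k + 1) (P.step q ε I k s) =
      ‖(1 - q.momX k) • (P.meanEstX q ε k s.x s.y s.lam - s.v)
        + (1 / (q.b : ℝ)) • ∑ j, P.innovX q ε k s (I (k + 1) j)‖ ^ 2 := by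
  have h1 := meanEstX_sub_estX (P := P) (ε := ε) hb (k + 1) (P.nextX q k s) (P.nextY q k s)
    (P.nextLam q k s) (I (k + 1))
  have h2 := meanEstX_sub_estX (P := P) (ε := ε) hb k s.x s.y s.lam (I (k + 1))
  have h3 : (P.step q ε I k s).v =
      P.estX q ε (k + 1) (P.nextX q k s) (P.nextY q k s) (P.nextLam q k s) (I (k + 1)) +
        (1 - q.momX k) • (s.v - P.estX q ε k s.x s.y s.lam (I (k + 1))) := rfl
  change ‖P.meanEstX q ε (k + 1) (P.nextX q k s) (P.nextY q k s) (P.nextLam q k s)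
    - (P.step q ε I k s).v‖ ^ 2 = _
  congr 2
  unfold innovX
  rw [Finset.sum_sub_distrib, ← Finset.smul_sum, smul_sub (1 / (q.b : ℝ)), smul_comm (1 / (q.b : ℝ)),
    ← h1, ← h2, h3]
  module

lemma errY_step (hb : 0 < q.b) (I : ℕ → Fin q.b → Ξ) (k : ℕ) (s : Iterate dx dy p) :
    P.errY q ε (k + 1) (P.step q ε I k s) =
      ‖(1 - q.momY k) • (P.meanEstY q ε k s.x s.y s.lam - s.w)
        + (1 / (q.b : ℝ)) • ∑ j, P.innovY q ε k s (I (k + 1) j)‖ ^ 2 := by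
  have h1 := meanEstY_sub_estY (P := P) (ε := ε) hb (k + 1) (P.nextX q k s) (P.nextY q k s)
    (P.nextLam q k s) (I (k + 1))
  have h2 := meanEstY_sub_estY (P := P) (ε := ε) hb k s.x s.y s.lam (I (k + 1))
  have h3 : (P.step q ε I k s).w =
      P.estY q ε (k + 1) (P.nextX q k s) (P.nextY q k s) (P.nextLam q k s) (I (k + 1)) +
        (1 - q.momY k) • (s.w - P.estY q ε k s.x s.y s.lam (I (k + 1))) := rfl
  change ‖P.meanEstY q ε (k + 1) (P.nextX q k s) (P.nextY q k s) (P.nextLam q k s)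
    - (P.step q ε I k s).w‖ ^ 2 = _
  congr 2
  unfold innovY
  rw [Finset.sum_sub_distrib, ← Finset.smul_sum, smul_sub (1 / (q.b : ℝ)), smul_comm (1 / (q.b : ℝ)),
    ← h1, ← h2, h3]
  module

end Iter

end Problem

end ZORMPDPG

namespace ZORMPDPG

namespace Problem

variable {dx dy p : ℕ} {Ξ : Type*} [MeasurableSpace Ξ]

/-! ### Expected descent along the random iterates -/

/-- The assumptions on the problem, the parameters and the samples, together with those on the
accuracy `ε`. -/
structure Run (P : Problem dx dy p Ξ) (q : Params) (U : Set (Vec dx)) (V : Set (Vec dy))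
    (l δ ε : ℝ) (x₁ : Vec dx) (y₁ : Vec dy) (lam₁ : Vec p) {Ω : Type*} [MeasurableSpace Ω]
    (μ : Measure Ω) (ζ : ℕ → Fin q.b → Ω → Ξ) : Prop where
  reg : P.Regular U V l
  adm : q.Admissible ‖P.A‖ ‖P.B‖
  scaled : P.Scaled q l
  prob : IsProbabilityMeasure P.D
  isOpen_U : IsOpen U
  isOpen_V : IsOpen V
  meas : Measurable (fun z : (Vec dx × Vec dy) × Ξ => P.G z.1.1 z.1.2 z.2)
  int : ∀ x ∈ U, ∀ y ∈ V, Integrable (P.G x y) P.D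
  smooth : P.SmoothOn U V l
  x₁_mem : x₁ ∈ P.X
  y₁_mem : y₁ ∈ P.Y
  lam₁_mem : lam₁ ∈ P.Lam
  ζ_meas : ∀ k j, Measurable (ζ k j)
  ζ_law : ∀ k j, μ.map (ζ k j) = P.D
  ζ_indep : iIndepFun (fun i : ℕ × Fin q.b => ζ i.1 i.2) μ
  ε_pos : 0 < ε
  stencil : P.StencilIn q ε U V
  variance : P.VarianceBound q ε δ

lemma randIter_succ {P : Problem dx dy p Ξ} {q : Params} {Ω : Type*} [MeasurableSpace Ω] {ε : ℝ}
    {x₁ : Vec dx} {y₁ : Vec dy} {lam₁ : Vec p} {ζ : ℕ → Fin q.b → Ω → Ξ} {k : ℕ} (hk : 1 ≤ k)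
    (ω : Ω) : P.randIter q ε x₁ y₁ lam₁ ζ (k + 1) ω =
      P.step q ε (fun n j => ζ n j ω) k (P.randIter q ε x₁ y₁ lam₁ ζ k ω) :=
  iter_succ _ hk

namespace Run

variable {P : Problem dx dy p Ξ} {q : Params} {U : Set (Vec dx)} {V : Set (Vec dy)} {l δ ε : ℝ}
  {x₁ : Vec dx} {y₁ : Vec dy} {lam₁ : Vec p} {Ω : Type*} [mΩ : MeasurableSpace Ω] {μ : Measure Ω}
  [IsProbabilityMeasure μ] {ζ : ℕ → Fin q.b → Ω → Ξ}

variable (r : P.Run q U V l δ ε x₁ y₁ lam₁ μ ζ) {k : ℕ} (hk : 1 ≤ k)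

include r

omit [IsProbabilityMeasure μ]

lemma iIndepFun_batch (k : ℕ) : iIndepFun (ζ k) μ :=
  r.ζ_indep.precomp (g := fun j : Fin q.b => (k, j)) fun _ _ hij => (Prod.ext_iff.1 hij).2

include hk

lemma feasible (ω : Ω) : P.Feasible (P.randIter q ε x₁ y₁ lam₁ ζ k ω) :=
  feasible_iter r.reg r.x₁_mem r.y₁_mem r.lam₁_mem _ hk

lemma measurable_randIter : Measurable (P.randIter q ε x₁ y₁ lam₁ ζ k) :=
  measurable_iter r.reg r.meas ε x₁ y₁ lam₁ k hk fun n _ j => r.ζ_meas n j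

/-- The current state is independent of the next mini-batch. -/
lemma indepFun_batch :
    IndepFun (P.randIter q ε x₁ y₁ lam₁ ζ k) (fun ω j => ζ (k + 1) j ω) μ := by
  set m : ℕ × Fin q.b → MeasurableSpace Ω := fun i => MeasurableSpace.comap (ζ i.1 i.2) inferInstance
  have hle : ∀ i, m i ≤ mΩ := fun i => (r.ζ_meas i.1 i.2).comap_le
  have hdisj : Disjoint {i : ℕ × Fin q.b | i.1 ≤ k} {i | i.1 = k + 1} := by
    rw [Set.disjoint_left]
    intro i hi hi'
    simp only [Set.mem_ofPred_eq] at hi hi'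
    omega
  have hind := indep_iSup_of_disjoint hle r.ζ_indep.iIndep hdisj
  -- `measurable_iter` is applied again, now with `Ω` carrying the σ-algebra of the samples up to
  -- batch `k`; this is why it asks for measurability of those samples only.
  have hpast : Measurable[⨆ i ∈ {i : ℕ × Fin q.b | i.1 ≤ k}, m i]
      (fun ω => P.iter q ε x₁ y₁ lam₁ (fun n j => ζ n j ω) k) := by
    have hreg := r.reg
    have hmeas := r.meas
    let _ : MeasurableSpace Ω := ⨆ i ∈ {i : ℕ × Fin q.b | i.1 ≤ k}, m i
    refine measurable_iter hreg hmeas ε x₁ y₁ lam₁ k hk fun n hn j => ?_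
    exact Measurable.of_comap_le (le_iSup₂_of_le (n, j) hn le_rfl)
  have hnext : Measurable[⨆ i ∈ {i : ℕ × Fin q.b | i.1 = k + 1}, m i]
      (fun ω j => ζ (k + 1) j ω) := by
    let _ : MeasurableSpace Ω := ⨆ i ∈ {i : ℕ × Fin q.b | i.1 = k + 1}, m i
    refine measurable_pi_lambda _ fun j => ?_
    exact Measurable.of_comap_le (le_iSup₂_of_le (k + 1, j) rfl le_rfl)
  exact indep_of_indep_of_le_left (indep_of_indep_of_le_right hind hnext.comap_le) hpast.comap_le

omit r hk

end Run

end Problem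

end ZORMPDPG

/-! ### Mean-square recursion of the estimator errors. -/

namespace ZORMPDPG

namespace Problem

variable {dx dy p : ℕ} {Ξ : Type*} [MeasurableSpace Ξ]

namespace Run

variable {P : Problem dx dy p Ξ} {q : Params} {U : Set (Vec dx)} {V : Set (Vec dy)} {l δ ε : ℝ}
  {x₁ : Vec dx} {y₁ : Vec dy} {lam₁ : Vec p} {Ω : Type*} [mΩ : MeasurableSpace Ω] {μ : Measure Ω}
  {ζ : ℕ → Fin q.b → Ω → Ξ}

variable (r : P.Run q U V l δ ε x₁ y₁ lam₁ μ ζ) {k : ℕ} (hk : 1 ≤ k)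

include r hk

lemma integral_fdX {x : Vec dx} {y : Vec dy} (hx : x ∈ P.X) (hy : y ∈ P.Y) :
    Integrable (fun z => fdX (fun x y => P.G x y z) (q.thetaX dx ε k) x y) P.D ∧
      ∫ z, fdX (fun x y => P.G x y z) (q.thetaX dx ε k) x y ∂P.D =
        fdX P.g (q.thetaX dx ε k) x y :=
  fd_integral (U := U) (F := fun x z => P.G x y z) (fun x hx => r.int x hx y (r.reg.Y_sub hy))
    (r.reg.X_sub hx) fun i => r.stencil.x_mem r.scaled.L_pos r.ε_pos hk hx i
      ⟨Params.Admissible.thetaX_nonneg r.scaled.L_pos dx r.ε_pos k, le_rfl⟩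

lemma integral_fdY {x : Vec dx} {y : Vec dy} (hx : x ∈ P.X) (hy : y ∈ P.Y) :
    Integrable (fun z => fdY (fun x y => P.G x y z) (q.thetaY dy ε k) x y) P.D ∧
      ∫ z, fdY (fun x y => P.G x y z) (q.thetaY dy ε k) x y ∂P.D =
        fdY P.g (q.thetaY dy ε k) x y :=
  fd_integral (U := V) (F := fun y z => P.G x y z) (fun y hy => r.int x (r.reg.X_sub hx) y hy)
    (r.reg.Y_sub hy) fun i => r.stencil.y_mem r.scaled.L_pos r.ε_pos hk hy i
      ⟨Params.Admissible.thetaY_nonneg r.scaled.L_pos dy r.ε_pos k, le_rfl⟩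

/-- The state is frozen: for each feasible `s` the innovation is centred, and its second moment is
bounded by `b` times `noiseX`, whose denominator records the averaging. -/
lemma lintegral_innovX {s : Iterate dx dy p} (hs : P.Feasible s) :
    ∫ z, P.innovX q ε k s z ∂P.D = 0 ∧
      ∫⁻ z, ‖P.innovX q ε k s z‖ₑ ^ 2 ∂P.D ≤ ENNReal.ofReal (q.b * P.noiseX q ε δ k s) := by
  have := r.prob
  obtain ⟨hx', hy', -⟩ := hs.next (q := q) (k := k) r.reg
  obtain ⟨i1, e1⟩ := r.integral_fdX hk hs.x_mem hs.y_mem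
  obtain ⟨i2, e2⟩ := r.integral_fdX (k := k + 1) (by omega) hx' hy'
  have hb : (q.b : ℝ) ≠ 0 := r.adm.b_pos'.ne'
  constructor
  · have j1 : Integrable (fun z => (1 - q.momX k) • (fdX P.g (q.thetaX dx ε k) s.x s.y
        - fdX (fun x y => P.G x y z) (q.thetaX dx ε k) s.x s.y)) P.D :=
      ((integrable_const _).sub i1).smul (1 - q.momX k)
    have j2 : Integrable (fun z => fdX P.g (q.thetaX dx ε (k + 1)) (P.nextX q k s) (P.nextY q k s)
        - fdX (fun x y => P.G x y z) (q.thetaX dx ε (k + 1))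
        (P.nextX q k s) (P.nextY q k s)) P.D :=
      (integrable_const _).sub i2
    unfold innovX
    rw [integral_sub j2 j1, integral_smul, integral_sub (integrable_const _) i1,
      integral_sub (integrable_const _) i2, e1, e2]
    simp
  · have h1 := lintegral_momentum_sq_le i1 i2 (r.adm.momX_nonneg k) (r.adm.momX_le k hk)
      (δ := δ) (C := 2 * (dx * q.L ^ 2 * q.thetaX dx ε k ^ 2)
        + 4 * q.L ^ 2 * (‖P.nextX q k s - s.x‖ ^ 2 + ‖P.nextY q k s - s.y‖ ^ 2)) (by positivity)
      (by rw [e2]; exact (r.variance (k + 1) (by omega) _ hx' _ hy').1)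
      (fun z => norm_fdX_sample_sub_sq_le r.adm r.scaled r.ε_pos r.stencil r.reg.l_pos r.isOpen_U
        r.isOpen_V r.reg.X_sub r.reg.Y_sub r.smooth hk hs.x_mem hx' hs.y_mem hy' z)
    rw [e1, e2] at h1
    refine h1.trans_eq ?_
    unfold noiseX
    congr 1
    field_simp

lemma lintegral_innovY {s : Iterate dx dy p} (hs : P.Feasible s) :
    ∫ z, P.innovY q ε k s z ∂P.D = 0 ∧
      ∫⁻ z, ‖P.innovY q ε k s z‖ₑ ^ 2 ∂P.D ≤ ENNReal.ofReal (q.b * P.noiseY q ε δ k s) := by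
  have := r.prob
  obtain ⟨hx', hy', -⟩ := hs.next (q := q) (k := k) r.reg
  obtain ⟨i1, e1⟩ := r.integral_fdY hk hs.x_mem hs.y_mem
  obtain ⟨i2, e2⟩ := r.integral_fdY (k := k + 1) (by omega) hx' hy'
  have hb : (q.b : ℝ) ≠ 0 := r.adm.b_pos'.ne'
  constructor
  · have j1 : Integrable (fun z => (1 - q.momY k) • (fdY P.g (q.thetaY dy ε k) s.x s.y
        - fdY (fun x y => P.G x y z) (q.thetaY dy ε k) s.x s.y)) P.D :=
      ((integrable_const _).sub i1).smul (1 - q.momY k)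
    have j2 : Integrable (fun z => fdY P.g (q.thetaY dy ε (k + 1)) (P.nextX q k s) (P.nextY q k s)
        - fdY (fun x y => P.G x y z) (q.thetaY dy ε (k + 1))
        (P.nextX q k s) (P.nextY q k s)) P.D :=
      (integrable_const _).sub i2
    unfold innovY
    rw [integral_sub j2 j1, integral_smul, integral_sub (integrable_const _) i1,
      integral_sub (integrable_const _) i2, e1, e2]
    simp
  · have h1 := lintegral_momentum_sq_le i1 i2 (r.adm.momY_nonneg k) (r.adm.momY_le k hk)
      (δ := δ) (C := 2 * (dy * q.L ^ 2 * q.thetaY dy ε k ^ 2)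
        + 4 * q.L ^ 2 * (‖P.nextX q k s - s.x‖ ^ 2 + ‖P.nextY q k s - s.y‖ ^ 2)) (by positivity)
      (by rw [e2]; exact (r.variance (k + 1) (by omega) _ hx' _ hy').2)
      (fun z => norm_fdY_sample_sub_sq_le r.adm r.scaled r.ε_pos r.stencil r.reg.l_pos r.isOpen_U
        r.isOpen_V r.reg.X_sub r.reg.Y_sub r.smooth hk hs.x_mem hx' hs.y_mem hy' z)
    rw [e1, e2] at h1
    refine h1.trans_eq ?_
    unfold noiseY
    congr 1
    field_simp

omit hk in
lemma measurable_innovX : Measurable fun z : Iterate dx dy p × Ξ => P.innovX q ε k z.1 z.2 := by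
  have := r.prob
  have hs : Measurable (Prod.fst : Iterate dx dy p × Ξ → Iterate dx dy p) := measurable_fst
  have hζ : Measurable (Prod.snd : Iterate dx dy p × Ξ → Ξ) := measurable_snd
  have hx := Iterate.measurable_x.comp hs
  have hy := Iterate.measurable_y.comp hs
  have hx' := (measurable_nextX (q := q) r.reg k).comp hs
  have hy' := (measurable_nextY (q := q) r.reg k).comp hs
  unfold innovX
  exact ((measurable_fdX_g r.meas _ hx' hy').sub (measurable_fdX_G r.meas _ hx' hy' hζ)).sub
    (((measurable_fdX_g r.meas _ hx hy).sub
      (measurable_fdX_G r.meas _ hx hy hζ)).const_smul (1 - q.momX k))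

omit hk in
lemma measurable_innovY : Measurable fun z : Iterate dx dy p × Ξ => P.innovY q ε k z.1 z.2 := by
  have := r.prob
  have hs : Measurable (Prod.fst : Iterate dx dy p × Ξ → Iterate dx dy p) := measurable_fst
  have hζ : Measurable (Prod.snd : Iterate dx dy p × Ξ → Ξ) := measurable_snd
  have hx := Iterate.measurable_x.comp hs
  have hy := Iterate.measurable_y.comp hs
  have hx' := (measurable_nextX (q := q) r.reg k).comp hs
  have hy' := (measurable_nextY (q := q) r.reg k).comp hs
  unfold innovY
  exact ((measurable_fdY_g r.meas _ hx' hy').sub (measurable_fdY_G r.meas _ hx' hy' hζ)).sub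
    (((measurable_fdY_g r.meas _ hx hy).sub
      (measurable_fdY_G r.meas _ hx hy hζ)).const_smul (1 - q.momY k))

omit hk in
lemma measurable_errVecX :
    Measurable fun s : Iterate dx dy p => P.meanEstX q ε k s.x s.y s.lam - s.v := by
  have := r.prob
  exact (measurable_meanEstX r.meas ε k Iterate.measurable_x Iterate.measurable_y
    Iterate.measurable_lam).sub Iterate.measurable_v

omit hk in
lemma measurable_errVecY :
    Measurable fun s : Iterate dx dy p => P.meanEstY q ε k s.x s.y s.lam - s.w := by
  have := r.prob
  exact (measurable_meanEstY r.meas ε k Iterate.measurable_x Iterate.measurable_y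
    Iterate.measurable_lam).sub Iterate.measurable_w

lemma measurable_errX : Measurable fun ω => P.errX q ε k (P.randIter q ε x₁ y₁ lam₁ ζ k ω) :=
  ((r.measurable_errVecX.comp (r.measurable_randIter hk)).norm).pow_const 2

lemma measurable_errY : Measurable fun ω => P.errY q ε k (P.randIter q ε x₁ y₁ lam₁ ζ k ω) :=
  ((r.measurable_errVecY.comp (r.measurable_randIter hk)).norm).pow_const 2

omit hk in
lemma noiseX_nonneg (s : Iterate dx dy p) : 0 ≤ P.noiseX q ε δ k s := by
  have := r.adm.b_pos'
  unfold noiseX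
  positivity

omit hk in
lemma noiseY_nonneg (s : Iterate dx dy p) : 0 ≤ P.noiseY q ε δ k s := by
  have := r.adm.b_pos'
  unfold noiseY
  positivity

variable [IsProbabilityMeasure μ]

/-- Kept in `ENNReal`, since integrability of the errors is only obtained from it, by induction in
`integrable_errX`. -/
lemma lintegral_errX_succ :
    ∫⁻ ω, ENNReal.ofReal (P.errX q ε (k + 1) (P.randIter q ε x₁ y₁ lam₁ ζ (k + 1) ω)) ∂μ ≤
      ∫⁻ ω, ENNReal.ofReal ((1 - q.momX k) ^ 2 * P.errX q ε k (P.randIter q ε x₁ y₁ lam₁ ζ k ω)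
        + P.noiseX q ε δ k (P.randIter q ε x₁ y₁ lam₁ ζ k ω)) ∂μ := by
  have := r.prob
  have hb : (q.b : ℝ) ≠ 0 := r.adm.b_pos'.ne'
  have hm := lintegral_average_le r.adm.b_pos (r.measurable_randIter hk)
    (fun j => r.ζ_meas (k + 1) j) (fun j => r.ζ_law (k + 1) j) (r.iIndepFun_batch (k + 1))
    (r.indepFun_batch hk)
    (a := fun s => (1 - q.momX k) • (P.meanEstX q ε k s.x s.y s.lam - s.v))
    (r.measurable_errVecX.const_smul (1 - q.momX k))
    (r.measurable_innovX (k := k))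
    (C := fun ω => q.b * P.noiseX q ε δ k (P.randIter q ε x₁ y₁ lam₁ ζ k ω))
    (fun ω => mul_nonneg r.adm.b_pos'.le (r.noiseX_nonneg _))
    (fun ω => (r.lintegral_innovX hk (r.feasible hk ω)).1)
    (fun ω => (r.lintegral_innovX hk (r.feasible hk ω)).2)
  simp only [randIter_succ hk, errX_step r.adm.b_pos]
  simp only [enorm_sq_eq_ofReal] at hm
  refine hm.trans_eq ?_
  congr 1
  funext ω
  congr 1
  unfold errX
  rw [norm_smul, mul_pow, Real.norm_eq_abs, sq_abs, mul_div_cancel_left₀ _ hb]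

lemma lintegral_errY_succ :
    ∫⁻ ω, ENNReal.ofReal (P.errY q ε (k + 1) (P.randIter q ε x₁ y₁ lam₁ ζ (k + 1) ω)) ∂μ ≤
      ∫⁻ ω, ENNReal.ofReal ((1 - q.momY k) ^ 2 * P.errY q ε k (P.randIter q ε x₁ y₁ lam₁ ζ k ω)
        + P.noiseY q ε δ k (P.randIter q ε x₁ y₁ lam₁ ζ k ω)) ∂μ := by
  have := r.prob
  have hb : (q.b : ℝ) ≠ 0 := r.adm.b_pos'.ne'
  have hm := lintegral_average_le r.adm.b_pos (r.measurable_randIter hk)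
    (fun j => r.ζ_meas (k + 1) j) (fun j => r.ζ_law (k + 1) j) (r.iIndepFun_batch (k + 1))
    (r.indepFun_batch hk)
    (a := fun s => (1 - q.momY k) • (P.meanEstY q ε k s.x s.y s.lam - s.w))
    (r.measurable_errVecY.const_smul (1 - q.momY k))
    (r.measurable_innovY (k := k))
    (C := fun ω => q.b * P.noiseY q ε δ k (P.randIter q ε x₁ y₁ lam₁ ζ k ω))
    (fun ω => mul_nonneg r.adm.b_pos'.le (r.noiseY_nonneg _))
    (fun ω => (r.lintegral_innovY hk (r.feasible hk ω)).1)
    (fun ω => (r.lintegral_innovY hk (r.feasible hk ω)).2)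
  simp only [randIter_succ hk, errY_step r.adm.b_pos]
  simp only [enorm_sq_eq_ofReal] at hm
  refine hm.trans_eq ?_
  congr 1
  funext ω
  congr 1
  unfold errY
  rw [norm_smul, mul_pow, Real.norm_eq_abs, sq_abs, mul_div_cancel_left₀ _ hb]

omit hk

lemma integral_errX_one :
    Integrable (fun ω => P.errX q ε 1 (P.randIter q ε x₁ y₁ lam₁ ζ 1 ω)) μ ∧
      ∫ ω, P.errX q ε 1 (P.randIter q ε x₁ y₁ lam₁ ζ 1 ω) ∂μ ≤ δ ^ 2 / q.b := by
  have := r.prob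
  have hb := r.adm.b_pos'
  obtain ⟨i1, e1⟩ := r.integral_fdX le_rfl r.x₁_mem r.y₁_mem
  -- The first estimator has no past: the state is trivial, the offset is zero, and only the
  -- variance of one batch remains.
  have hm := lintegral_average_le r.adm.b_pos (w := fun _ : Ω => ()) measurable_const
    (fun j => r.ζ_meas 1 j) (fun j => r.ζ_law 1 j) (r.iIndepFun_batch 1)
    (indepFun_const_left () _) (a := fun _ => (0 : Vec dx)) measurable_const
    (ξ := fun _ z => fdX P.g (q.thetaX dx ε 1) x₁ y₁
      - fdX (fun x y => P.G x y z) (q.thetaX dx ε 1) x₁ y₁)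
    (measurable_const.sub (measurable_fdX_G r.meas _ measurable_const measurable_const
      measurable_snd))
    (C := fun _ => δ ^ 2) (fun _ => sq_nonneg _)
    (fun _ => by rw [integral_sub (integrable_const _) i1, e1]; simp)
    (fun _ => by
      simp only [← enorm_neg (fdX P.g _ _ _ - _), neg_sub]
      exact (r.variance 1 le_rfl _ r.x₁_mem _ r.y₁_mem).1)
  simp only [enorm_sq_eq_ofReal, zero_add, norm_zero] at hm
  have e2 : ∀ ω, P.randIter q ε x₁ y₁ lam₁ ζ 1 ω = P.start q ε x₁ y₁ lam₁ fun n j => ζ n j ω :=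
    fun ω => iter_one _
  have := integrable_of_lintegral_le (r.measurable_errX le_rfl) (fun _ => sq_nonneg _)
    (integrable_const (δ ^ 2 / (q.b : ℝ)) (μ := μ)) (fun _ => by positivity)
    (by
      simp only [e2, errX_start r.adm.b_pos]
      simpa using hm)
  simpa using this

lemma integral_errY_one :
    Integrable (fun ω => P.errY q ε 1 (P.randIter q ε x₁ y₁ lam₁ ζ 1 ω)) μ ∧
      ∫ ω, P.errY q ε 1 (P.randIter q ε x₁ y₁ lam₁ ζ 1 ω) ∂μ ≤ δ ^ 2 / q.b := by
  have := r.prob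
  have hb := r.adm.b_pos'
  obtain ⟨i1, e1⟩ := r.integral_fdY le_rfl r.x₁_mem r.y₁_mem
  have hm := lintegral_average_le r.adm.b_pos (w := fun _ : Ω => ()) measurable_const
    (fun j => r.ζ_meas 1 j) (fun j => r.ζ_law 1 j) (r.iIndepFun_batch 1)
    (indepFun_const_left () _) (a := fun _ => (0 : Vec dy)) measurable_const
    (ξ := fun _ z => fdY P.g (q.thetaY dy ε 1) x₁ y₁
      - fdY (fun x y => P.G x y z) (q.thetaY dy ε 1) x₁ y₁)
    (measurable_const.sub (measurable_fdY_G r.meas _ measurable_const measurable_const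
      measurable_snd))
    (C := fun _ => δ ^ 2) (fun _ => sq_nonneg _)
    (fun _ => by rw [integral_sub (integrable_const _) i1, e1]; simp)
    (fun _ => by
      simp only [← enorm_neg (fdY P.g _ _ _ - _), neg_sub]
      exact (r.variance 1 le_rfl _ r.x₁_mem _ r.y₁_mem).2)
  simp only [enorm_sq_eq_ofReal, zero_add, norm_zero] at hm
  have e2 : ∀ ω, P.randIter q ε x₁ y₁ lam₁ ζ 1 ω = P.start q ε x₁ y₁ lam₁ fun n j => ζ n j ω :=
    fun ω => iter_one _
  have := integrable_of_lintegral_le (r.measurable_errY le_rfl) (fun _ => sq_nonneg _)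
    (integrable_const (δ ^ 2 / (q.b : ℝ)) (μ := μ)) (fun _ => by positivity)
    (by
      simp only [e2, errY_start r.adm.b_pos]
      simpa using hm)
  simpa using this

end Run

end Problem

end ZORMPDPG

/-! ### Integrability of the potential and bounds of its expected parts. -/

namespace ZORMPDPG

lemma integrable_of_bounded {Ω : Type*} [MeasurableSpace Ω] {μ : Measure Ω} [IsFiniteMeasure μ]
    {f : Ω → ℝ} (hf : Measurable f) {C : ℝ} (hC : ∀ ω, |f ω| ≤ C) : Integrable f μ :=
  Integrable.of_bound hf.aestronglyMeasurable C (ae_of_all _ hC)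

namespace Problem

variable {dx dy p : ℕ} {Ξ : Type*} [MeasurableSpace Ξ]

section Expectations

variable (P : Problem dx dy p Ξ) (q : Params) {Ω : Type*} [MeasurableSpace Ω] (μ : Measure Ω)
  (ε : ℝ) (x₁ : Vec dx) (y₁ : Vec dy) (lam₁ : Vec p) (ζ : ℕ → Fin q.b → Ω → Ξ) (k : ℕ)

/-- The part of the potential that decreases along the iteration. -/
noncomputable def core (s : Iterate dx dy p) : ℝ :=
  P.primal q k s.x s.y s.lam + q.weightX (k - 1) * P.errX q ε k s
    + q.weightY (k - 1) * P.errY q ε k s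

/-- The expectation of the core of the potential. -/
noncomputable def meanCore : ℝ := ∫ ω, P.core q ε k (P.randIter q ε x₁ y₁ lam₁ ζ k ω) ∂μ

/-- The expectation of `‖y_k^*‖²`. -/
noncomputable def meanArgSq : ℝ :=
  ∫ ω, ‖P.argMax q k (P.randIter q ε x₁ y₁ lam₁ ζ k ω).x
    (P.randIter q ε x₁ y₁ lam₁ ζ k ω).lam‖ ^ 2 ∂μ

/-- The expectation of `‖y_k - y_k^*‖²`. -/
noncomputable def meanDistSq : ℝ :=
  ∫ ω, ‖(P.randIter q ε x₁ y₁ lam₁ ζ k ω).y - P.argMax q k (P.randIter q ε x₁ y₁ lam₁ ζ k ω).x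
    (P.randIter q ε x₁ y₁ lam₁ ζ k ω).lam‖ ^ 2 ∂μ

end Expectations

/-- Separates the decreasing core from the corrections of `S_k`; the term in `‖y*‖²` among them is
the boundary term of the summation by parts in `sum_descent`. -/
lemma potential_eq (P : Problem dx dy p Ξ) (q : Params) (ε : ℝ) (k : ℕ)
    (s : Iterate dx dy p) :
    P.potential q ε k s = P.core q ε k s
      - 4 * Params.eta (k - 1) * q.alpha (k - 1) * q.L ^ 2 * ‖s.y - P.argMax q k s.x s.lam‖ ^ 2
      - argCoeff q k * ‖P.argMax q k s.x s.lam‖ ^ 2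
      + 12 * q.weightY k * q.rho k ^ 2 * P.sigma ^ 2 / q.b := by
  unfold potential core primal errX errY argCoeff
  ring

namespace Run

variable {P : Problem dx dy p Ξ} {q : Params} {U : Set (Vec dx)} {V : Set (Vec dy)} {l δ ε : ℝ}
  {x₁ : Vec dx} {y₁ : Vec dy} {lam₁ : Vec p} {Ω : Type*} [mΩ : MeasurableSpace Ω] {μ : Measure Ω}
  [IsProbabilityMeasure μ] {ζ : ℕ → Fin q.b → Ω → Ξ}

variable (r : P.Run q U V l δ ε x₁ y₁ lam₁ μ ζ) {k : ℕ} (hk : 1 ≤ k)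

include r hk

lemma integrable_stepSq :
    Integrable (fun ω => ‖P.nextX q k (P.randIter q ε x₁ y₁ lam₁ ζ k ω)
        - (P.randIter q ε x₁ y₁ lam₁ ζ k ω).x‖ ^ 2
      + ‖P.nextY q k (P.randIter q ε x₁ y₁ lam₁ ζ k ω)
        - (P.randIter q ε x₁ y₁ lam₁ ζ k ω).y‖ ^ 2) μ := by
  obtain ⟨M, hM⟩ := r.reg.exists_boundedBy
  have hs := r.measurable_randIter hk
  have m1 := ((((measurable_nextX (q := q) r.reg k).comp hs).sub
    (Iterate.measurable_x.comp hs)).norm).pow_const 2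
  have m2 := ((((measurable_nextY (q := q) r.reg k).comp hs).sub
    (Iterate.measurable_y.comp hs)).norm).pow_const 2
  refine integrable_of_bounded (m1.add m2) (C := (M + M) ^ 2 + (M + M) ^ 2) fun ω => ?_
  have hf := r.feasible hk ω
  obtain ⟨hx, hy, -⟩ := hf.next (q := q) (k := k) r.reg
  rw [abs_of_nonneg (by positivity)]
  refine add_le_add (pow_le_pow_left₀ (norm_nonneg _) ?_ 2) (pow_le_pow_left₀ (norm_nonneg _) ?_ 2)
  · exact (norm_sub_le _ _).trans (add_le_add (hM.norm_x_le _ hx) (hM.norm_x_le _ hf.x_mem))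
  · exact (norm_sub_le _ _).trans (add_le_add (hM.norm_y_le _ hy) (hM.norm_y_le _ hf.y_mem))

lemma integrable_noiseX :
    Integrable (fun ω => P.noiseX q ε δ k (P.randIter q ε x₁ y₁ lam₁ ζ k ω)) μ := by
  unfold noiseX
  exact ((integrable_const _).add (((integrable_const _).add
    ((r.integrable_stepSq hk).const_mul (4 * q.L ^ 2))).const_mul 2)).div_const _

lemma integrable_noiseY :
    Integrable (fun ω => P.noiseY q ε δ k (P.randIter q ε x₁ y₁ lam₁ ζ k ω)) μ := by
  unfold noiseY
  exact ((integrable_const _).add (((integrable_const _).add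
    ((r.integrable_stepSq hk).const_mul (4 * q.L ^ 2))).const_mul 2)).div_const _

lemma integrable_errX :
    Integrable (fun ω => P.errX q ε k (P.randIter q ε x₁ y₁ lam₁ ζ k ω)) μ := by
  induction k, hk using Nat.le_induction with
  | base => exact r.integral_errX_one.1
  | succ k hk ih =>
    exact (integrable_of_lintegral_le (r.measurable_errX (by omega)) (fun _ => sq_nonneg _)
      ((ih.const_mul ((1 - q.momX k) ^ 2)).add (r.integrable_noiseX hk))
      (fun ω => add_nonneg (mul_nonneg (sq_nonneg _) (sq_nonneg _)) (r.noiseX_nonneg _))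
      (r.lintegral_errX_succ hk)).1

lemma integrable_errY :
    Integrable (fun ω => P.errY q ε k (P.randIter q ε x₁ y₁ lam₁ ζ k ω)) μ := by
  induction k, hk using Nat.le_induction with
  | base => exact r.integral_errY_one.1
  | succ k hk ih =>
    exact (integrable_of_lintegral_le (r.measurable_errY (by omega)) (fun _ => sq_nonneg _)
      ((ih.const_mul ((1 - q.momY k) ^ 2)).add (r.integrable_noiseY hk))
      (fun ω => add_nonneg (mul_nonneg (sq_nonneg _) (sq_nonneg _)) (r.noiseY_nonneg _))
      (r.lintegral_errY_succ hk)).1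

lemma integral_errX_succ_le :
    ∫ ω, P.errX q ε (k + 1) (P.randIter q ε x₁ y₁ lam₁ ζ (k + 1) ω) ∂μ ≤
      ∫ ω, ((1 - q.momX k) ^ 2 * P.errX q ε k (P.randIter q ε x₁ y₁ lam₁ ζ k ω)
        + P.noiseX q ε δ k (P.randIter q ε x₁ y₁ lam₁ ζ k ω)) ∂μ :=
  (integrable_of_lintegral_le (r.measurable_errX (by omega)) (fun _ => sq_nonneg _)
    (((r.integrable_errX hk).const_mul ((1 - q.momX k) ^ 2)).add (r.integrable_noiseX hk))
    (fun ω => add_nonneg (mul_nonneg (sq_nonneg _) (sq_nonneg _)) (r.noiseX_nonneg _))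
    (r.lintegral_errX_succ hk)).2

lemma integral_errY_succ_le :
    ∫ ω, P.errY q ε (k + 1) (P.randIter q ε x₁ y₁ lam₁ ζ (k + 1) ω) ∂μ ≤
      ∫ ω, ((1 - q.momY k) ^ 2 * P.errY q ε k (P.randIter q ε x₁ y₁ lam₁ ζ k ω)
        + P.noiseY q ε δ k (P.randIter q ε x₁ y₁ lam₁ ζ k ω)) ∂μ :=
  (integrable_of_lintegral_le (r.measurable_errY (by omega)) (fun _ => sq_nonneg _)
    (((r.integrable_errY hk).const_mul ((1 - q.momY k) ^ 2)).add (r.integrable_noiseY hk))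
    (fun ω => add_nonneg (mul_nonneg (sq_nonneg _) (sq_nonneg _)) (r.noiseY_nonneg _))
    (r.lintegral_errY_succ hk)).2

omit [IsProbabilityMeasure μ] in
lemma measurable_argMax_randIter :
    Measurable fun ω => P.argMax q k (P.randIter q ε x₁ y₁ lam₁ ζ k ω).x
      (P.randIter q ε x₁ y₁ lam₁ ζ k ω).lam :=
  measurable_argMax r.reg r.scaled.L_pos k (Iterate.measurable_x.comp (r.measurable_randIter hk))
    (Iterate.measurable_lam.comp (r.measurable_randIter hk)) fun ω => (r.feasible hk ω).x_mem

lemma integrable_argSq :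
    Integrable (fun ω => ‖P.argMax q k (P.randIter q ε x₁ y₁ lam₁ ζ k ω).x
      (P.randIter q ε x₁ y₁ lam₁ ζ k ω).lam‖ ^ 2) μ := by
  refine integrable_of_bounded ((r.measurable_argMax_randIter hk).norm.pow_const 2)
    (C := P.sigma ^ 2) fun ω => ?_
  rw [abs_of_nonneg (sq_nonneg _)]
  exact sq_norm_le_sigma r.reg.Y_comp (r.reg.argMax_mem q k (r.feasible hk ω).x_mem _)

lemma integrable_distSq :
    Integrable (fun ω => ‖(P.randIter q ε x₁ y₁ lam₁ ζ k ω).y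
      - P.argMax q k (P.randIter q ε x₁ y₁ lam₁ ζ k ω).x
        (P.randIter q ε x₁ y₁ lam₁ ζ k ω).lam‖ ^ 2) μ := by
  refine integrable_of_bounded ((((Iterate.measurable_y.comp (r.measurable_randIter hk)).sub
    (r.measurable_argMax_randIter hk)).norm).pow_const 2) (C := 4 * P.sigma ^ 2) fun ω => ?_
  rw [abs_of_nonneg (sq_nonneg _)]
  have hf := r.feasible hk ω
  exact sq_norm_sub_argMax_le r.reg k hf.x_mem hf.y_mem _

lemma integrable_maxVal :
    Integrable (fun ω => P.maxVal q k (P.randIter q ε x₁ y₁ lam₁ ζ k ω).x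
      (P.randIter q ε x₁ y₁ lam₁ ζ k ω).lam) μ := by
  obtain ⟨M, hM⟩ := r.reg.exists_boundedBy
  have := r.prob
  have hM0 := hM.nonneg
  refine integrable_of_bounded (measurable_maxVal r.reg r.meas r.scaled.L_pos k
      (Iterate.measurable_x.comp (r.measurable_randIter hk))
      (Iterate.measurable_lam.comp (r.measurable_randIter hk)) fun ω => (r.feasible hk ω).x_mem)
    (C := M + (‖lam₁‖ + k * (q.A₃ * M)) * M + q.L / 2 * P.sigma ^ 2) fun ω => ?_
  refine (abs_maxVal_le r.reg hM k r.scaled.L_pos (r.feasible hk ω).x_mem _).trans ?_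
  have := norm_lam_iter_le (ε := ε) r.reg r.adm hM r.x₁_mem r.y₁_mem r.lam₁_mem
    (fun n j => ζ n j ω) hk
  gcongr
  exact this

lemma integrable_primal :
    Integrable (fun ω => P.primal q k (P.randIter q ε x₁ y₁ lam₁ ζ k ω).x
      (P.randIter q ε x₁ y₁ lam₁ ζ k ω).y (P.randIter q ε x₁ y₁ lam₁ ζ k ω).lam) μ :=
  (r.integrable_maxVal hk).add ((r.integrable_distSq hk).const_mul _)

lemma integrable_core :
    Integrable (fun ω => P.core q ε k (P.randIter q ε x₁ y₁ lam₁ ζ k ω)) μ :=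
  ((r.integrable_primal hk).add ((r.integrable_errX hk).const_mul _)).add
    ((r.integrable_errY hk).const_mul _)

lemma integrable_potential :
    Integrable (fun ω => P.potential q ε k (P.randIter q ε x₁ y₁ lam₁ ζ k ω)) μ := by
  simp only [potential_eq]
  exact (((r.integrable_core hk).sub ((r.integrable_distSq hk).const_mul _)).sub
    ((r.integrable_argSq hk).const_mul _)).add (integrable_const _)

lemma S_eq : P.S q μ ε x₁ y₁ lam₁ ζ k = P.meanCore q μ ε x₁ y₁ lam₁ ζ k
      - 4 * Params.eta (k - 1) * q.alpha (k - 1) * q.L ^ 2 * P.meanDistSq q μ ε x₁ y₁ lam₁ ζ k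
      - argCoeff q k * P.meanArgSq q μ ε x₁ y₁ lam₁ ζ k
      + 12 * q.weightY k * q.rho k ^ 2 * P.sigma ^ 2 / q.b := by
  have i0 := r.integrable_core hk
  have i2 := (r.integrable_argSq hk).const_mul (argCoeff q k)
  have i1 := i0.sub ((r.integrable_distSq hk).const_mul
    (4 * Params.eta (k - 1) * q.alpha (k - 1) * q.L ^ 2))
  have e1 := integral_sub i0 ((r.integrable_distSq hk).const_mul
    (4 * Params.eta (k - 1) * q.alpha (k - 1) * q.L ^ 2))
  have e2 := integral_sub i1 i2
  have e3 := integral_add (i1.sub i2)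
    (integrable_const (12 * q.weightY k * q.rho k ^ 2 * P.sigma ^ 2 / (q.b : ℝ)))
  simp only [Pi.sub_apply, integral_const_mul, integral_const, probReal_univ, one_smul] at e1 e2 e3
  unfold S meanCore meanDistSq meanArgSq
  simp only [potential_eq]
  rw [e3, e2, e1]

lemma meanArgSq_mem :
    0 ≤ P.meanArgSq q μ ε x₁ y₁ lam₁ ζ k ∧ P.meanArgSq q μ ε x₁ y₁ lam₁ ζ k ≤ P.sigma ^ 2 := by
  refine ⟨integral_nonneg fun _ => sq_nonneg _, ?_⟩
  unfold meanArgSq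
  have := integral_mono (r.integrable_argSq hk) (integrable_const (P.sigma ^ 2)) fun ω =>
    sq_norm_le_sigma r.reg.Y_comp (r.reg.argMax_mem q k (r.feasible hk ω).x_mem _)
  simpa using this

lemma meanDistSq_mem :
    0 ≤ P.meanDistSq q μ ε x₁ y₁ lam₁ ζ k ∧
      P.meanDistSq q μ ε x₁ y₁ lam₁ ζ k ≤ 4 * P.sigma ^ 2 := by
  refine ⟨integral_nonneg fun _ => sq_nonneg _, ?_⟩
  unfold meanDistSq
  have := integral_mono (r.integrable_distSq hk) (integrable_const (4 * P.sigma ^ 2)) fun ω =>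
    sq_norm_sub_argMax_le r.reg k (r.feasible hk ω).x_mem (r.feasible hk ω).y_mem _
  simpa using this

end Run

end Problem

end ZORMPDPG

/-! ### Descent in expectation. -/

namespace ZORMPDPG

namespace Problem

variable {dx dy p : ℕ} {Ξ : Type*} [MeasurableSpace Ξ]

namespace Run

variable {P : Problem dx dy p Ξ} {q : Params} {U : Set (Vec dx)} {V : Set (Vec dy)} {l δ ε : ℝ}
  {x₁ : Vec dx} {y₁ : Vec dy} {lam₁ : Vec p} {Ω : Type*} [mΩ : MeasurableSpace Ω] {μ : Measure Ω}
  [IsProbabilityMeasure μ] {ζ : ℕ → Fin q.b → Ω → Ξ}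

variable (r : P.Run q U V l δ ε x₁ y₁ lam₁ μ ζ) {k : ℕ}

include r

/-- The expected descent of the core of the potential at a non-stationary iterate. -/
theorem meanCore_descent (hk : 2 ≤ k)
    (hgap : ENNReal.ofReal (ε ^ 2) < P.meanSqGap q μ ε x₁ y₁ lam₁ ζ k) :
    q.D₁ * (Params.eta k * q.alpha k) * ε ^ 2
      + P.meanCore q μ ε x₁ y₁ lam₁ ζ (k + 1) ≤
      P.meanCore q μ ε x₁ y₁ lam₁ ζ k
      + argCoeff q k * (P.meanArgSq q μ ε x₁ y₁ lam₁ ζ (k + 1)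
          - P.meanArgSq q μ ε x₁ y₁ lam₁ ζ k)
      + (q.rho k - q.rho (k + 1)) / 2 * P.sigma ^ 2
      + 2 * q.D₁ * (Params.eta k * q.alpha k) * q.rho k ^ 2 * P.sigma ^ 2
      + 2 * δ ^ 2 / q.b * (q.weightX k * q.momX k ^ 2 + q.weightY k * q.momY k ^ 2)
      + 1 / 8 * (q.D₁ * (Params.eta k * q.alpha k) * ε ^ 2) := by
  have hk1 : 1 ≤ k := by omega
  have hk2 : 1 ≤ k + 1 := by omega
  have hc : 0 < q.D₁ * (Params.eta k * q.alpha k) :=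
    mul_pos r.adm.D₁_pos (mul_pos (Params.eta_pos k) (r.adm.alpha_pos k))
  set c := q.D₁ * (Params.eta k * q.alpha k)
  set s := P.randIter q ε x₁ y₁ lam₁ ζ k with hs
  set s' := P.randIter q ε x₁ y₁ lam₁ ζ (k + 1) with hs'
  set C := (q.rho k - q.rho (k + 1)) / 2 * P.sigma ^ 2
      + 2 * q.D₁ * (Params.eta k * q.alpha k) * q.rho k ^ 2 * P.sigma ^ 2
      + 2 * δ ^ 2 / q.b * (q.weightX k * q.momX k ^ 2 + q.weightY k * q.momY k ^ 2)
      + 1 / 8 * (c * ε ^ 2) with hC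
  set eX := fun ω => (1 - q.momX k) ^ 2 * P.errX q ε k (s ω) + P.noiseX q ε δ k (s ω)
  set eY := fun ω => (1 - q.momY k) ^ 2 * P.errY q ε k (s ω) + P.noiseY q ε δ k (s ω)
  have iX : Integrable eX μ :=
    ((r.integrable_errX hk1).const_mul ((1 - q.momX k) ^ 2)).add (r.integrable_noiseX hk1)
  have iY : Integrable eY μ :=
    ((r.integrable_errY hk1).const_mul ((1 - q.momY k) ^ 2)).add (r.integrable_noiseY hk1)
  have iX' := iX.const_mul (q.weightX k)
  have iY' := iY.const_mul (q.weightY k)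
  have ia := (((r.integrable_argSq hk2).sub (r.integrable_argSq hk1)).const_mul (argCoeff q k))
  have ic := r.integrable_core hk1
  have ip := r.integrable_primal hk2
  -- Pointwise, only the predicted errors `eX` and `eY` are available. They are exchanged for the
  -- actual errors of the next state after integration, through `hwX` and `hwY`.
  set F : Ω → ℝ := fun ω => P.core q ε k (s ω)
    - P.primal q (k + 1) (s' ω).x (s' ω).y (s' ω).lam
    - q.weightX k * eX ω - q.weightY k * eY ω
    + argCoeff q k * (‖P.argMax q (k + 1) (s' ω).x (s' ω).lam‖ ^ 2
        - ‖P.argMax q k (s ω).x (s ω).lam‖ ^ 2) + C with hF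
  have iF : Integrable F μ :=
    ((((ic.sub ip).sub iX').sub iY').add ia).add (integrable_const C)
  have hpt : ∀ ω, c * ‖P.gap (q.alpha k) q.β (q.gamma k) (s ω).x (s ω).y (s ω).lam‖ ^ 2 ≤ F ω := by
    intro ω
    have h1 := potential_descent (δ := δ) r.reg r.adm r.scaled r.ε_pos r.stencil hk
      (r.feasible hk1 ω)
    have e : s' ω = P.step q ε (fun n j => ζ n j ω) k (s ω) := randIter_succ hk1 ω
    have ex : (s' ω).x = P.nextX q k (s ω) := by rw [e]; rfl
    have ey : (s' ω).y = P.nextY q k (s ω) := by rw [e]; rfl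
    have el : (s' ω).lam = P.nextLam q k (s ω) := by rw [e]; rfl
    simp only [hF, ex, ey, el, core]
    linarith only [h1, hC]
  have hint : ε ^ 2 < (∫ ω, F ω ∂μ) / c := by
    -- The gap is dominated by the integrable `F / c`; monotonicity of `lintegral` requires no
    -- measurability of the gap itself.
    have h1 : P.meanSqGap q μ ε x₁ y₁ lam₁ ζ k ≤ ENNReal.ofReal ((∫ ω, F ω ∂μ) / c) := by
      rw [← integral_div, ofReal_integral_eq_lintegral_ofReal (iF.div_const c)
        (ae_of_all _ fun ω => div_nonneg (le_trans (by positivity) (hpt ω)) hc.le)]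
      refine lintegral_mono fun ω => ?_
      rw [← ofReal_norm, ← ENNReal.ofReal_pow (norm_nonneg _)]
      refine ENNReal.ofReal_le_ofReal ?_
      rw [le_div_iff₀' hc]
      exact hpt ω
    by_contra! hcon
    exact absurd (hgap.trans_le (h1.trans (ENNReal.ofReal_le_ofReal hcon))) (lt_irrefl _)
  rw [lt_div_iff₀' hc] at hint
  have hX := r.integral_errX_succ_le hk1
  have hY := r.integral_errY_succ_le hk1
  have hwX := mul_le_mul_of_nonneg_left hX (r.adm.weightX_pos k).le
  have hwY := mul_le_mul_of_nonneg_left hY (r.adm.weightY_pos k).le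
  have e1 := integral_sub ic ip
  have e2 := integral_sub (ic.sub ip) iX'
  have e3 := integral_sub ((ic.sub ip).sub iX') iY'
  have e4 := integral_add (((ic.sub ip).sub iX').sub iY') ia
  have e5 := integral_add ((((ic.sub ip).sub iX').sub iY').add ia) (integrable_const C)
  have e6 := integral_sub (r.integrable_argSq hk2) (r.integrable_argSq hk1)
  have jX := (r.integrable_errX hk2).const_mul (q.weightX k)
  have jY := (r.integrable_errY hk2).const_mul (q.weightY k)
  have e7 := integral_add ip jX
  have e8 := integral_add (ip.add jX) jY
  have e9 : P.meanCore q μ ε x₁ y₁ lam₁ ζ (k + 1) = ∫ ω, (P.primal q (k + 1) (s' ω).x (s' ω).y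
      (s' ω).lam + q.weightX k * P.errX q ε (k + 1) (s' ω)
        + q.weightY k * P.errY q ε (k + 1) (s' ω)) ∂μ := rfl
  simp only [Pi.sub_apply, Pi.add_apply, integral_const_mul, integral_const, probReal_univ,
    one_smul] at e1 e2 e3 e4 e5 e6 e7 e8
  rw [e9, e8, e7]
  unfold meanArgSq meanCore
  have e10 : ∫ ω, F ω ∂μ = _ := e5
  rw [e10, e4, e3, e2, e1, e6] at hint
  linarith only [hint, hwX, hwY, hC]

end Run

end Problem

end ZORMPDPG

namespace ZORMPDPG

/-! ### Summation of the schedules -/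

/-- A discrete form of `d(x²) = 2/(13 x¹¹) d(x¹³)`, as is the next lemma in the other direction. In
terms of `u` and the increment, the difference of the two sides has only nonnegative coefficients.
-/
lemma mul_sq_sub_sq_le_pow_sub {u v : ℝ} (hu : 0 < u) (huv : u ≤ v) :
    13 * v ^ 5 * (v ^ 2 - u ^ 2) * u ^ 6 ≤ 2 * (v ^ 13 - u ^ 13) := by
  obtain ⟨y, hy, rfl⟩ : ∃ y, 0 ≤ y ∧ v = u + y := ⟨v - u, by linarith, by ring⟩
  rw [← sub_nonneg]
  ring_nf
  positivity

lemma pow_sub_mul_sq_le {t u : ℝ} (ht : 0 < t) (htu : t ≤ u) :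
    2 * (u ^ 13 - t ^ 13) * t ^ 2 ≤ 13 * u ^ 13 * (u ^ 2 - t ^ 2) := by
  obtain ⟨y, hy, rfl⟩ : ∃ y, 0 ≤ y ∧ u = t + y := ⟨u - t, by linarith, by ring⟩
  rw [← sub_nonneg]
  ring_nf
  positivity

namespace Params

lemma tau_mul_tau_le (k : ℕ) : tau k * tau (k + 2) ≤ tau (k + 1) ^ 2 := by
  have h0 := tau_pos k
  have h2 := tau_pos (k + 2)
  refine le_of_pow_le_pow_left₀ (n := 13) (by norm_num) (sq_nonneg _) ?_
  rw [mul_pow, pow_right_comm, tau_pow_thirteen, tau_pow_thirteen, tau_pow_thirteen]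
  push_cast
  nlinarith

variable (q : Params)

lemma argCoeff_eq (hL : q.L ≠ 0) (k : ℕ) :
    Problem.argCoeff q (k + 1) = 160 * q.A₂ / q.β ^ 2 *
      (tau (k + 1) ^ 5 * (tau (k + 1) ^ 2 - tau k ^ 2) / tau k ^ 2) := by
  have h0 := (tau_pos k).ne'
  have h1 := (tau_pos (k + 1)).ne'
  unfold Problem.argCoeff
  rw [alpha_eq, eta_eq, rho_succ_eq, rho_succ_eq]
  by_cases hβ : q.β = 0
  · simp [hβ]
  · field_simp

variable {q}

/-- Consecutive values are separated by `2 / (13 u⁸)` with `u = tau (k + 1)`; the thirteenth powers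
of neighbouring `tau` differ by exactly 1. -/
lemma argCoeff_succ_le (hL : 0 < q.L) (hA : 0 ≤ q.A₂) (k : ℕ) :
    Problem.argCoeff q (k + 2) ≤ Problem.argCoeff q (k + 1) := by
  have ht := tau_pos k
  have hu := tau_pos (k + 1)
  have h1 := mul_sq_sub_sq_le_pow_sub hu (tau_le_succ (k + 1))
  have h2 := pow_sub_mul_sq_le ht (tau_le_succ k)
  rw [tau_pow_thirteen (k + 1 + 1), tau_pow_thirteen (k + 1)] at h1
  rw [tau_pow_thirteen k] at h2
  have h3 := tau_pow_thirteen (k + 1)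
  rw [argCoeff_eq q hL.ne', argCoeff_eq q hL.ne']
  set t := tau k
  set u := tau (k + 1)
  set v := tau (k + 1 + 1)
  refine mul_le_mul_of_nonneg_left ?_ (by positivity)
  calc v ^ 5 * (v ^ 2 - u ^ 2) / u ^ 2 ≤ 2 / (13 * u ^ 8) := by
        rw [div_le_div_iff₀ (by positivity) (by positivity)]
        push_cast at h1
        calc v ^ 5 * (v ^ 2 - u ^ 2) * (13 * u ^ 8)
            = (13 * v ^ 5 * (v ^ 2 - u ^ 2) * u ^ 6) * u ^ 2 := by ring
          _ ≤ 2 * u ^ 2 := by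
            gcongr
            linarith
    _ ≤ u ^ 5 * (u ^ 2 - t ^ 2) / t ^ 2 := by
        rw [div_le_div_iff₀ (by positivity) (by positivity)]
        rw [tau_pow_thirteen] at h2
        push_cast at h2
        have e : u ^ 5 * (u ^ 2 - t ^ 2) * (13 * u ^ 8) = 13 * u ^ 13 * (u ^ 2 - t ^ 2) := by ring
        rw [e, h3]
        push_cast
        linarith

lemma argCoeff_nonneg (h : 0 ≤ q.A₂) (hL : 0 < q.L) (k : ℕ) : 0 ≤ Problem.argCoeff q (k + 1) := by
  have ht := tau_pos k
  have hu := tau_pos (k + 1)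
  have h1 : tau k ^ 2 ≤ tau (k + 1) ^ 2 := by
    have := tau_le_succ k
    gcongr
  have h2 : 0 ≤ tau (k + 1) ^ 2 - tau k ^ 2 := by linarith
  rw [argCoeff_eq q hL.ne']
  positivity

lemma argCoeff_le (hL : 0 < q.L) (hA : 0 ≤ q.A₂) {k : ℕ} (hk : 2 ≤ k) :
    Problem.argCoeff q k ≤ Problem.argCoeff q 2 := by
  induction k, hk using Nat.le_induction with
  | base => exact le_rfl
  | succ k hk ih =>
    obtain ⟨j, rfl⟩ : ∃ j, k = j + 1 := ⟨k - 1, by omega⟩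
    exact (argCoeff_succ_le hL hA j).trans ih

lemma argCoeff_two_le (hL : 0 < q.L) (hA : 0 ≤ q.alpha 2) :
    Problem.argCoeff q 2 ≤
      160 * q.alpha 2 * q.L ^ 2 * q.rho 2 / (eta 2 * q.β ^ 2 * q.rho 3 ^ 3) := by
  have h3 := Admissible.rho_pos hL 3
  have hη := eta_pos 2
  unfold Problem.argCoeff
  gcongr
  linarith

/-- The weight grows like `τ³` and `ρ²` decays like `τ⁻⁴` with the index shifted by one;
log-concavity of `tau` absorbs the shift. -/
lemma weightY_mul_rho_sq_succ_le (hA : 0 ≤ q.A₇) (k : ℕ) :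
    q.weightY (k + 2) * q.rho (k + 2) ^ 2 ≤ q.weightY (k + 1) * q.rho (k + 1) ^ 2 := by
  have ht := tau_pos k
  have hu := tau_pos (k + 1)
  have hv := tau_pos (k + 2)
  have h1 := tau_mul_tau_le k
  have h2 := tau_le_succ k
  rw [weightY_eq, weightY_eq, rho_succ_eq, rho_succ_eq]
  set t := tau k
  set u := tau (k + 1)
  set v := tau (k + 2)
  have h3 : v ^ 3 * t ^ 4 ≤ u ^ 3 * u ^ 4 := by
    calc v ^ 3 * t ^ 4 = (t * v) ^ 3 * t := by ring
      _ ≤ (u ^ 2) ^ 3 * u := by gcongr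
      _ = _ := by ring
  calc q.A₇ * v ^ 3 * (q.L / u ^ 2) ^ 2 = q.A₇ * q.L ^ 2 * (v ^ 3 / u ^ 4) := by ring
    _ ≤ q.A₇ * q.L ^ 2 * (u ^ 3 / t ^ 4) := by
      refine mul_le_mul_of_nonneg_left ?_ (by positivity)
      rw [div_le_div_iff₀ (by positivity) (by positivity)]
      exact h3
    _ = _ := by ring

lemma weightY_mul_rho_sq_le (hA : 0 ≤ q.A₇) {k : ℕ} (hk : 2 ≤ k) :
    q.weightY k * q.rho k ^ 2 ≤ q.weightY 2 * q.rho 2 ^ 2 := by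
  induction k, hk using Nat.le_induction with
  | base => exact le_rfl
  | succ k hk ih =>
    obtain ⟨j, rfl⟩ : ∃ j, k = j + 1 := ⟨k - 1, by omega⟩
    exact (weightY_mul_rho_sq_succ_le hA j).trans ih

lemma eta_mul_alpha (k : ℕ) :
    eta k * q.alpha k = q.A₂ * ((k : ℝ) + 2) ^ (-(9 / 13) : ℝ) := by
  have h := tau_pow k 9
  rw [eta_eq, alpha_eq, Real.rpow_neg (by positivity)]
  push_cast at h
  rw [← h]
  have := tau_pos k
  field_simp

lemma eta_mul_alpha_mul_rho_sq_le (hA : 0 ≤ q.A₂) {k : ℕ} (hk : 1 ≤ k) :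
    eta k * q.alpha k * q.rho k ^ 2 ≤ q.A₂ * q.L ^ 2 * (1 / ((k : ℝ) + 1)) := by
  obtain ⟨j, rfl⟩ : ∃ j, k = j + 1 := ⟨k - 1, by omega⟩
  have ht := tau_pos j
  have hu := tau_pos (j + 1)
  have h1 := tau_le_succ j
  have e : ((j + 1 : ℕ) : ℝ) + 1 = tau j ^ 13 := by
    rw [tau_pow_thirteen]
    push_cast
    ring
  rw [e, eta_eq, alpha_eq, rho_succ_eq]
  calc 1 / tau (j + 1) ^ 5 * (q.A₂ / tau (j + 1) ^ 4) * (q.L / tau j ^ 2) ^ 2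
      = q.A₂ * q.L ^ 2 * (1 / (tau (j + 1) ^ 9 * tau j ^ 4)) := by field_simp
    _ ≤ q.A₂ * q.L ^ 2 * (1 / (tau j ^ 9 * tau j ^ 4)) := by gcongr
    _ = _ := by ring

end Params

lemma sum_one_div_succ_le_log {T : ℕ} (hT : 2 ≤ T) :
    ∑ k ∈ Finset.Ico 2 T, 1 / ((k : ℝ) + 1) ≤ Real.log T := by
  induction T, hT using Nat.le_induction with
  | base => simpa using Real.log_nonneg (by norm_num : (1 : ℝ) ≤ 2)
  | succ T hT ih =>
    have hT0 : (0 : ℝ) < T := by exact_mod_cast (by omega : 0 < T)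
    rw [Finset.sum_Ico_succ_top hT]
    have h1 := Real.one_sub_inv_le_log_of_pos (x := ((T : ℝ) + 1) / T) (by positivity)
    rw [Real.log_div (by positivity) (by positivity), inv_div] at h1
    have h2 : 1 - (T : ℝ) / (T + 1) = 1 / ((T : ℝ) + 1) := by field_simp; ring
    push_cast
    linarith

/-- Bernoulli's inequality for the exponent 4/13 bounds each increment of `13/4 x^(4/13)` by
`x^(-9/13)`. -/
lemma rpow_sub_le_sum {T : ℕ} (hT : 2 ≤ T) :
    13 / 4 * ((T : ℝ) + 2) ^ (4 / 13 : ℝ) - 13 / 4 * (4 : ℝ) ^ (4 / 13 : ℝ) ≤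
      ∑ k ∈ Finset.Ico 2 T, ((k : ℝ) + 2) ^ (-(9 / 13) : ℝ) := by
  induction T, hT using Nat.le_induction with
  | base => norm_num
  | succ T hT ih =>
    rw [Finset.sum_Ico_succ_top hT]
    have hx : (0 : ℝ) < (T : ℝ) + 2 := by positivity
    set x := (T : ℝ) + 2 with hxd
    have h1 := rpow_one_add_le_one_add_mul_self (s := 1 / x) (p := 4 / 13)
      (by have : 0 < 1 / x := by positivity
          linarith) (by norm_num) (by norm_num)
    have e1 : ((T + 1 : ℕ) : ℝ) + 2 = x * (1 + 1 / x) := by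
      rw [mul_add, mul_one_div_cancel hx.ne']
      push_cast
      rw [hxd]
      ring
    have e2 : x ^ (-(9 / 13) : ℝ) = x ^ (4 / 13 : ℝ) * (1 / x) := by
      rw [mul_one_div, ← Real.rpow_sub_one hx.ne']
      norm_num
    rw [e1, Real.mul_rpow hx.le (by positivity), e2]
    have h2 := mul_le_mul_of_nonneg_left h1 (Real.rpow_nonneg hx.le (4 / 13 : ℝ))
    linarith

end ZORMPDPG

/-! ### Uniform bounds of the potential, telescoping and the rate. -/

namespace ZORMPDPG

namespace Problem

variable {dx dy p : ℕ} {Ξ : Type*} [MeasurableSpace Ξ]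

namespace Run

variable {P : Problem dx dy p Ξ} {q : Params} {U : Set (Vec dx)} {V : Set (Vec dy)}
  {l δ ε M : ℝ} {x₁ : Vec dx} {y₁ : Vec dy} {lam₁ : Vec p} {Ω : Type*} [mΩ : MeasurableSpace Ω]
  {μ : Measure Ω} [IsProbabilityMeasure μ] {ζ : ℕ → Fin q.b → Ω → Ξ}

variable (r : P.Run q U V l δ ε x₁ y₁ lam₁ μ ζ)

include r

omit [IsProbabilityMeasure μ] in
-- The negative multiple of the tracking error in the potential is dominated by the positive one in
-- its core, so it does not harm the lower bound.
lemma dist_coeff_le (k : ℕ) : 4 * Params.eta k * q.alpha k * q.L ^ 2 ≤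
    32 * q.alpha k * q.L ^ 2 / (q.β * q.rho (k + 1)) := by
  have hL := r.scaled.L_pos
  have hα := r.adm.alpha_pos k
  have hβ := r.adm.β_pos
  have hρ := Params.Admissible.rho_pos hL (k + 1)
  have h1 := r.adm.β_mul_L_le hL
  have h2 : q.β * q.rho (k + 1) ≤ q.β * q.L :=
    mul_le_mul_of_nonneg_left (Params.Admissible.rho_le hL _) hβ.le
  rw [le_div_iff₀ (by positivity)]
  have h3 := Params.eta_le_one k
  have h4 := Params.eta_pos k
  calc 4 * Params.eta k * q.alpha k * q.L ^ 2 * (q.β * q.rho (k + 1))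
      = (q.alpha k * q.L ^ 2) * (4 * Params.eta k * (q.β * q.rho (k + 1))) := by ring
    _ ≤ (q.alpha k * q.L ^ 2) * (4 * 1 * 1) := by
      gcongr
      linarith
    _ ≤ _ := by nlinarith [mul_pos hα (pow_pos hL 2)]

/-- A lower bound of the expected potential that does not depend on the accuracy. -/
lemma le_S (hM : P.BoundedBy M)
    (hfeas : ∀ x ∈ P.X, ∃ y ∈ P.Y, P.rel.holds (P.A x + P.B y) P.c) {k : ℕ} (hk : 2 ≤ k) :
    -M - q.L / 2 * P.sigma ^ 2 - argCoeff q 2 * P.sigma ^ 2 ≤ P.S q μ ε x₁ y₁ lam₁ ζ k := by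
  obtain ⟨j, rfl⟩ : ∃ j, k = j + 1 := ⟨k - 1, by omega⟩
  have hk1 : 1 ≤ j + 1 := by omega
  have hL := r.scaled.L_pos
  have hb := r.adm.b_pos'
  rw [r.S_eq hk1]
  obtain ⟨ha0, ha1⟩ := r.meanArgSq_mem hk1
  have h1 : -M - q.L / 2 * P.sigma ^ 2 + 4 * Params.eta j * q.alpha j * q.L ^ 2 *
      P.meanDistSq q μ ε x₁ y₁ lam₁ ζ (j + 1) ≤ P.meanCore q μ ε x₁ y₁ lam₁ ζ (j + 1) := by
    have i1 := (r.integrable_distSq hk1).const_mul (4 * Params.eta j * q.alpha j * q.L ^ 2)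
    have e1 := integral_add (integrable_const (μ := μ) (-M - q.L / 2 * P.sigma ^ 2)) i1
    simp only [integral_const_mul, integral_const, probReal_univ, one_smul] at e1
    unfold meanDistSq meanCore
    rw [← e1]
    refine integral_mono ((integrable_const _).add i1) (r.integrable_core hk1) fun ω => ?_
    have hf := r.feasible hk1 ω
    have h2 := le_maxVal r.reg hM (j + 1) hL hfeas hf.x_mem hf.lam_mem
    have h3 := mul_le_mul_of_nonneg_right (r.dist_coeff_le j)
      (sq_nonneg ‖(P.randIter q ε x₁ y₁ lam₁ ζ (j + 1) ω).y
        - P.argMax q (j + 1) (P.randIter q ε x₁ y₁ lam₁ ζ (j + 1) ω).x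
          (P.randIter q ε x₁ y₁ lam₁ ζ (j + 1) ω).lam‖)
    have h4 : 0 ≤ q.weightX j * P.errX q ε (j + 1) (P.randIter q ε x₁ y₁ lam₁ ζ (j + 1) ω) :=
      mul_nonneg (r.adm.weightX_pos j).le (sq_nonneg _)
    have h5 : 0 ≤ q.weightY j * P.errY q ε (j + 1) (P.randIter q ε x₁ y₁ lam₁ ζ (j + 1) ω) :=
      mul_nonneg (r.adm.weightY_pos j).le (sq_nonneg _)
    simp only [core, primal, Nat.add_sub_cancel]
    linarith
  have h2 : argCoeff q (j + 1) * P.meanArgSq q μ ε x₁ y₁ lam₁ ζ (j + 1) ≤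
      argCoeff q 2 * P.sigma ^ 2 :=
    mul_le_mul (Params.argCoeff_le hL r.adm.A₂_pos.le hk) ha1 ha0
      (Params.argCoeff_nonneg r.adm.A₂_pos.le hL 1)
  have h3 : 0 ≤ 12 * q.weightY (j + 1) * q.rho (j + 1) ^ 2 * P.sigma ^ 2 / q.b := by
    have := r.adm.weightY_pos (j + 1)
    positivity
  simp only [Nat.add_sub_cancel]
  linarith

omit [IsProbabilityMeasure μ] in
lemma thetaX_sq_le_one (hε : ε ≤ 1) (k : ℕ) : q.thetaX dx ε k ^ 2 ≤ q.thetaX dx 1 k ^ 2 := by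
  have hL := r.scaled.L_pos
  have := r.ε_pos
  unfold Params.thetaX
  gcongr

omit [IsProbabilityMeasure μ] in
lemma thetaY_sq_le_one (hε : ε ≤ 1) (k : ℕ) : q.thetaY dy ε k ^ 2 ≤ q.thetaY dy 1 k ^ 2 := by
  have hL := r.scaled.L_pos
  have := r.ε_pos
  unfold Params.thetaY
  gcongr

omit [IsProbabilityMeasure μ] in
lemma sq_step_le (hM : P.BoundedBy M) {k : ℕ} {s : Iterate dx dy p} (hs : P.Feasible s) :
    ‖P.nextX q k s - s.x‖ ^ 2 + ‖P.nextY q k s - s.y‖ ^ 2 ≤ 8 * M ^ 2 := by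
  obtain ⟨hx, hy, -⟩ := hs.next (q := q) (k := k) r.reg
  have h1 : ‖P.nextX q k s - s.x‖ ≤ 2 * M := by
    linarith [norm_sub_le (P.nextX q k s) s.x, hM.norm_x_le _ hx, hM.norm_x_le _ hs.x_mem]
  have h2 : ‖P.nextY q k s - s.y‖ ≤ 2 * M := by
    linarith [norm_sub_le (P.nextY q k s) s.y, hM.norm_y_le _ hy, hM.norm_y_le _ hs.y_mem]
  calc _ ≤ (2 * M) ^ 2 + (2 * M) ^ 2 := by gcongr
    _ = _ := by ring

/-- One step of the recursion from the first batch. For `ε ≤ 1` the smoothing parameter is replaced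
by its value at accuracy 1, which removes the dependence on `ε`. -/
lemma integral_errX_two_le (hM : P.BoundedBy M) (hε : ε ≤ 1) :
    ∫ ω, P.errX q ε 2 (P.randIter q ε x₁ y₁ lam₁ ζ 2 ω) ∂μ ≤
      δ ^ 2 / q.b + (2 * q.momX 1 ^ 2 * δ ^ 2 + 2 * (2 * (dx * q.L ^ 2 * q.thetaX dx 1 1 ^ 2)
        + 4 * q.L ^ 2 * (8 * M ^ 2))) / q.b := by
  have h1 := r.integral_errX_succ_le le_rfl
  obtain ⟨i1, h2⟩ := r.integral_errX_one
  have hb := r.adm.b_pos'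
  refine h1.trans ?_
  have e := integral_add i1 (integrable_const (μ := μ) ((2 * q.momX 1 ^ 2 * δ ^ 2
    + 2 * (2 * (dx * q.L ^ 2 * q.thetaX dx 1 1 ^ 2) + 4 * q.L ^ 2 * (8 * M ^ 2))) / (q.b : ℝ)))
  simp only [integral_const, probReal_univ, one_smul] at e
  refine (integral_mono ((i1.const_mul _).add (r.integrable_noiseX le_rfl))
    (i1.add (integrable_const _)) fun ω => ?_).trans (e.trans_le (by gcongr))
  have h3 := r.sq_step_le hM (k := 1) (r.feasible le_rfl ω)
  have h4 := r.thetaX_sq_le_one hε 1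
  have h5 : (1 - q.momX 1) ^ 2 ≤ 1 :=
    pow_le_one₀ (by linarith [r.adm.momX_le 1 le_rfl]) (by linarith [r.adm.momX_nonneg 1])
  have h6 : P.noiseX q ε δ 1 (P.randIter q ε x₁ y₁ lam₁ ζ 1 ω) ≤ (2 * q.momX 1 ^ 2 * δ ^ 2
      + 2 * (2 * (dx * q.L ^ 2 * q.thetaX dx 1 1 ^ 2) + 4 * q.L ^ 2 * (8 * M ^ 2))) / q.b := by
    unfold noiseX
    gcongr
  exact add_le_add (mul_le_of_le_one_left (sq_nonneg _) h5) h6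

lemma integral_errY_two_le (hM : P.BoundedBy M) (hε : ε ≤ 1) :
    ∫ ω, P.errY q ε 2 (P.randIter q ε x₁ y₁ lam₁ ζ 2 ω) ∂μ ≤
      δ ^ 2 / q.b + (2 * q.momY 1 ^ 2 * δ ^ 2 + 2 * (2 * (dy * q.L ^ 2 * q.thetaY dy 1 1 ^ 2)
        + 4 * q.L ^ 2 * (8 * M ^ 2))) / q.b := by
  have h1 := r.integral_errY_succ_le le_rfl
  obtain ⟨i1, h2⟩ := r.integral_errY_one
  have hb := r.adm.b_pos'
  refine h1.trans ?_
  have e := integral_add i1 (integrable_const (μ := μ) ((2 * q.momY 1 ^ 2 * δ ^ 2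
    + 2 * (2 * (dy * q.L ^ 2 * q.thetaY dy 1 1 ^ 2) + 4 * q.L ^ 2 * (8 * M ^ 2))) / (q.b : ℝ)))
  simp only [integral_const, probReal_univ, one_smul] at e
  refine (integral_mono ((i1.const_mul _).add (r.integrable_noiseY le_rfl))
    (i1.add (integrable_const _)) fun ω => ?_).trans (e.trans_le (by gcongr))
  have h3 := r.sq_step_le hM (k := 1) (r.feasible le_rfl ω)
  have h4 := r.thetaY_sq_le_one hε 1
  have h5 : (1 - q.momY 1) ^ 2 ≤ 1 :=
    pow_le_one₀ (by linarith [r.adm.momY_le 1 le_rfl]) (by linarith [r.adm.momY_nonneg 1])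
  have h6 : P.noiseY q ε δ 1 (P.randIter q ε x₁ y₁ lam₁ ζ 1 ω) ≤ (2 * q.momY 1 ^ 2 * δ ^ 2
      + 2 * (2 * (dy * q.L ^ 2 * q.thetaY dy 1 1 ^ 2) + 4 * q.L ^ 2 * (8 * M ^ 2))) / q.b := by
    unfold noiseY
    gcongr
  exact add_le_add (mul_le_of_le_one_left (sq_nonneg _) h5) h6

/-- An upper bound of the initial expected potential that does not depend on the accuracy. -/
lemma S_two_le (hM : P.BoundedBy M) (hε : ε ≤ 1) :
    P.S q μ ε x₁ y₁ lam₁ ζ 2 ≤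
      M + (‖lam₁‖ + 2 * (q.A₃ * M)) * M + q.L / 2 * P.sigma ^ 2
        + 32 * q.alpha 1 * q.L ^ 2 / (q.β * q.rho 2) * (4 * P.sigma ^ 2)
        + q.weightX 1 * (δ ^ 2 / q.b + (2 * q.momX 1 ^ 2 * δ ^ 2
          + 2 * (2 * (dx * q.L ^ 2 * q.thetaX dx 1 1 ^ 2) + 4 * q.L ^ 2 * (8 * M ^ 2))) / q.b)
        + q.weightY 1 * (δ ^ 2 / q.b + (2 * q.momY 1 ^ 2 * δ ^ 2
          + 2 * (2 * (dy * q.L ^ 2 * q.thetaY dy 1 1 ^ 2) + 4 * q.L ^ 2 * (8 * M ^ 2))) / q.b)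
        + 12 * q.weightY 2 * q.rho 2 ^ 2 * P.sigma ^ 2 / q.b := by
  have hk : 1 ≤ 2 := by norm_num
  have hL := r.scaled.L_pos
  have hα := r.adm.alpha_pos 1
  have hβ := r.adm.β_pos
  have hρ := Params.Admissible.rho_pos hL 2
  have hη := Params.eta_pos 1
  have hM0 := hM.nonneg
  have hX := mul_le_mul_of_nonneg_left (r.integral_errX_two_le hM hε) (r.adm.weightX_pos 1).le
  have hY := mul_le_mul_of_nonneg_left (r.integral_errY_two_le hM hε) (r.adm.weightY_pos 1).le
  have hd := (r.meanDistSq_mem hk).1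
  have ha := mul_nonneg (Params.argCoeff_nonneg r.adm.A₂_pos.le hL 1) (r.meanArgSq_mem hk).1
  have h1 : 0 ≤ 4 * Params.eta 1 * q.alpha 1 * q.L ^ 2 * P.meanDistSq q μ ε x₁ y₁ lam₁ ζ 2 := by
    positivity
  have jX := (r.integrable_errX hk).const_mul (q.weightX 1)
  have jY := (r.integrable_errY hk).const_mul (q.weightY 1)
  have e7 := integral_add (r.integrable_primal hk) jX
  have e8 := integral_add ((r.integrable_primal hk).add jX) jY
  have e9 : P.meanCore q μ ε x₁ y₁ lam₁ ζ 2 =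
      ∫ ω, (P.primal q 2 (P.randIter q ε x₁ y₁ lam₁ ζ 2 ω).x (P.randIter q ε x₁ y₁ lam₁ ζ 2 ω).y
        (P.randIter q ε x₁ y₁ lam₁ ζ 2 ω).lam
        + q.weightX 1 * P.errX q ε 2 (P.randIter q ε x₁ y₁ lam₁ ζ 2 ω)
        + q.weightY 1 * P.errY q ε 2 (P.randIter q ε x₁ y₁ lam₁ ζ 2 ω)) ∂μ := rfl
  have hp : ∫ ω, P.primal q 2 (P.randIter q ε x₁ y₁ lam₁ ζ 2 ω).x
      (P.randIter q ε x₁ y₁ lam₁ ζ 2 ω).y (P.randIter q ε x₁ y₁ lam₁ ζ 2 ω).lam ∂μ ≤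
      M + (‖lam₁‖ + 2 * (q.A₃ * M)) * M + q.L / 2 * P.sigma ^ 2
        + 32 * q.alpha 1 * q.L ^ 2 / (q.β * q.rho 2) * (4 * P.sigma ^ 2) := by
    have := integral_mono (r.integrable_primal hk) (integrable_const (μ := μ)
      (M + (‖lam₁‖ + 2 * (q.A₃ * M)) * M + q.L / 2 * P.sigma ^ 2
        + 32 * q.alpha 1 * q.L ^ 2 / (q.β * q.rho 2) * (4 * P.sigma ^ 2))) fun ω => by
      have hf := r.feasible hk ω
      have h2 := (le_abs_self _).trans (abs_maxVal_le r.reg hM 2 hL hf.x_mem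
        (P.randIter q ε x₁ y₁ lam₁ ζ 2 ω).lam)
      have h3 : ‖(P.randIter q ε x₁ y₁ lam₁ ζ 2 ω).lam‖ ≤ ‖lam₁‖ + (2 : ℕ) * (q.A₃ * M) :=
        norm_lam_iter_le (ε := ε) r.reg r.adm hM r.x₁_mem r.y₁_mem r.lam₁_mem
        (fun n j => ζ n j ω) hk
      push_cast at h3
      have h4 := mul_le_mul_of_nonneg_right h3 hM0
      have h5 := sq_norm_sub_argMax_le (q := q) r.reg 2 hf.x_mem hf.y_mem
        (P.randIter q ε x₁ y₁ lam₁ ζ 2 ω).lam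
      have h6 := mul_le_mul_of_nonneg_left h5
        (by positivity : 0 ≤ 32 * q.alpha 1 * q.L ^ 2 / (q.β * q.rho 2))
      exact add_le_add (by linarith) h6
    simpa only [integral_const, probReal_univ, one_smul] using this
  simp only [Pi.add_apply, integral_const_mul] at e7 e8
  rw [r.S_eq hk, e9, e8, e7]
  norm_num only [Nat.add_one_sub_one] at *
  linarith

/-- The descent estimates summed up to an index below which no iterate is stationary. -/
theorem sum_descent {T : ℕ} (hT : 2 ≤ T)
    (hgap : ∀ k, 2 ≤ k → k < T → ENNReal.ofReal (ε ^ 2) < P.meanSqGap q μ ε x₁ y₁ lam₁ ζ k) :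
    7 * ε ^ 2 / 8 * (q.D₁ * q.A₂ * ∑ k ∈ Finset.Ico 2 T, ((k : ℝ) + 2) ^ (-(9 / 13) : ℝ)) ≤
      (P.meanCore q μ ε x₁ y₁ lam₁ ζ 2 - argCoeff q 2 * P.meanArgSq q μ ε x₁ y₁ lam₁ ζ 2)
      - (P.meanCore q μ ε x₁ y₁ lam₁ ζ T - argCoeff q T * P.meanArgSq q μ ε x₁ y₁ lam₁ ζ T)
      + (argCoeff q 2 - argCoeff q T) * P.sigma ^ 2 + (q.rho 2 - q.rho T) / 2 * P.sigma ^ 2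
      + (2 * q.D₁ * q.A₂ * q.L ^ 2 * P.sigma ^ 2
        + 2 * δ ^ 2 * (q.A₄ ^ 2 * q.A₆ + q.A₅ ^ 2 * q.A₇) / q.b) *
        ∑ k ∈ Finset.Ico 2 T, 1 / ((k : ℝ) + 1) := by
  induction T, hT using Nat.le_induction with
  | base => simp
  | succ T hT ih =>
    have h1 := ih fun k hk hk' => hgap k hk (by omega)
    have h2 := r.meanCore_descent hT (hgap T hT (by omega))
    rw [Finset.sum_Ico_succ_top hT, Finset.sum_Ico_succ_top hT]
    have hb := r.adm.b_pos'
    have hD := r.adm.D₁_pos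
    have hA₆ := r.adm.A₆_pos
    have hA₇ := r.adm.A₇_pos
    have n1 : 2 * q.D₁ * (Params.eta T * q.alpha T) * q.rho T ^ 2 * P.sigma ^ 2 ≤
        2 * q.D₁ * q.A₂ * q.L ^ 2 * P.sigma ^ 2 * (1 / ((T : ℝ) + 1)) := by
      have := mul_le_mul_of_nonneg_left
        (Params.eta_mul_alpha_mul_rho_sq_le r.adm.A₂_pos.le (k := T) (by omega))
        (by positivity : 0 ≤ 2 * q.D₁ * P.sigma ^ 2)
      linarith
    have n2 : 2 * δ ^ 2 / q.b * (q.weightX T * q.momX T ^ 2 + q.weightY T * q.momY T ^ 2) ≤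
        2 * δ ^ 2 * (q.A₄ ^ 2 * q.A₆ + q.A₅ ^ 2 * q.A₇) / q.b * (1 / ((T : ℝ) + 1)) := by
      have hx := r.adm.weightX_mul_momX_sq_le T
      have hy := Params.Admissible.weightY_mul_momY_sq_le (q := q) T
      have ht : 1 / ((T : ℝ) + 2) ≤ 1 / ((T : ℝ) + 1) := by
        gcongr
        norm_num
      calc _ ≤ 2 * δ ^ 2 / q.b * (q.A₄ ^ 2 * q.A₆ * (1 / ((T : ℝ) + 2))
            + q.A₅ ^ 2 * q.A₇ * (1 / ((T : ℝ) + 2))) := by gcongr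
        _ = 2 * δ ^ 2 * (q.A₄ ^ 2 * q.A₆ + q.A₅ ^ 2 * q.A₇) / q.b * (1 / ((T : ℝ) + 2)) := by ring
        _ ≤ _ := by gcongr
    -- Summation by parts: since the coefficients decrease, the remainder is bounded by `σ²` times a
    -- telescoping sum.
    have n3 : (argCoeff q T - argCoeff q (T + 1)) * P.meanArgSq q μ ε x₁ y₁ lam₁ ζ (T + 1) ≤
        (argCoeff q T - argCoeff q (T + 1)) * P.sigma ^ 2 := by
      refine mul_le_mul_of_nonneg_left (r.meanArgSq_mem (by omega)).2 ?_
      obtain ⟨j, rfl⟩ : ∃ j, T = j + 1 := ⟨T - 1, by omega⟩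
      linarith [Params.argCoeff_succ_le r.scaled.L_pos r.adm.A₂_pos.le j]
    rw [Params.eta_mul_alpha] at h2 n1
    linarith only [h1, h2, n1, n2, n3]

/-- The convergence rate. -/
theorem rate {T : ℕ} (hT : 3 ≤ T)
    (hgap : ∀ k, 2 ≤ k → k < T → ENNReal.ofReal (ε ^ 2) < P.meanSqGap q μ ε x₁ y₁ lam₁ ζ k)
    {m : ℝ} (hm : m ≤ P.S q μ ε x₁ y₁ lam₁ ζ T) :
    7 * ε ^ 2 / 8 * (q.D₁ * q.A₂ *
        (13 / 4 * ((T : ℝ) + 2) ^ (4 / 13 : ℝ) - 13 / 4 * (4 : ℝ) ^ (4 / 13 : ℝ))) ≤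
      P.C₁ q (P.S q μ ε x₁ y₁ lam₁ ζ 2) m + P.C₂ q δ * Real.log ((T : ℝ) + 1) := by
  have h1 := r.sum_descent (by omega : 2 ≤ T) hgap
  have hL := r.scaled.L_pos
  have hD := r.adm.D₁_pos
  have hA₂ := r.adm.A₂_pos
  have hA₆ := r.adm.A₆_pos
  have hA₇ := r.adm.A₇_pos
  have hb := r.adm.b_pos'
  have hT0 : (0 : ℝ) < T := by exact_mod_cast (by omega : 0 < T)
  have h2 := mul_le_mul_of_nonneg_left (rpow_sub_le_sum (by omega : 2 ≤ T))
    (by positivity : 0 ≤ 7 * ε ^ 2 / 8 * (q.D₁ * q.A₂))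
  have hlog0 : 0 ≤ Real.log ((T : ℝ) + 1) := Real.log_nonneg (by linarith)
  have hlog : ∑ k ∈ Finset.Ico 2 T, 1 / ((k : ℝ) + 1) ≤ Real.log ((T : ℝ) + 1) :=
    (sum_one_div_succ_le_log (by omega)).trans (Real.log_le_log hT0 (by linarith))
  have h3 := mul_le_mul_of_nonneg_left hlog (by positivity :
    0 ≤ 2 * q.D₁ * q.A₂ * q.L ^ 2 * P.sigma ^ 2
        + 2 * δ ^ 2 * (q.A₄ ^ 2 * q.A₆ + q.A₅ ^ 2 * q.A₇) / q.b)
  -- This part of `C₂` is slack: the descent does not use it, and only its sign matters. Likewise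
  -- `h7` shows that the last summand of the potential contributes with a favourable sign.
  have h4 : 0 ≤ 36 * q.A₇ * dy * q.L ^ 2 * P.sigma ^ 2 / (13 * q.b) * Real.log ((T : ℝ) + 1) := by
    positivity
  rw [r.S_eq (by omega : 1 ≤ T)] at hm
  rw [r.S_eq (by norm_num : 1 ≤ 2)]
  have hd2 := (r.meanDistSq_mem (by norm_num : 1 ≤ 2)).2
  have hdT := (r.meanDistSq_mem (by omega : 1 ≤ T)).1
  have hα := r.adm.alpha_pos 1
  have hη := Params.eta_pos 1
  have hα' := r.adm.alpha_pos (T - 1)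
  have hη' := Params.eta_pos (T - 1)
  have h5 := mul_le_mul_of_nonneg_left hd2
    (by positivity : 0 ≤ 4 * Params.eta 1 * q.alpha 1 * q.L ^ 2)
  have h6 : 0 ≤ 4 * Params.eta (T - 1) * q.alpha (T - 1) * q.L ^ 2 *
      P.meanDistSq q μ ε x₁ y₁ lam₁ ζ T := by positivity
  have h7 : 12 * q.weightY T * q.rho T ^ 2 * P.sigma ^ 2 / q.b ≤
      12 * q.weightY 2 * q.rho 2 ^ 2 * P.sigma ^ 2 / q.b := by
    have := mul_le_mul_of_nonneg_left (Params.weightY_mul_rho_sq_le hA₇.le (by omega : 2 ≤ T))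
      (by positivity : 0 ≤ 12 * P.sigma ^ 2 / (q.b : ℝ))
    calc _ = 12 * P.sigma ^ 2 / (q.b : ℝ) * (q.weightY T * q.rho T ^ 2) := by ring
      _ ≤ _ := this
      _ = _ := by ring
  have h8 := mul_le_mul_of_nonneg_right (Params.argCoeff_two_le hL (r.adm.alpha_pos 2).le)
    (sq_nonneg P.sigma)
  have h9 : 0 ≤ argCoeff q T * P.sigma ^ 2 := by
    obtain ⟨j, rfl⟩ : ∃ j, T = j + 1 := ⟨T - 1, by omega⟩
    exact mul_nonneg (Params.argCoeff_nonneg hA₂.le hL j) (sq_nonneg _)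
  have h10 : 0 ≤ q.rho T / 2 * P.sigma ^ 2 := by
    have := Params.Admissible.rho_pos hL T
    positivity
  unfold C₁ C₂
  norm_num only [Nat.add_one_sub_one] at *
  linarith only [h1, h2, h3, h4, hm, h5, h6, h7, h8, h9, h10]

end Run

end Problem

end ZORMPDPG

namespace ZORMPDPG

/-! ### From the rate to the iteration complexity -/

/-- A crude a priori bound from `log u ≤ 2 √u`, good enough inside a logarithm. -/
lemma sqrt_le_of_le_add_log {u A B : ℝ} (hu : 1 ≤ u) (hA : 0 ≤ A) (hB : 0 ≤ B)
    (h : u ≤ A + B * Real.log u) : √u ≤ A + 2 * B := by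
  have h1 : 1 ≤ √u := Real.one_le_sqrt.2 hu
  have h2 : √u * √u = u := Real.mul_self_sqrt (by linarith)
  have h3 : Real.log u ≤ 2 * √u := by
    have := Real.log_le_sub_one_of_pos (by linarith : 0 < √u)
    rw [Real.log_sqrt (by linarith)] at this
    linarith
  have h4 : √u * √u ≤ (A + 2 * B) * √u := by
    rw [h2]
    calc u ≤ A + B * (2 * √u) := h.trans (by gcongr)
      _ ≤ A * √u + B * (2 * √u) := by
        gcongr
        exact le_mul_of_one_le_right hA h1
      _ = _ := by ring
  exact le_of_mul_le_mul_right h4 (by linarith)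

/-- Rewrites the rate in the single variable `u = (T + 2)^(4/13)`. The summand 4 bounds `4^(4/13)`
and also covers `T < 3`, where the hypothesis is void. -/
lemma rpow_le_add_log {a C c ε : ℝ} (ha : 0 < a) (hc : 0 ≤ c) (hε : 0 < ε) {T : ℕ}
    (h : 3 ≤ T → ε ^ 2 * (a * (((T : ℝ) + 2) ^ (4 / 13 : ℝ) - (4 : ℝ) ^ (4 / 13 : ℝ))) ≤
      C + c * Real.log ((T : ℝ) + 1)) :
    ((T : ℝ) + 2) ^ (4 / 13 : ℝ) ≤ (4 + ε⁻¹ ^ 2 * (|C| / a))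
      + ε⁻¹ ^ 2 * (13 / 4 * (c / a)) * Real.log (((T : ℝ) + 2) ^ (4 / 13 : ℝ)) := by
  have h4 : (4 : ℝ) ^ (4 / 13 : ℝ) ≤ 4 := by
    calc (4 : ℝ) ^ (4 / 13 : ℝ) ≤ 4 ^ (1 : ℝ) :=
          Real.rpow_le_rpow_of_exponent_le (by norm_num) (by norm_num)
      _ = 4 := Real.rpow_one 4
  have hT0 : (0 : ℝ) ≤ T := Nat.cast_nonneg T
  rw [Real.log_rpow (by positivity)]
  have hlog : 0 ≤ Real.log ((T : ℝ) + 2) := Real.log_nonneg (by linarith)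
  have e : ε⁻¹ ^ 2 * (13 / 4 * (c / a)) * (4 / 13 * Real.log ((T : ℝ) + 2)) =
      ε⁻¹ ^ 2 * (c / a * Real.log ((T : ℝ) + 2)) := by ring
  rw [e]
  rcases Nat.lt_or_ge T 3 with hT | hT
  · have hT' : (T : ℝ) ≤ 2 := by exact_mod_cast (by omega : T ≤ 2)
    have h5 : ((T : ℝ) + 2) ^ (4 / 13 : ℝ) ≤ (4 : ℝ) ^ (4 / 13 : ℝ) := by
      gcongr
      linarith
    have h6 : 0 ≤ ε⁻¹ ^ 2 * (|C| / a) := by positivity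
    have h7 : 0 ≤ ε⁻¹ ^ 2 * (c / a * Real.log ((T : ℝ) + 2)) := by positivity
    linarith
  · have h1 := h hT
    have hl : Real.log ((T : ℝ) + 1) ≤ Real.log ((T : ℝ) + 2) :=
      Real.log_le_log (by positivity) (by linarith)
    have h2 : C + c * Real.log ((T : ℝ) + 1) ≤ |C| + c * Real.log ((T : ℝ) + 2) := by
      gcongr
      exact le_abs_self C
    have h3 : ((T : ℝ) + 2) ^ (4 / 13 : ℝ) - (4 : ℝ) ^ (4 / 13 : ℝ) ≤
        (|C| + c * Real.log ((T : ℝ) + 2)) / (ε ^ 2 * a) := by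
      rw [le_div_iff₀ (by positivity)]
      linarith
    have e2 : (|C| + c * Real.log ((T : ℝ) + 2)) / (ε ^ 2 * a) =
        ε⁻¹ ^ 2 * (|C| / a) + ε⁻¹ ^ 2 * (c / a * Real.log ((T : ℝ) + 2)) := by
      field_simp
    linarith

lemma one_le_rpow_index (T : ℕ) : 1 ≤ ((T : ℝ) + 2) ^ (4 / 13 : ℝ) :=
  Real.one_le_rpow (by linarith [(Nat.cast_nonneg T : (0 : ℝ) ≤ T)]) (by norm_num)

/-- A power grows faster than a logarithm. -/
lemma exists_lt_rpow_of_log {a C c ε : ℝ} (ha : 0 < a) (hc : 0 ≤ c) (hε : 0 < ε) :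
    ∃ T : ℕ, 3 ≤ T ∧ C + c * Real.log ((T : ℝ) + 1) <
      ε ^ 2 * (a * (((T : ℝ) + 2) ^ (4 / 13 : ℝ) - (4 : ℝ) ^ (4 / 13 : ℝ))) := by
  by_contra! hcon
  set A := 4 + ε⁻¹ ^ 2 * (|C| / a)
  set B := ε⁻¹ ^ 2 * (13 / 4 * (c / a))
  have hA : 0 ≤ A := by positivity
  have hB : 0 ≤ B := by positivity
  have h1 : ∀ T : ℕ, ((T : ℝ) + 2) ^ (4 / 13 : ℝ) ≤ (A + 2 * B) ^ 2 := fun T => by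
    have h2 := sqrt_le_of_le_add_log (one_le_rpow_index T) hA hB
      (rpow_le_add_log ha hc hε (hcon T))
    exact (Real.sqrt_le_left (by positivity)).1 h2
  obtain ⟨T, hT⟩ := exists_nat_gt (((A + 2 * B) ^ 2) ^ (13 / 4 : ℝ))
  have h3 := Real.rpow_le_rpow (by positivity) (h1 T) (by norm_num : (0 : ℝ) ≤ 13 / 4)
  rw [← Real.rpow_mul (by positivity)] at h3
  norm_num at h3
  norm_num at hT
  linarith

/-- The solution of the implicit inequality for the number of iterations. -/
lemma exists_complexity_const {a c : ℝ} (C : ℝ) (ha : 0 < a) (hc : 0 ≤ c) :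
    ∃ K : ℝ, 0 < K ∧ ∀ ε : ℝ, 0 < ε → ε ≤ 1 / 2 → ∀ T : ℕ,
      (3 ≤ T → ε ^ 2 * (a * (((T : ℝ) + 2) ^ (4 / 13 : ℝ) - (4 : ℝ) ^ (4 / 13 : ℝ))) ≤
        C + c * Real.log ((T : ℝ) + 1)) →
      (T : ℝ) ≤ K * ε ^ (-(13 / 2) : ℝ) * Real.log (1 / ε) ^ (13 / 4 : ℝ) := by
  set A := 1 + |C| / a with hA
  set B := 13 / 4 * (c / a) with hB
  have hA1 : 1 ≤ A := by
    have : 0 ≤ |C| / a := by positivity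
    linarith
  have hB0 : 0 ≤ B := by positivity
  have hs : 0 ≤ Real.log (A + 2 * B) := Real.log_nonneg (by linarith)
  have hlog2 : 0 < Real.log 2 := Real.log_pos (by norm_num)
  -- Division by `log 2` lets the constant term be absorbed into `log (1/ε)`, which is at least `log
  -- 2` for `ε ≤ 1/2`.
  set K₀ := (A + B * (2 * Real.log (A + 2 * B))) / Real.log 2 + 4 * B with hK₀
  have hK : 0 < K₀ := by positivity
  refine ⟨K₀ ^ (13 / 4 : ℝ), by positivity, fun ε hε hε2 T hT => ?_⟩
  have hE : Real.log 2 ≤ Real.log (1 / ε) := by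
    refine Real.log_le_log (by norm_num) ?_
    rw [le_div_iff₀ hε]
    linarith
  have hE0 : 0 < Real.log (1 / ε) := hlog2.trans_le hE
  have hi2 : 2 ≤ ε⁻¹ := by
    rw [le_inv_comm₀ (by norm_num) hε]
    linarith
  have hi4 : 4 ≤ ε⁻¹ ^ 2 := by nlinarith
  set u := ((T : ℝ) + 2) ^ (4 / 13 : ℝ) with hu
  have hu1 : 1 ≤ u := one_le_rpow_index T
  have h1 : u ≤ ε⁻¹ ^ 2 * A + ε⁻¹ ^ 2 * B * Real.log u := by
    refine (rpow_le_add_log ha hc hε hT).trans ?_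
    rw [hA, mul_add, mul_one]
    gcongr
  have h2 := sqrt_le_of_le_add_log hu1 (by positivity) (by positivity) h1
  -- Bootstrap: the crude bound of `√u` is put back into the logarithm, so that `log u` costs only a
  -- multiple of `log (1/ε)`.
  have h3 : Real.log u ≤ 4 * Real.log (1 / ε) + 2 * Real.log (A + 2 * B) := by
    have h4 := Real.log_le_log (Real.sqrt_pos.2 (by linarith)) h2
    have e : ε⁻¹ ^ 2 * A + 2 * (ε⁻¹ ^ 2 * B) = ε⁻¹ ^ 2 * (A + 2 * B) := by ring
    rw [Real.log_sqrt (by linarith), e, Real.log_mul (by positivity) (by positivity),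
      Real.log_pow] at h4
    rw [one_div]
    push_cast at h4
    linarith
  have h5 : u ≤ ε⁻¹ ^ 2 * (Real.log (1 / ε) * K₀) := by
    calc u ≤ ε⁻¹ ^ 2 * A + ε⁻¹ ^ 2 * B * (4 * Real.log (1 / ε) + 2 * Real.log (A + 2 * B)) :=
          h1.trans (by gcongr)
      _ = ε⁻¹ ^ 2 * ((A + B * (2 * Real.log (A + 2 * B))) / Real.log 2 * Real.log 2
            + 4 * B * Real.log (1 / ε)) := by
          rw [div_mul_cancel₀ _ hlog2.ne']
          ring
      _ ≤ ε⁻¹ ^ 2 * ((A + B * (2 * Real.log (A + 2 * B))) / Real.log 2 * Real.log (1 / ε)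
            + 4 * B * Real.log (1 / ε)) := by gcongr
      _ = _ := by
          rw [hK₀]
          ring
  have h6 := Real.rpow_le_rpow (by positivity) h5 (by norm_num : (0 : ℝ) ≤ 13 / 4)
  have e1 : u ^ (13 / 4 : ℝ) = (T : ℝ) + 2 := by
    rw [hu, ← Real.rpow_mul (by positivity)]
    norm_num
  have e2 : (ε⁻¹ ^ 2 : ℝ) ^ (13 / 4 : ℝ) = ε ^ (-(13 / 2) : ℝ) := by
    rw [← Real.rpow_natCast, ← Real.rpow_mul (by positivity), Real.inv_rpow hε.le,
      ← Real.rpow_neg hε.le]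
    norm_num
  rw [e1, Real.mul_rpow (by positivity) (by positivity), e2,
    Real.mul_rpow hE0.le hK.le] at h6
  calc (T : ℝ) ≤ (T : ℝ) + 2 := by linarith
    _ ≤ _ := h6
    _ = _ := by ring

namespace Problem

variable {dx dy p : ℕ} {Ξ : Type*} [MeasurableSpace Ξ] {P : Problem dx dy p Ξ} {q : Params}

lemma C₁_mono {S S' m m' : ℝ} (hS : S ≤ S') (hm : m' ≤ m) : P.C₁ q S m ≤ P.C₁ q S' m' := by
  unfold C₁
  linarith

lemma C₂_nonneg {nA nB : ℝ} (hq : q.Admissible nA nB) (δ : ℝ) : 0 ≤ P.C₂ q δ := by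
  have := hq.A₂_pos
  have := hq.A₆_pos
  have := hq.A₇_pos
  have := hq.D₁_pos
  unfold C₂
  positivity

end Problem

end ZORMPDPG

/-! ### Assembly of the theorem with constants uniform in `ε`. -/

theorem mainTheorem4 {dx dy p : ℕ} {Ξ : Type*} [MeasurableSpace Ξ]
    (P : ZORMPDPG.Problem dx dy p Ξ) (q : ZORMPDPG.Params)
    -- the feasible sets, and the feasibility of the coupled constraint
    (hXne : P.X.Nonempty) (hXconv : Convex ℝ P.X) (hXcomp : IsCompact P.X)
    (hYne : P.Y.Nonempty) (hYconv : Convex ℝ P.Y) (hYcomp : IsCompact P.Y)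
    (hfeas : ∀ x ∈ P.X, ∃ y ∈ P.Y, P.rel.holds (P.A x + P.B y) P.c)
    -- the stochastic objective: defined on open sets around `X` and `Y`, smooth, concave in `y`
    (hD : IsProbabilityMeasure P.D)
    (U : Set (ZORMPDPG.Vec dx)) (V : Set (ZORMPDPG.Vec dy))
    (hU : IsOpen U) (hV : IsOpen V) (hXU : P.X ⊆ U) (hYV : P.Y ⊆ V)
    (hGmeas : Measurable
      (fun z : (ZORMPDPG.Vec dx × ZORMPDPG.Vec dy) × Ξ => P.G z.1.1 z.1.2 z.2))
    (hGint : ∀ x ∈ U, ∀ y ∈ V, Integrable (P.G x y) P.D)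
    (l : ℝ) (hl : 0 < l) (hsmooth : P.SmoothOn U V l)
    (hconc : ∀ x ∈ P.X, ConcaveOn ℝ P.Y (P.g x))
    -- the constants
    (hL : q.L = max (l + q.rho 1) (max ‖P.A‖ ‖P.B‖))
    (hq : q.Admissible ‖P.A‖ ‖P.B‖)
    (δ : ℝ) (hδ : 0 < δ)
    -- the initial point and the i.i.d. samples
    (x₁ : ZORMPDPG.Vec dx) (y₁ : ZORMPDPG.Vec dy) (lam₁ : ZORMPDPG.Vec p)
    (hx₁ : x₁ ∈ P.X) (hy₁ : y₁ ∈ P.Y) (hlam₁ : lam₁ ∈ P.Lam)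
    {Ω : Type*} [MeasurableSpace Ω] (μ : Measure Ω) [IsProbabilityMeasure μ]
    (ζ : ℕ → Fin q.b → Ω → Ξ)
    (hζmeas : ∀ k j, Measurable (ζ k j))
    (hζlaw : ∀ k j, μ.map (ζ k j) = P.D)
    (hζindep : iIndepFun (fun i : ℕ × Fin q.b => ζ i.1 i.2) μ) :
    ∃ K : ℝ, 0 < K ∧ ∀ ε : ℝ, 0 < ε → P.StencilIn q ε U V → P.VarianceBound q ε δ →
      -- the values `S_k(x_k, y_k, λ_k)` are expectations of integrable variables, bounded below
      (∀ k, 2 ≤ k →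
        Integrable (fun ω => P.potential q ε k (P.randIter q ε x₁ y₁ lam₁ ζ k ω)) μ) ∧
      BddBelow (P.S q μ ε x₁ y₁ lam₁ ζ '' Set.Ici 2) ∧
      -- an `ε`-stationary index exists, and the first one is bounded
      (P.stationaryIndices q μ ε x₁ y₁ lam₁ ζ).Nonempty ∧
      (3 ≤ P.T₂ q μ ε x₁ y₁ lam₁ ζ →
        7 * ε ^ 2 / 8 ≤
          (P.C₁ q (P.S q μ ε x₁ y₁ lam₁ ζ 2) (sInf (P.S q μ ε x₁ y₁ lam₁ ζ '' Set.Ici 2))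
              + P.C₂ q δ * Real.log ((P.T₂ q μ ε x₁ y₁ lam₁ ζ : ℝ) + 1)) /
            (q.D₁ * q.A₂ *
              (13 / 4 * ((P.T₂ q μ ε x₁ y₁ lam₁ ζ : ℝ) + 2) ^ (4 / 13 : ℝ)
                - 13 / 4 * (4 : ℝ) ^ (4 / 13 : ℝ)))) ∧
      -- the resulting iteration complexity
      (ε ≤ 1 / 2 →
        (P.T₂ q μ ε x₁ y₁ lam₁ ζ : ℝ) ≤
          K * ε ^ (-(13 / 2) : ℝ) * Real.log (1 / ε) ^ (13 / 4 : ℝ)) := by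
  have hsc := ZORMPDPG.Problem.Scaled.of_eq hl hL
  have hreg : P.Regular U V l :=
    ⟨hXne, hXconv, hXcomp, hYne, hYconv, hYcomp, hXU, hYV, hl, hsmooth.smoothMean hU hV hGint,
      hconc⟩
  obtain ⟨M, hM⟩ := hreg.exists_boundedBy
  have ha : 0 < 7 / 8 * (q.D₁ * q.A₂) * (13 / 4) := by
    have := hq.D₁_pos
    have := hq.A₂_pos
    positivity
  have hc := ZORMPDPG.Problem.C₂_nonneg (P := P) hq δ
  -- The omitted witnesses here and for `Smin` are the right-hand sides of `S_two_le` and `le_S`.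
  -- They are fixed before `ε`, which makes `K` independent of it.
  obtain ⟨Smax, hSmax⟩ : ∃ Smax : ℝ, ∀ ε : ℝ, P.Run q U V l δ ε x₁ y₁ lam₁ μ ζ → ε ≤ 1 →
      P.S q μ ε x₁ y₁ lam₁ ζ 2 ≤ Smax := ⟨_, fun ε r hε => r.S_two_le hM hε⟩
  obtain ⟨Smin, hSmin⟩ : ∃ Smin : ℝ, ∀ ε : ℝ, P.Run q U V l δ ε x₁ y₁ lam₁ μ ζ → ∀ k, 2 ≤ k →
      Smin ≤ P.S q μ ε x₁ y₁ lam₁ ζ k := ⟨_, fun ε r k hk => r.le_S hM hfeas hk⟩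
  obtain ⟨K, hK, hcomp⟩ := ZORMPDPG.exists_complexity_const (P.C₁ q Smax Smin) ha hc
  refine ⟨K, hK, fun ε hε hst hvar => ?_⟩
  have r : P.Run q U V l δ ε x₁ y₁ lam₁ μ ζ :=
    ⟨hreg, hq, hsc, hD, hU, hV, hGmeas, hGint, hsmooth, hx₁, hy₁, hlam₁, hζmeas, hζlaw, hζindep,
      hε, hst, hvar⟩
  have hbdd : ∀ s ∈ P.S q μ ε x₁ y₁ lam₁ ζ '' Set.Ici 2, Smin ≤ s := by
    rintro _ ⟨k, hk, rfl⟩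
    exact hSmin ε r k hk
  -- Without a stationary index the rate would hold for every `T ≥ 3`, against the growth of a power
  -- over a logarithm.
  have hne : (P.stationaryIndices q μ ε x₁ y₁ lam₁ ζ).Nonempty := by
    by_contra hemp
    rw [Set.not_nonempty_iff_eq_empty] at hemp
    obtain ⟨T, hT, hlt⟩ := ZORMPDPG.exists_lt_rpow_of_log
      (C := P.C₁ q (P.S q μ ε x₁ y₁ lam₁ ζ 2) Smin) ha hc hε
    have h1 := r.rate hT (fun k hk _ => by
      by_contra! hle
      have : k ∈ P.stationaryIndices q μ ε x₁ y₁ lam₁ ζ := ⟨hk, hle⟩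
      rw [hemp] at this
      exact this) (hSmin ε r T (by omega))
    linarith
  have hgap : ∀ k, 2 ≤ k → k < P.T₂ q μ ε x₁ y₁ lam₁ ζ →
      ENNReal.ofReal (ε ^ 2) < P.meanSqGap q μ ε x₁ y₁ lam₁ ζ k := fun k hk hkT => by
    by_contra! hle
    exact Nat.notMem_of_lt_sInf hkT ⟨hk, hle⟩
  refine ⟨fun k hk => r.integrable_potential (by omega), ⟨Smin, hbdd⟩, hne, fun hT => ?_,
    fun hε2 => hcomp ε hε hε2 _ fun hT => ?_⟩
  · have h1 := r.rate hT hgap (csInf_le ⟨Smin, hbdd⟩ ⟨_, (by omega : 2 ≤ _), rfl⟩)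
    have hT' : (3 : ℝ) ≤ P.T₂ q μ ε x₁ y₁ lam₁ ζ := by exact_mod_cast hT
    have h2 : (4 : ℝ) ^ (4 / 13 : ℝ) < ((P.T₂ q μ ε x₁ y₁ lam₁ ζ : ℝ) + 2) ^ (4 / 13 : ℝ) :=
      Real.rpow_lt_rpow (by norm_num) (by linarith) (by norm_num)
    rw [le_div_iff₀ (mul_pos (mul_pos hq.D₁_pos hq.A₂_pos) (by linarith))]
    exact h1
  -- For the complexity the rate is taken with the uniform lower bound instead of the infimum, and
  -- `S_2` is enlarged to `Smax`.
  · have h1 := r.rate hT hgap (hSmin ε r _ (by omega))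
    have h2 := ZORMPDPG.Problem.C₁_mono (P := P) (q := q) (hSmax ε r (by linarith))
      (le_refl Smin)
    linarith
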